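/- **Theorem 4.1 (Local Lyapunov property in $L^p$).** Let $m\ge 3$ be an integer and $2\le p<\infty$. There are constants $C,K>0$ depending only on $m$ and $p$ such that the following holds for every viscosity $\nu>0$ and every $0<T\le\infty$ (with $[0,T]$ read as $[0,\infty)$ if $T=\infty$). Let $u,\omega$ be vector fields on $\mathbb R^m$, depending on time, with $$u,\ \omega\in C([0,T];L^m(\mathbb R^m;\mathbb R^m)\cap L^p(\mathbb R^m;\mathbb R^m)),\qquad \nabla u,\ \nabla\omega\in L^1_{loc}((0,T);L^p(\mathbb R^m)),$$ where $\nabla$ is the weak spatial gradient, and suppose that $\nabla\cdot u=0$, $\nabla\cdot\omega=0$ and that the vorticity equation $$\partial_t\omega-\nu\Delta\omega+u\cdot\nabla\omega-\omega\cdot\nabla u=0$$ holds on $\mathbb R^m\times(0,T)$ in the sense of distributions. For a vector field $\varphi$ put $Q_p(\varphi)=\int_{\mathbb R^m}|\varphi|^{p-2}|\nabla\varphi|^2\,dx$ with $|\nabla\varphi|^2=\sum_i|\partial_i\varphi|^2$. Then $t\mapsto\|\omega(t)\|_p^p$ is locally absolutely continuous on $(0,T)$, $Q_p(\omega(t))$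 is finite for a.e. $t\in(0,T)$ and locally integrable in $t$ on $(0,T)$, and for a.e. $t\in(0,T)$ the function $t\mapsto\|\omega(t)\|_p^p$ is differentiable with $$\partial_t\|\omega(t)\|_p^p\le -C\,(\nu-K\|u(t)\|_m)\,Q_p(\omega(t)).$$ Consequently, if $J\subseteq[0,T]$ is an interval and $K\|u(t)\|_m\le\nu$ for all $t\in J$, then $t\mapsto\|\omega(t)\|_p$ is nonincreasing on $J$; in particular, it is nonincreasing on $[0,T]$ if $\|u(t)\|_m\le\nu/K$ for all $t\in[0,T]$. -/

import Mathlib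

open MeasureTheory Filter Topology Set
open scoped ENNReal

namespace Vorticity

noncomputable section

/-- Euclidean space `ℝᵐ`. -/
abbrev Space (m : ℕ) : Type := EuclideanSpace ℝ (Fin m)

/-- The `i`-th standard basis vector of `ℝᵐ`. -/
abbrev basisVec {m : ℕ} (i : Fin m) : Space m := EuclideanSpace.single i (1 : ℝ)

/-- The real times in `[0, T]`, where `0 < T ≤ ∞` (this is `[0, ∞)` when `T = ∞`). -/
def closedTimes (T : EReal) : Set ℝ := {t | 0 ≤ t ∧ (t : EReal) ≤ T}

/-- The real times in `(0, T)`, where `0 < T ≤ ∞`. -/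
def openTimes (T : EReal) : Set ℝ := {t | 0 < t ∧ (t : EReal) < T}

/-- `v ∈ C(I; L^q(ℝᵐ; ℝᵐ))`. -/
def ContinuousInLp {m : ℕ} (I : Set ℝ) (q : ℝ≥0∞) (v : ℝ → Space m → Space m) : Prop :=
  (∀ t ∈ I, MemLp (v t) q volume) ∧
    ∀ t ∈ I, Tendsto (fun s => eLpNorm (v s - v t) q volume) (𝓝[I] t) (𝓝 0)

/-- `g` is the weak partial derivative `∂ᵢ f` on `ℝᵐ`. -/
def HasWeakPartial {m : ℕ} (i : Fin m) (f g : Space m → Space m) : Prop :=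
  LocallyIntegrable f volume ∧ LocallyIntegrable g volume ∧
    ∀ φ : Space m → ℝ, ContDiff ℝ ((⊤ : ℕ∞) : WithTop ℕ∞) φ → HasCompactSupport φ →
      ∫ x, fderiv ℝ φ x (basisVec i) • f x = -∫ x, φ x • g x

/-- `Dv` is the weak spatial gradient of the time-dependent field `v` on `ℝᵐ × (0, T)`
(with `Dv t i = ∂ᵢ v(t)`), and it lies in `L¹_loc((0, T); L^p)`. -/
structure HasGradientL1LocLp {m : ℕ} (p : ℝ) (T : EReal) (v : ℝ → Space m → Space m)
    (Dv : ℝ → Fin m → Space m → Space m) : Prop where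
  weakPartial : ∀ᵐ t : ℝ, t ∈ openTimes T → ∀ i, HasWeakPartial i (v t) (Dv t i)
  memLp : ∀ᵐ t : ℝ, t ∈ openTimes T → ∀ i, MemLp (Dv t i) (ENNReal.ofReal p) volume
  locallyIntegrable : ∀ i, LocallyIntegrableOn
    (fun t => lpNorm (Dv t i) (ENNReal.ofReal p) volume) (openTimes T) volume

/-- The divergence `∑ᵢ ∂ᵢ vᵢ`, computed from the gradient `D` with `D i = ∂ᵢ v`. -/
def divergence {m : ℕ} (D : Fin m → Space m → Space m) (x : Space m) : ℝ :=
  ∑ i, D i x i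

/-- The directional derivative `(u · ∇) v = ∑ᵢ uᵢ ∂ᵢ v`, where `D i = ∂ᵢ v`. -/
def advect {m : ℕ} (u : Space m → Space m) (D : Fin m → Space m → Space m) (x : Space m) :
    Space m :=
  ∑ i, u x i • D i x

/-- The pair `(u, ω)` of divergence-free fields, with weak gradients `Du` and `Dω`, solves
`∂ₜ ω - ν Δ ω + u · ∇ω - ω · ∇u = 0` on `ℝᵐ × (0, T)` in the sense of distributions. -/
structure SolvesVorticityEquation {m : ℕ} (ν : ℝ) (T : EReal) (u ω : ℝ → Space m → Space m)
    (Du Dω : ℝ → Fin m → Space m → Space m) : Prop where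
  div_velocity : ∀ᵐ t : ℝ, t ∈ openTimes T → ∀ᵐ x : Space m, divergence (Du t) x = 0
  div_vorticity : ∀ᵐ t : ℝ, t ∈ openTimes T → ∀ᵐ x : Space m, divergence (Dω t) x = 0
  equation : ∀ φ : ℝ × Space m → ℝ, ContDiff ℝ ((⊤ : ℕ∞) : WithTop ℕ∞) φ → HasCompactSupport φ →
    tsupport φ ⊆ openTimes T ×ˢ univ →
      ∫ t : ℝ, ∫ x : Space m,
        ((deriv (fun s => φ (s, x)) t + ν * Laplacian.laplacian (fun y => φ (t, y)) x) • ω t x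
          - φ (t, x) • (advect (u t) (Dω t) x - advect (ω t) (Du t) x)) = 0

/-- The integrand `|f|^{p-2} |∇f|²` of `Q_p(f)`, where `D i = ∂ᵢ f` and `|∇f|² = ∑ᵢ |∂ᵢ f|²`. -/
def dissipationDensity {m : ℕ} (p : ℝ) (f : Space m → Space m)
    (D : Fin m → Space m → Space m) (x : Space m) : ℝ :=
  ‖f x‖ ^ (p - 2) * ∑ i, ‖D i x‖ ^ 2

/-- `Q_p(f) = ∫ |f|^{p-2} |∇f|² dx`, where `D i = ∂ᵢ f`. -/
def Q {m : ℕ} (p : ℝ) (f : Space m → Space m) (D : Fin m → Space m → Space m) : ℝ :=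
  ∫ x, dissipationDensity p f D x

end

end Vorticity

/-! Formally the equation is paired with `|ω|^(p-2) ω`. The viscous term yields `-ν` times a
quantity comparable to `Q_p(ω)`. Transport disappears because `u` is divergence free. In the
stretching term the derivative is moved off `u`, using that `ω` is divergence free, and what remains
has size `|u| · |ω|^(p/2) · |ω|^((p-2)/2) |∇ω|`. Hölder with exponents `m`, `2m/(m-2)`, `2` and
Sobolev's inequality for the field `|ω|^((p-2)/2) ω` bound its integral by a constant times `‖u‖_m
Q_p(ω)` (`holder_sobolev`, `norm_transDensity_le`). The work lies in justifying this: a priori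
`Q_p(ω(t))` may be infinite, and the gradients are merely integrable in time.

Truncation. The power is replaced by a potential whose gradient is `h(|w|²) w`, where `h(q) = q^a (1
+ δq)^(-(a+1/3))`; in the end `a = (p-2)/2`. The extra `1/3` does three things. The field grows only
like `|w|^(1/3)`, so its product with the nonlinear term is locally integrable by Young's inequality
with exponents 6, 3, 2 (`young_six_three_two`), which is where `m ≥ 3` and `p ≥ 2` enter. Its
derivative stays coercive, with constant `1/3` (`radDeriv_coercive`). The potential is at most
`h(|w|²) |w|²` (`potential_le_wt`), so the cutoff part of the transport term has the same form as
the stretching term.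

Regularization. The vorticity is mollified in space only. The nonlinear term is the divergence of a
flux continuous in time with values in `L^(m/2)`, so the mollified vorticity is classically
differentiable in time (`hasDerivAt_moll`) and satisfies an exact energy balance. No commutator
estimate is needed: the lower order integrands are dominated by a weight times `1 + M + M ∗ ρ_n`
with `M` integrable, and dominated convergence with converging majorants applies. In time these
terms are linear in the gradient norms, so they converge by domination. The dissipation is quadratic
in the gradient, and Fatou's lemma gives only an energy inequality at first.

A priori bound. On a compact time interval `u(t)` splits into a part uniformly small in `L^m` and a
uniformly bounded part (`ContinuousInLp.exists_splitting`). The small part is absorbed by viscosity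
and the bounded part costs only mass, so no smallness of `u` itself is used
(`exists_integral_wDissip_le`). With `a = 0` this gives gradients locally square integrable in
space-time, which upgrades the inequality to an identity (`energy_identity`). With `a = (p-2)/2` and
expanding cutoffs it gives local integrability in time of `Q_p(ω(t))` (`integrable_Q`).

Conclusion. Cutoff and truncation are removed together. The increments of `‖ω‖_p^p` are then bounded
on both sides by integrals of `‖u‖_m Q_p` and `ν Q_p` (`energy_estimate`). The two-sided bound gives
absolute continuity, the upper bound gives the differential inequality, and integrating the upper
bound gives monotonicity. -/

namespace Vorticity

open scoped Convolution

noncomputable section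

/-! ### Spatial mollification and Jensen's inequality -/

section Mollification

variable {m : ℕ} {F : Type*} [NormedAddCommGroup F] [NormedSpace ℝ F]

/-- Smooth bumps on `ℝᵐ` that shrink to the origin. -/
def mollBump (m n : ℕ) : ContDiffBump (0 : Space m) where
  rIn := 1 / (2 * (n + 1))
  rOut := 1 / (n + 1)
  rIn_pos := by positivity
  rIn_lt_rOut := by
    apply one_div_lt_one_div_of_lt <;> nlinarith [(Nat.cast_nonneg n : (0 : ℝ) ≤ n)]

/-- The standard mollifiers. -/
def kernel (m n : ℕ) : Space m → ℝ := (mollBump m n).normed volume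

/-- The mollification of a locally integrable function. -/
def moll (n : ℕ) (f : Space m → F) : Space m → F :=
  kernel m n ⋆[ContinuousLinearMap.lsmul ℝ ℝ, volume] f

lemma kernel_contDiff (n : ℕ) {k : ℕ∞} : ContDiff ℝ k (kernel m n) :=
  (mollBump m n).contDiff_normed

lemma kernel_continuous (n : ℕ) : Continuous (kernel m n) := (mollBump m n).continuous_normed

lemma kernel_hasCompactSupport (n : ℕ) : HasCompactSupport (kernel m n) :=
  (mollBump m n).hasCompactSupport_normed

lemma kernel_nonneg (n : ℕ) (x : Space m) : 0 ≤ kernel m n x := (mollBump m n).nonneg_normed x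

lemma integral_kernel (n : ℕ) : ∫ x, kernel m n x = 1 := (mollBump m n).integral_normed

lemma kernel_eq_zero (n : ℕ) {x : Space m} (hx : 1 ≤ ‖x‖) : kernel m n x = 0 := by
  by_contra h
  have h1 : x ∈ Function.support ((mollBump m n).normed volume) := h
  rw [(mollBump m n).support_normed_eq] at h1
  have h2 : ‖x‖ < 1 / ((n : ℝ) + 1) := by simpa [mollBump] using h1
  have h3 : 1 / ((n : ℝ) + 1) ≤ 1 := by
    rw [div_le_one (by positivity)]; linarith [(Nat.cast_nonneg n : (0 : ℝ) ≤ n)]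
  linarith

lemma integrable_conv {k : Space m → ℝ} (hk : Continuous k) (hc : HasCompactSupport k)
    {f : Space m → F} (hf : LocallyIntegrable f volume) (x : Space m) :
    Integrable (fun y => k (x - y) • f y) volume := by
  have := (hc.convolutionExists_left (ContinuousLinearMap.lsmul ℝ ℝ) hk hf x).integrable_swap
  simpa using this

lemma integrable_kernel_smul (n : ℕ) {f : Space m → F} (hf : LocallyIntegrable f volume)
    (x : Space m) : Integrable (fun y => kernel m n (x - y) • f y) volume :=
  integrable_conv (kernel_continuous n) (kernel_hasCompactSupport n) hf x

lemma moll_apply (n : ℕ) (f : Space m → F) (x : Space m) :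
    moll n f x = ∫ y, kernel m n (x - y) • f y := by
  rw [moll, convolution_lsmul_swap]

lemma moll_contDiff (n : ℕ) {f : Space m → F} (hf : LocallyIntegrable f volume) {k : ℕ∞} :
    ContDiff ℝ k (moll n f) :=
  (kernel_hasCompactSupport n).contDiff_convolution_left _ (kernel_contDiff n) hf

lemma moll_continuous (n : ℕ) {f : Space m → F} (hf : LocallyIntegrable f volume) :
    Continuous (moll n f) := (moll_contDiff n hf (k := 0)).continuous

/-- Lebesgue differentiation. The outer radius of each bump is twice the inner one, and this bounded
ratio makes the kernels comparable to averages over balls. -/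
lemma tendsto_moll_ae [CompleteSpace F] {f : Space m → F} (hf : LocallyIntegrable f volume) :
    ∀ᵐ x, Tendsto (fun n => moll n f x) atTop (𝓝 (f x)) := by
  refine ContDiffBump.ae_convolution_tendsto_right_of_locallyIntegrable (K := 2)
    (φ := fun n => mollBump m n) ?_ ?_ hf
  · exact tendsto_one_div_add_atTop_nhds_zero_nat
  · refine Eventually.of_forall fun n => ?_
    simp only [mollBump]
    apply le_of_eq; field_simp

lemma moll_mono (n : ℕ) {f g : Space m → ℝ} (hf : LocallyIntegrable f volume)
    (hg : LocallyIntegrable g volume) (h : ∀ᵐ x, f x ≤ g x) (x : Space m) :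
    moll n f x ≤ moll n g x := by
  rw [moll_apply, moll_apply]
  refine integral_mono_ae (integrable_kernel_smul n hf x) (integrable_kernel_smul n hg x) ?_
  filter_upwards [h] with y hy
  exact mul_le_mul_of_nonneg_left hy (kernel_nonneg n _)

lemma moll_nonneg (n : ℕ) {f : Space m → ℝ} (h : ∀ x, 0 ≤ f x) (x : Space m) :
    0 ≤ moll n f x := by
  rw [moll_apply]
  exact integral_nonneg fun y => mul_nonneg (kernel_nonneg n _) (h y)

lemma norm_moll_le (n : ℕ) (f : Space m → F) (x : Space m) :
    ‖moll n f x‖ ≤ moll n (fun y => ‖f y‖) x := by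
  rw [moll_apply, moll_apply]
  refine (norm_integral_le_integral_norm _).trans (le_of_eq ?_)
  refine integral_congr_ae (Eventually.of_forall fun y => ?_)
  simp [norm_smul, abs_of_nonneg (kernel_nonneg n _)]

lemma moll_add (n : ℕ) {f g : Space m → F} (hf : LocallyIntegrable f volume)
    (hg : LocallyIntegrable g volume) (x : Space m) :
    moll n (fun y => f y + g y) x = moll n f x + moll n g x := by
  simp only [moll_apply, smul_add]
  exact integral_add (integrable_kernel_smul n hf x) (integrable_kernel_smul n hg x)

lemma moll_sum (n : ℕ) {ι : Type*} (s : Finset ι) {f : ι → Space m → F}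
    (hf : ∀ i ∈ s, LocallyIntegrable (f i) volume) (x : Space m) :
    moll n (fun y => ∑ i ∈ s, f i y) x = ∑ i ∈ s, moll n (f i) x := by
  simp only [moll_apply, Finset.smul_sum]
  exact integral_finsetSum _ fun i hi => integrable_kernel_smul n (hf i hi) x

lemma moll_const_mul (n : ℕ) (c : ℝ) (f : Space m → ℝ) (x : Space m) :
    moll n (fun y => c * f y) x = c * moll n f x := by
  simp only [moll_apply, smul_eq_mul]
  rw [← integral_const_mul]
  congr 1; ext y; ring

lemma moll_const [CompleteSpace F] (n : ℕ) (c : F) (x : Space m) :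
    moll n (fun _ => c) x = c := by
  rw [moll_apply, integral_smul_const, integral_sub_left_eq_self (kernel m n) volume x,
    integral_kernel, one_smul]

lemma moll_clm [CompleteSpace F] {F' : Type*} [NormedAddCommGroup F'] [NormedSpace ℝ F']
    [CompleteSpace F'] (n : ℕ)
    (A : F →L[ℝ] F') {f : Space m → F} (hf : LocallyIntegrable f volume) (x : Space m) :
    moll n (fun y => A (f y)) x = A (moll n f x) := by
  rw [moll_apply, moll_apply, ← A.integral_comp_comm (integrable_kernel_smul n hf x)]
  simp

lemma moll_congr_ball (n : ℕ) {f g : Space m → F} {x : Space m}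
    (h : ∀ y, ‖x - y‖ < 1 → f y = g y) : moll n f x = moll n g x := by
  rw [moll_apply, moll_apply]
  congr 1; ext y
  by_cases hy : ‖x - y‖ < 1
  · rw [h y hy]
  · rw [kernel_eq_zero n (not_lt.1 hy)]; simp

lemma LocallyIntegrable.norm_comp {F : Type*} [NormedAddCommGroup F] {f : Space m → F} (hf : LocallyIntegrable f volume) :
    LocallyIntegrable (fun x => ‖f x‖) volume := fun x => by
  obtain ⟨s, hs, h⟩ := hf x
  exact ⟨s, hs, h.norm⟩

/-- A convex power lies above its tangent at `s`. For `q > 1` this is Young's inequality applied to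
`t` and `s ^ (q - 1)`. -/
lemma rpow_tangent_le {q s t : ℝ} (hq : 1 ≤ q) (hs : 0 ≤ s) (ht : 0 ≤ t) :
    q * s ^ (q - 1) * t ≤ t ^ q + (q - 1) * s ^ q := by
  rcases hq.eq_or_lt with rfl | hq
  · simp
  have h := Real.young_inequality_of_nonneg ht (Real.rpow_nonneg hs (q - 1))
    (Real.HolderConjugate.conjExponent hq)
  have h2 : (s ^ (q - 1)) ^ q.conjExponent = s ^ q := by
    rw [← Real.rpow_mul hs]; congr 1
    rw [Real.conjExponent]; field_simp [(sub_pos.2 hq).ne']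
  rw [h2] at h
  have h3 : t * s ^ (q - 1) * q ≤ (t ^ q / q + s ^ q / q.conjExponent) * q :=
    mul_le_mul_of_nonneg_right h (by linarith)
  have h4 : (t ^ q / q + s ^ q / q.conjExponent) * q = t ^ q + (q - 1) * s ^ q := by
    have : (q - 1) ≠ 0 := (sub_pos.2 hq).ne'
    have : q ≠ 0 := by linarith
    rw [Real.conjExponent]; field_simp
  linarith

/-- Jensen's inequality for the probability density `kernel`: the tangent inequality at the average
`s` is itself averaged against the kernel. -/
lemma rpow_norm_moll_le (n : ℕ) {q : ℝ} (hq : 1 ≤ q) {f : Space m → F}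
    (hf : LocallyIntegrable f volume) (hfq : LocallyIntegrable (fun x => ‖f x‖ ^ q) volume)
    (x : Space m) : ‖moll n f x‖ ^ q ≤ moll n (fun y => ‖f y‖ ^ q) x := by
  set s := moll n (fun y => ‖f y‖) x with hs
  have hs0 : 0 ≤ s := moll_nonneg n (fun _ => norm_nonneg _) x
  have h1 : ‖moll n f x‖ ^ q ≤ s ^ q :=
    Real.rpow_le_rpow (norm_nonneg _) (norm_moll_le n f x) (by linarith)
  refine h1.trans ?_
  have hl : LocallyIntegrable (fun y => q * s ^ (q - 1) * ‖f y‖) (volume : Measure (Space m)) :=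
    (LocallyIntegrable.norm_comp hf).smul (q * s ^ (q - 1))
  have hr : LocallyIntegrable (fun y => ‖f y‖ ^ q + (q - 1) * s ^ q)
      (volume : Measure (Space m)) := hfq.add (locallyIntegrable_const _)
  have h2 := moll_mono n hl hr (Eventually.of_forall fun y =>
    rpow_tangent_le hq hs0 (norm_nonneg (f y))) x
  rw [moll_const_mul, moll_add n hfq (locallyIntegrable_const _), moll_const, ← hs] at h2
  have h3 : s ^ (q - 1) * s = s ^ q := by
    rcases hs0.eq_or_lt with h0 | h0
    · rw [← h0, mul_zero, Real.zero_rpow (by linarith)]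
    · rw [← Real.rpow_add_one h0.ne']; congr 1; ring
  have h4 : q * s ^ (q - 1) * s = q * s ^ q := by rw [mul_assoc, h3]
  linarith

lemma integrable_moll (n : ℕ) {f : Space m → F} (hf : Integrable f volume) :
    Integrable (moll n f) volume :=
  Integrable.integrable_convolution _
    ((kernel_continuous n).integrable_of_hasCompactSupport (kernel_hasCompactSupport n)) hf

lemma integral_moll [CompleteSpace F] (n : ℕ) {f : Space m → F} (hf : Integrable f volume) :
    ∫ x, moll n f x = ∫ x, f x := by
  have := integral_convolution (L := ContinuousLinearMap.lsmul ℝ ℝ) (μ := (volume : Measure (Space m)))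
    (ν := volume)
    ((kernel_continuous (m := m) n).integrable_of_hasCompactSupport (kernel_hasCompactSupport n)) hf
  rw [moll, this, integral_kernel]; simp

lemma fderiv_conv {k : Space m → ℝ} (hk : ContDiff ℝ 1 k) (hc : HasCompactSupport k)
    {f : Space m → F} (hf : LocallyIntegrable f volume) (x v : Space m) :
    fderiv ℝ (fun z => ∫ y, k (z - y) • f y) x v = ∫ y, fderiv ℝ k (x - y) v • f y := by
  have h := hc.hasFDerivAt_convolution_left (ContinuousLinearMap.lsmul ℝ ℝ) hk hf x
  have e : (fun z => ∫ y, k (z - y) • f y) = k ⋆[ContinuousLinearMap.lsmul ℝ ℝ, volume] f := by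
    ext z; rw [convolution_lsmul_swap]
  rw [e, h.fderiv, convolution_eq_swap, ContinuousLinearMap.integral_apply]
  · rfl
  · have := ((hc.fderiv (𝕜 := ℝ)).convolutionExists_left
      ((ContinuousLinearMap.lsmul ℝ ℝ).precompL (Space m) : _ →L[ℝ] F →L[ℝ] _)
      (hk.continuous_fderiv (by norm_num)) hf x).integrable_swap
    exact this

lemma fderiv_sub_left {G : Type*} [NormedAddCommGroup G] [NormedSpace ℝ G] {k : Space m → G}
    (hk : Differentiable ℝ k) (x y v : Space m) :
    fderiv ℝ (fun z => k (x - z)) y v = -fderiv ℝ k (x - y) v := by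
  have h := (hk (x - y)).hasFDerivAt.comp y ((hasFDerivAt_id y).const_sub x)
  rw [show (fun z => k (x - z)) = k ∘ HSub.hSub x from rfl, h.fderiv]
  simp

lemma hasCompactSupport_sub_left {G : Type*} [Zero G] {k : Space m → G} (hc : HasCompactSupport k)
    (x : Space m) : HasCompactSupport (fun y => k (x - y)) :=
  hc.comp_homeomorph (Homeomorph.subLeft x)

/-- The weak derivative is tested against the reflected kernel `y ↦ kernel m n (x - y)`. The sign
produced by the reflection cancels the sign of integration by parts. -/
lemma fderiv_moll {i : Fin m} {f g : Space m → Space m} (h : HasWeakPartial i f g) (n : ℕ)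
    (x : Space m) : fderiv ℝ (moll n f) x (basisVec i) = moll n g x := by
  have h1 := h.2.2 (fun y => kernel m n (x - y))
    ((kernel_contDiff n).comp (contDiff_const.sub contDiff_id))
    (hasCompactSupport_sub_left (kernel_hasCompactSupport n) x)
  have e : moll n f = fun z => ∫ y, kernel m n (z - y) • f y := by ext1 z; exact moll_apply n f z
  rw [e, fderiv_conv (kernel_contDiff n) (kernel_hasCompactSupport n) h.1, moll_apply]
  simp only [fderiv_sub_left ((kernel_contDiff n (k := 1)).differentiable (by norm_num)), neg_smul, integral_neg, neg_inj] at h1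
  exact h1

end Mollification

/-! ### Dominated convergence with varying majorants -/

section Convergence

variable {α : Type*} [MeasurableSpace α] {μ : Measure α}
  {F : Type*} [NormedAddCommGroup F] [NormedSpace ℝ F]

/-- Dominated convergence with converging dominating functions. -/
lemma tendsto_integral_of_tendsto_dominating {f : ℕ → α → F} {f' : α → F} {g : ℕ → α → ℝ}
    {g' : α → ℝ} (hf : ∀ n, AEStronglyMeasurable (f n) μ) (hg : ∀ n, Integrable (g n) μ)
    (hg' : Integrable g' μ) (hfg : ∀ n, ∀ᵐ x ∂μ, ‖f n x‖ ≤ g n x)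
    (hlim : ∀ᵐ x ∂μ, Tendsto (fun n => f n x) atTop (𝓝 (f' x)))
    (hglim : ∀ᵐ x ∂μ, Tendsto (fun n => g n x) atTop (𝓝 (g' x)))
    (hgint : Tendsto (fun n => ∫ x, g n x ∂μ) atTop (𝓝 (∫ x, g' x ∂μ))) :
    Integrable f' μ ∧ Tendsto (fun n => ∫ x, f n x ∂μ) atTop (𝓝 (∫ x, f' x ∂μ)) := by
  have hfm : AEStronglyMeasurable f' μ := aestronglyMeasurable_of_tendsto_ae _ hf hlim
  have hfg' : ∀ᵐ x ∂μ, ‖f' x‖ ≤ g' x := by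
    filter_upwards [hlim, hglim, ae_all_iff.2 hfg] with x h1 h2 h3
    exact le_of_tendsto_of_tendsto' h1.norm h2 h3
  have hfi : Integrable f' μ := hg'.mono' hfm hfg'
  refine ⟨hfi, ?_⟩
  have hfn : ∀ n, Integrable (f n) μ := fun n => (hg n).mono' (hf n) (hfg n)
  have hd : ∀ n, Integrable (fun x => ‖f n x - f' x‖) μ := fun n => ((hfn n).sub hfi).norm
  have key : Tendsto (fun n => ∫ x, ‖f n x - f' x‖ ∂μ) atTop (𝓝 0) := by
    -- Fatou for `g n + g' - ‖f n - f'‖`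
    set H : ℕ → α → ℝ := fun n x => g n x + g' x - ‖f n x - f' x‖ with hH
    have hHi : ∀ n, Integrable (H n) μ := fun n => ((hg n).add hg').sub (hd n)
    have hH0 : ∀ n, 0 ≤ᵐ[μ] H n := by
      intro n
      filter_upwards [hfg n, hfg'] with x h1 h2
      have := norm_sub_le (f n x) (f' x)
      simp only [hH, Pi.zero_apply]; linarith
    have hHlim : ∀ᵐ x ∂μ, Tendsto (fun n => H n x) atTop (𝓝 (2 * g' x)) := by
      filter_upwards [hlim, hglim] with x h1 h2
      have := (h2.add_const (g' x)).sub (h1.sub_const (f' x)).norm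
      simp only [sub_self, norm_zero, sub_zero] at this
      rw [two_mul]; exact this
    have hFatou : ENNReal.ofReal (∫ x, 2 * g' x ∂μ) ≤
        liminf (fun n => ENNReal.ofReal (∫ x, H n x ∂μ)) atTop := by
      have h0 : 0 ≤ᵐ[μ] fun x => 2 * g' x := by
        filter_upwards [hfg'] with x h2
        have := (norm_nonneg (f' x)).trans h2
        simp only [Pi.zero_apply]; linarith
      rw [ofReal_integral_eq_lintegral_ofReal (hg'.const_mul 2) h0]
      calc ∫⁻ x, ENNReal.ofReal (2 * g' x) ∂μ
          = ∫⁻ x, liminf (fun n => ENNReal.ofReal (H n x)) atTop ∂μ := by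
            refine lintegral_congr_ae ?_
            filter_upwards [hHlim] with x hx
            exact ((ENNReal.continuous_ofReal.tendsto _).comp hx).liminf_eq.symm
        _ ≤ liminf (fun n => ∫⁻ x, ENNReal.ofReal (H n x) ∂μ) atTop :=
            lintegral_liminf_le' fun n => (hHi n).1.aemeasurable.ennreal_ofReal
        _ = _ := by
            congr 1; ext n
            rw [ofReal_integral_eq_lintegral_ofReal (hHi n) (hH0 n)]
    have hval : ∀ n, ∫ x, H n x ∂μ
        = ∫ x, g n x ∂μ + ∫ x, g' x ∂μ - ∫ x, ‖f n x - f' x‖ ∂μ := by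
      intro n
      simp only [hH]
      rw [integral_sub (f := fun x => g n x + g' x) ((hg n).add hg') (hd n),
        integral_add (hg n) hg']
    have hgn : 0 ≤ ∫ x, 2 * g' x ∂μ := by
      refine integral_nonneg_of_ae ?_
      filter_upwards [hfg'] with x h2
      have := (norm_nonneg (f' x)).trans h2
      simp only [Pi.zero_apply]; linarith
    rw [Metric.tendsto_atTop]
    intro ε hε
    have hlow : ∀ᶠ n in atTop, ∫ x, 2 * g' x ∂μ - ε / 2 < ∫ x, H n x ∂μ := by
      by_cases hc : ∫ x, 2 * g' x ∂μ - ε / 2 < 0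
      · exact Eventually.of_forall fun n => hc.trans_le (integral_nonneg_of_ae (hH0 n))
      · have : ENNReal.ofReal (∫ x, 2 * g' x ∂μ - ε / 2) <
            liminf (fun n => ENNReal.ofReal (∫ x, H n x ∂μ)) atTop :=
          lt_of_lt_of_le ((ENNReal.ofReal_lt_ofReal_iff_of_nonneg (not_lt.1 hc)).2
            (by linarith)) hFatou
        filter_upwards [eventually_lt_of_lt_liminf this] with n hn
        exact (ENNReal.ofReal_lt_ofReal_iff_of_nonneg (not_lt.1 hc)).1 hn
    have hup : ∀ᶠ n in atTop, ∫ x, g n x ∂μ < ∫ x, g' x ∂μ + ε / 2 :=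
      hgint.eventually_lt_const (by linarith)
    obtain ⟨N, hN⟩ := eventually_atTop.1 (hlow.and hup)
    refine ⟨N, fun n hn => ?_⟩
    obtain ⟨h1, h2⟩ := hN n hn
    rw [hval, integral_const_mul] at h1
    rw [Real.dist_eq, sub_zero, abs_of_nonneg (integral_nonneg fun x => norm_nonneg _)]
    linarith
  rw [tendsto_iff_norm_sub_tendsto_zero]
  refine squeeze_zero (fun n => norm_nonneg _) (fun n => ?_) key
  rw [← integral_sub (hfn n) hfi]
  exact norm_integral_le_integral_norm _

/-- Dominated convergence where the dominating functions are mollifications. -/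
lemma tendsto_integral_of_le_moll {m : ℕ} {f : ℕ → Space m → F} {f' : Space m → F}
    {G V : Space m → ℝ} (hf : ∀ n, AEStronglyMeasurable (f n) volume)
    (hG : Integrable G volume) (hV : Integrable V volume)
    (hfg : ∀ n, ∀ᵐ x, ‖f n x‖ ≤ G x + moll n V x)
    (hlim : ∀ᵐ x, Tendsto (fun n => f n x) atTop (𝓝 (f' x))) :
    Integrable f' volume ∧ Tendsto (fun n => ∫ x, f n x) atTop (𝓝 (∫ x, f' x)) := by
  refine tendsto_integral_of_tendsto_dominating (g := fun n x => G x + moll n V x)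
    (g' := fun x => G x + V x) hf (fun n => hG.add (integrable_moll n hV)) (hG.add hV) hfg hlim ?_ ?_
  · filter_upwards [tendsto_moll_ae hV.locallyIntegrable] with x hx
    exact hx.const_add _
  · have : ∀ n, ∫ x, (G x + moll n V x) = ∫ x, (G x + V x) := by
      intro n
      rw [integral_add hG (integrable_moll n hV), integral_add hG hV, integral_moll n hV]
    simp only [this]; exact tendsto_const_nhds

end Convergence

/-! ### The truncated power: radial field, coercivity, potential -/

section TruncatedPower

/-- The truncated power `q ^ a * (1 + δ * q) ^ (-κ)`. -/
def wt (a κ δ q : ℝ) : ℝ := q ^ a * (1 + δ * q) ^ (-κ)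

variable {a κ δ q : ℝ}

lemma wt_nonneg (hδ : 0 ≤ δ) (hq : 0 ≤ q) : 0 ≤ wt a κ δ q := by
  unfold wt; positivity

lemma wt_le_rpow (hκ : 0 ≤ κ) (hδ : 0 ≤ δ) (hq : 0 ≤ q) : wt a κ δ q ≤ q ^ a := by
  unfold wt
  refine mul_le_of_le_one_right (by positivity) ?_
  exact Real.rpow_le_one_of_one_le_of_nonpos (by nlinarith [mul_nonneg hδ hq]) (by linarith)

/-- For `κ ≥ a` truncation makes the weight bounded, at the price of a negative power of `δ`. For
fixed `δ` the weighted dissipation is therefore dominated by the unweighted square of the gradient.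
-/
lemma wt_le_const (ha : 0 ≤ a) (hκ : a ≤ κ) (hδ : 0 < δ) (hq : 0 ≤ q) :
    wt a κ δ q ≤ δ ^ (-a) := by
  have h1 : 0 < 1 + δ * q := by positivity
  have h2 : (δ * q) ^ a ≤ (1 + δ * q) ^ a := Real.rpow_le_rpow (by positivity) (by linarith) ha
  have h3 : q ^ a = δ ^ (-a) * (δ * q) ^ a := by
    rw [Real.mul_rpow hδ.le hq, ← mul_assoc, ← Real.rpow_add hδ]; simp
  unfold wt
  rw [h3, mul_assoc]
  refine mul_le_of_le_one_right (by positivity) ?_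
  calc (δ * q) ^ a * (1 + δ * q) ^ (-κ) ≤ (1 + δ * q) ^ a * (1 + δ * q) ^ (-κ) := by gcongr
    _ = (1 + δ * q) ^ (a - κ) := by rw [← Real.rpow_add h1]; rfl
    _ ≤ 1 := Real.rpow_le_one_of_one_le_of_nonpos (by nlinarith [mul_nonneg hδ.le hq])
        (by linarith)

/-- Dropping the `1` in `1 + δ r²` leaves the exponent `2a - 2(a + 1/3) + 1 = 1/3`. The sixth power
of the bound is of order `r²`, which matches the first slot of the Young inequality with exponents
6, 3, 2. -/
lemma wt_mul_le_third (hδ : 0 < δ) {r : ℝ} (hr : 0 ≤ r) (ha : 0 ≤ a) :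
    wt a (a + 1 / 3) δ (r ^ 2) * r ≤ δ ^ (-(a + 1 / 3)) * r ^ (1 / 3 : ℝ) := by
  rcases hr.eq_or_lt with rfl | hr
  · simp
  have h1 : (1 + δ * r ^ 2) ^ (-(a + 1 / 3)) ≤ (δ * r ^ 2) ^ (-(a + 1 / 3)) :=
    Real.rpow_le_rpow_of_nonpos (by positivity) (by linarith) (by linarith)
  calc wt a (a + 1 / 3) δ (r ^ 2) * r
      ≤ (r ^ 2) ^ a * (δ * r ^ 2) ^ (-(a + 1 / 3)) * r := by unfold wt; gcongr
    _ = δ ^ (-(a + 1 / 3)) * r ^ (1 / 3 : ℝ) := by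
      rw [Real.mul_rpow hδ.le (by positivity), ← Real.rpow_natCast r 2, ← Real.rpow_mul hr.le,
        ← Real.rpow_mul hr.le]
      have : r ^ (1 / 3 : ℝ) = r ^ ((2 : ℕ) * a) * r ^ ((2 : ℕ) * (-(a + 1 / 3))) * r := by
        rw [← Real.rpow_add hr, ← Real.rpow_add_one hr.ne']; congr 1; push_cast; ring
      rw [this]; ring

lemma wt_half_sq (hδ : 0 ≤ δ) (hq : 0 ≤ q) : wt (a / 2) (κ / 2) δ q ^ 2 = wt a κ δ q := by
  have h1 : 0 < 1 + δ * q := by positivity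
  unfold wt
  rw [mul_pow, ← Real.rpow_natCast, ← Real.rpow_natCast, ← Real.rpow_mul hq, ← Real.rpow_mul h1.le]
  congr 2 <;> push_cast <;> ring

lemma continuousOn_wt (ha : 0 ≤ a) (hδ : 0 ≤ δ) : ContinuousOn (wt a κ δ) (Ici 0) := by
  unfold wt
  refine (continuousOn_id.rpow_const fun x _ => Or.inr ha).mul
    (ContinuousOn.rpow_const (by fun_prop) fun x hx => Or.inl ?_)
  have : 0 ≤ δ * x := mul_nonneg hδ hx
  linarith

lemma hasDerivAt_wt (hδ : 0 ≤ δ) (hq : 0 < q) :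
    HasDerivAt (wt a κ δ) ((a - κ * (δ * q / (1 + δ * q))) * wt a κ δ q / q) q := by
  have h1 : 0 < 1 + δ * q := by positivity
  have e1 : HasDerivAt (fun q => q ^ a) (a * q ^ (a - 1)) q := Real.hasDerivAt_rpow_const (Or.inl hq.ne')
  have e2 : HasDerivAt (fun q => (1 + δ * q) ^ (-κ)) (δ * (-κ) * (1 + δ * q) ^ (-κ - 1)) q := by
    refine HasDerivAt.rpow_const ?_ (Or.inl h1.ne')
    simpa using ((hasDerivAt_id q).const_mul δ).const_add 1
  refine (e1.mul e2).congr_deriv ?_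
  rw [Real.rpow_sub_one hq.ne', Real.rpow_sub_one h1.ne']
  unfold wt
  field_simp
  ring

variable {m : ℕ}

/-- The radial field `w ↦ |w| ^ (2 a) * (1 + δ |w| ^ 2) ^ (-κ) • w`. -/
def radField (a κ δ : ℝ) (w : Space m) : Space m := wt a κ δ (‖w‖ ^ 2) • w

/-- The derivative of `radField`. -/
def radDeriv (a κ δ : ℝ) (w : Space m) : Space m →L[ℝ] Space m :=
  wt a κ δ (‖w‖ ^ 2) • ContinuousLinearMap.id ℝ (Space m) +
    (2 * (a - κ * (δ * ‖w‖ ^ 2 / (1 + δ * ‖w‖ ^ 2))) * wt a κ δ (‖w‖ ^ 2) / ‖w‖ ^ 2) •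
      (innerSL ℝ w).smulRight w

lemma radDeriv_apply (w ξ : Space m) : radDeriv a κ δ w ξ = wt a κ δ (‖w‖ ^ 2) • ξ +
    (2 * (a - κ * (δ * ‖w‖ ^ 2 / (1 + δ * ‖w‖ ^ 2))) * wt a κ δ (‖w‖ ^ 2) / ‖w‖ ^ 2) •
      (inner ℝ w ξ • w) := rfl

lemma continuous_wt_norm_sq (ha : 0 ≤ a) (hδ : 0 ≤ δ) :
    Continuous fun w : Space m => wt a κ δ (‖w‖ ^ 2) :=
  (continuousOn_wt ha hδ).comp_continuous (by fun_prop) fun w => by simp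

lemma hasFDerivAt_norm_sq' (w : Space m) :
    HasFDerivAt (fun w : Space m => ‖w‖ ^ 2) ((2 : ℝ) • innerSL ℝ w) w :=
  (hasStrictFDerivAt_norm_sq w).hasFDerivAt.congr_fderiv (by ext; simp)

lemma hasFDerivAt_radField (ha : 0 ≤ a) (hδ : 0 ≤ δ) (w : Space m) :
    HasFDerivAt (radField a κ δ) (radDeriv a κ δ w) w := by
  by_cases hw : w = 0
  · subst hw
    -- Division by `‖w‖ ^ 2 = 0` gives zero, so the radial part vanishes at the origin. The
    -- remaining factor `wt a κ δ 0` is `1` when `a = 0`, since `0 ^ 0 = 1`, and `0` otherwise.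
    have h0 : radDeriv a κ δ (0 : Space m) = wt a κ δ 0 • ContinuousLinearMap.id ℝ (Space m) := by
      ext1 ξ; simp [radDeriv_apply]
    rw [h0, hasFDerivAt_iff_isLittleO_nhds_zero]
    have hc : Tendsto (fun w : Space m => wt a κ δ (‖w‖ ^ 2) - wt a κ δ 0) (𝓝 0) (𝓝 0) := by
      have := ((continuous_wt_norm_sq (κ := κ) (m := m) ha hδ).tendsto 0).sub_const (wt a κ δ 0)
      simpa using this
    have := (Asymptotics.isLittleO_one_iff ℝ).2 hc |>.smul_isBigO
      (Asymptotics.isBigO_refl (fun w : Space m => w) (𝓝 0))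
    simp only [one_smul] at this
    refine this.congr_left fun w => ?_
    simp [radField, sub_smul]
  · have hq : 0 < ‖w‖ ^ 2 := by positivity
    have h1 := (hasDerivAt_wt (a := a) (κ := κ) hδ hq).comp_hasFDerivAt w (hasFDerivAt_norm_sq' w)
    have h2 := h1.smul (hasFDerivAt_id w)
    refine h2.congr_fderiv ?_
    ext1 ξ
    simp only [radDeriv_apply, add_apply, smul_apply,
      ContinuousLinearMap.smulRight_apply, innerSL_apply_apply, Function.comp, id, smul_smul,
      ContinuousLinearMap.id_apply, smul_eq_mul]
    congr 2
    ring

lemma radDeriv_coeff_abs_le (ha : 0 ≤ a) (hκ : 0 ≤ κ) (hδ : 0 ≤ δ) (hq : 0 ≤ q) :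
    |2 * (a - κ * (δ * q / (1 + δ * q)))| ≤ 2 * (a + κ) := by
  have h1 : 0 ≤ δ * q / (1 + δ * q) := by positivity
  have h2 : δ * q / (1 + δ * q) ≤ 1 := by
    rw [div_le_one (by positivity)]; linarith
  rw [abs_le]; constructor <;> nlinarith

lemma norm_inner_smul_div_le (w ξ : Space m) : ‖inner ℝ w ξ • w‖ / ‖w‖ ^ 2 ≤ ‖ξ‖ := by
  by_cases hw : w = 0
  · simp [hw]
  have hq : 0 < ‖w‖ ^ 2 := by positivity
  rw [div_le_iff₀ hq, norm_smul, Real.norm_eq_abs]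
  nlinarith [abs_real_inner_le_norm w ξ, norm_nonneg w]

lemma norm_radDeriv_smul_le (ha : 0 ≤ a) (hκ : 0 ≤ κ) (hδ : 0 ≤ δ) (w ξ : Space m) :
    ‖(2 * (a - κ * (δ * ‖w‖ ^ 2 / (1 + δ * ‖w‖ ^ 2))) * wt a κ δ (‖w‖ ^ 2) / ‖w‖ ^ 2) •
      (inner ℝ w ξ • w)‖ ≤ 2 * (a + κ) * wt a κ δ (‖w‖ ^ 2) * ‖ξ‖ := by
  have hw := wt_nonneg (a := a) (κ := κ) hδ (sq_nonneg ‖w‖)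
  rw [norm_smul, Real.norm_eq_abs, abs_div, abs_mul, abs_of_nonneg hw,
    abs_of_nonneg (sq_nonneg ‖w‖), div_mul_eq_mul_div, mul_div_assoc]
  gcongr
  · exact radDeriv_coeff_abs_le ha hκ hδ (sq_nonneg _)
  · exact norm_inner_smul_div_le w ξ

lemma norm_radDeriv_apply_le (ha : 0 ≤ a) (hκ : 0 ≤ κ) (hδ : 0 ≤ δ) (w ξ : Space m) :
    ‖radDeriv a κ δ w ξ‖ ≤ (1 + 2 * (a + κ)) * wt a κ δ (‖w‖ ^ 2) * ‖ξ‖ := by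
  have hw := wt_nonneg (a := a) (κ := κ) hδ (sq_nonneg ‖w‖)
  rw [radDeriv_apply]
  refine (norm_add_le _ _).trans ?_
  have := norm_radDeriv_smul_le ha hκ hδ w ξ
  rw [norm_smul, Real.norm_eq_abs, abs_of_nonneg hw]
  linarith

/-- The quadratic form is `h |ξ|² + 2 (a - (a + 1/3) θ) h (w·ξ)² / |w|²` with `0 ≤ θ ≤ 1`. The
radial coefficient is at least `-2/3` because `a (1 - θ) ≥ 0`, and Cauchy–Schwarz leaves one third
of `h |ξ|²`. -/
lemma radDeriv_coercive (ha : 0 ≤ a) (hδ : 0 ≤ δ) (w ξ : Space m) :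
    1 / 3 * (wt a (a + 1 / 3) δ (‖w‖ ^ 2) * ‖ξ‖ ^ 2) ≤
      inner ℝ (radDeriv a (a + 1 / 3) δ w ξ) ξ := by
  have hw := wt_nonneg (a := a) (κ := a + 1 / 3) hδ (sq_nonneg ‖w‖)
  set h := wt a (a + 1 / 3) δ (‖w‖ ^ 2) with hh
  rw [radDeriv_apply, inner_add_left, inner_smul_left, inner_smul_left, inner_smul_left,
    real_inner_self_eq_norm_sq]
  simp only [conj_trivial, ← hh]
  set θ := δ * ‖w‖ ^ 2 / (1 + δ * ‖w‖ ^ 2) with hθ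
  have h1 : 0 ≤ θ := by positivity
  have h2 : θ ≤ 1 := by
    rw [hθ, div_le_one (by positivity)]; linarith
  have h3 : inner ℝ w ξ * inner ℝ w ξ / ‖w‖ ^ 2 ≤ ‖ξ‖ ^ 2 := by
    by_cases hw0 : w = 0
    · simp [hw0]
    have hq : 0 < ‖w‖ ^ 2 := by positivity
    rw [div_le_iff₀ hq, ← pow_two, ← sq_abs, ← mul_pow, mul_comm]
    exact pow_le_pow_left₀ (abs_nonneg _) (abs_real_inner_le_norm w ξ) 2
  have h4 : 0 ≤ inner ℝ w ξ * inner ℝ w ξ / ‖w‖ ^ 2 :=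
    div_nonneg (mul_self_nonneg _) (sq_nonneg _)
  set X := inner ℝ w ξ * inner ℝ w ξ / ‖w‖ ^ 2 with hX
  have h5 : 2 * (a - (a + 1 / 3) * θ) * h / ‖w‖ ^ 2 * (inner ℝ w ξ * inner ℝ w ξ)
      = 2 * (a - (a + 1 / 3) * θ) * h * X := by rw [hX]; ring
  rw [h5]
  have h6 : -(2 / 3) ≤ 2 * (a - (a + 1 / 3) * θ) := by nlinarith
  have h7 : -(2 / 3) * (h * X) ≤ 2 * (a - (a + 1 / 3) * θ) * (h * X) :=
    mul_le_mul_of_nonneg_right h6 (mul_nonneg hw h4)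
  have h8 : h * X ≤ h * ‖ξ‖ ^ 2 := mul_le_mul_of_nonneg_left h3 hw
  nlinarith

lemma continuous_radField (ha : 0 ≤ a) (hδ : 0 ≤ δ) : Continuous (radField (m := m) a κ δ) :=
  (continuous_wt_norm_sq ha hδ).smul continuous_id

lemma continuous_radDeriv (ha : 0 ≤ a) (hδ : 0 ≤ δ) :
    Continuous (radDeriv (m := m) a κ δ) := by
  unfold radDeriv
  refine Continuous.add ((continuous_wt_norm_sq ha hδ).smul continuous_const) ?_
  rw [continuous_iff_continuousAt]
  intro w
  by_cases hw : w = 0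
  · subst hw
    rw [ContinuousAt]
    simp only [map_zero, ContinuousLinearMap.smulRight_zero, smul_zero]
    -- squeeze by `2 |a - κ θ| * wt`, which vanishes at the origin
    set b : Space m → ℝ := fun w =>
      |2 * (a - κ * (δ * ‖w‖ ^ 2 / (1 + δ * ‖w‖ ^ 2)))| * wt a κ δ (‖w‖ ^ 2) with hb
    have hbc : Continuous b := by
      refine Continuous.mul ?_ (continuous_wt_norm_sq ha hδ)
      refine Continuous.abs (continuous_const.mul (continuous_const.sub (continuous_const.mul
        (Continuous.div (by fun_prop) (by fun_prop) fun w => ?_))))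
      positivity
    -- Either `a = 0` and the bracket `a - κ θ` vanishes at the origin, or `a > 0` and the weight
    -- does.
    have hb0 : b 0 = 0 := by
      rcases ha.eq_or_lt with rfl | ha
      · simp [hb]
      · simp [hb, wt, Real.zero_rpow ha.ne']
    refine squeeze_zero_norm (a := b) (fun w => ?_) (by simpa [hb0] using hbc.tendsto 0)
    refine ContinuousLinearMap.opNorm_le_bound _ (by
      have := wt_nonneg (a := a) (κ := κ) hδ (sq_nonneg ‖w‖); positivity) fun ξ => ?_
    have hw := wt_nonneg (a := a) (κ := κ) hδ (sq_nonneg ‖w‖)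
    rw [smul_apply, ContinuousLinearMap.smulRight_apply, innerSL_apply_apply,
      norm_smul, Real.norm_eq_abs, abs_div, abs_mul, abs_of_nonneg hw,
      abs_of_nonneg (sq_nonneg ‖w‖), div_mul_eq_mul_div, mul_div_assoc]
    have := norm_inner_smul_div_le w ξ
    gcongr
  · have hq : ‖w‖ ^ 2 ≠ 0 := by positivity
    refine ContinuousAt.smul (ContinuousAt.div (ContinuousAt.mul ?_
      (continuous_wt_norm_sq ha hδ).continuousAt) (by fun_prop) hq) ?_
    · refine continuousAt_const.mul (continuousAt_const.sub (continuousAt_const.mul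
        (ContinuousAt.div (by fun_prop) (by fun_prop) ?_)))
      positivity
    · have h1 : Continuous fun w : Space m => innerSL ℝ w := (innerSL ℝ).continuous
      exact (((ContinuousLinearMap.smulRightL ℝ (Space m) (Space m)).continuous₂).comp
        (h1.prodMk continuous_id)).continuousAt

lemma contDiff_radField (ha : 0 ≤ a) (hδ : 0 ≤ δ) :
    ContDiff ℝ 1 (radField (m := m) a κ δ) := by
  rw [contDiff_one_iff_fderiv]
  refine ⟨fun w => (hasFDerivAt_radField ha hδ w).differentiableAt, ?_⟩
  have : fderiv ℝ (radField (m := m) a κ δ) = radDeriv a κ δ := by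
    ext1 w; exact (hasFDerivAt_radField ha hδ w).fderiv
  rw [this]; exact continuous_radDeriv ha hδ

lemma norm_radField (hδ : 0 ≤ δ) (w : Space m) :
    ‖radField a κ δ w‖ = wt a κ δ (‖w‖ ^ 2) * ‖w‖ := by
  rw [radField, norm_smul, Real.norm_eq_abs, abs_of_nonneg (wt_nonneg hδ (sq_nonneg _))]

/-- The convex potential of `radField`. -/
def potential (a κ δ : ℝ) (w : Space m) : ℝ := ∫ r in (0 : ℝ)..‖w‖ ^ 2, wt a κ δ (max r 0) / 2

lemma continuous_wt_max (ha : 0 ≤ a) (hδ : 0 ≤ δ) :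
    Continuous fun r : ℝ => wt a κ δ (max r 0) / 2 :=
  ((continuousOn_wt ha hδ).comp_continuous (by fun_prop) fun r => by simp).div_const 2

lemma hasFDerivAt_potential (ha : 0 ≤ a) (hδ : 0 ≤ δ) (w : Space m) :
    HasFDerivAt (potential a κ δ) (innerSL ℝ (radField a κ δ w)) w := by
  have h1 := ((continuous_wt_max (κ := κ) ha hδ).integral_hasStrictDerivAt 0
    (‖w‖ ^ 2)).hasDerivAt.comp_hasFDerivAt w (hasFDerivAt_norm_sq' w)
  refine h1.congr_fderiv ?_
  ext ξ
  simp only [smul_apply, innerSL_apply_apply, smul_eq_mul, radField,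
    inner_smul_left, conj_trivial, max_eq_left (sq_nonneg ‖w‖)]
  ring

lemma contDiff_potential (ha : 0 ≤ a) (hδ : 0 ≤ δ) :
    ContDiff ℝ 1 (potential (m := m) a κ δ) := by
  rw [contDiff_one_iff_fderiv]
  refine ⟨fun w => (hasFDerivAt_potential ha hδ w).differentiableAt, ?_⟩
  have : fderiv ℝ (potential (m := m) a κ δ) = fun w => innerSL ℝ (radField a κ δ w) := by
    ext1 w; exact (hasFDerivAt_potential ha hδ w).fderiv
  rw [this]; exact (innerSL ℝ).continuous.comp (continuous_radField ha hδ)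

lemma potential_nonneg (hδ : 0 ≤ δ) (w : Space m) : 0 ≤ potential a κ δ w :=
  intervalIntegral.integral_nonneg (sq_nonneg _) fun r _ =>
    div_nonneg (wt_nonneg hδ (le_max_right _ _)) (by norm_num)

lemma sq_rpow_eq (r : ℝ) (hr : 0 ≤ r) (b : ℝ) : (r ^ 2) ^ b = r ^ (2 * b) := by
  rw [← Real.rpow_natCast r 2, ← Real.rpow_mul hr]; norm_num

lemma rpow_sq_mul (ha : 0 ≤ a) {r : ℝ} (hr : 0 ≤ r) : (r ^ 2) ^ a * r ^ 2 = r ^ (2 * a + 2) := by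
  rw [sq_rpow_eq r hr, Real.rpow_add' hr (by linarith)]; norm_num

lemma potential_le (ha : 0 ≤ a) (hκ : 0 ≤ κ) (hδ : 0 ≤ δ) (w : Space m) :
    potential a κ δ w ≤ ‖w‖ ^ (2 * a + 2) := by
  have h1 : potential a κ δ w ≤ ∫ r in (0 : ℝ)..‖w‖ ^ 2, (‖w‖ ^ 2) ^ a := by
    refine intervalIntegral.integral_mono_on (sq_nonneg _)
      ((continuous_wt_max ha hδ).intervalIntegrable _ _) intervalIntegrable_const fun r hr => ?_
    rw [max_eq_left hr.1]
    have h2 := wt_le_rpow (a := a) hκ hδ hr.1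
    have h3 := wt_nonneg (a := a) (κ := κ) hδ hr.1
    have h4 : r ^ a ≤ (‖w‖ ^ 2) ^ a := Real.rpow_le_rpow hr.1 hr.2 ha
    linarith
  refine h1.trans (le_of_eq ?_)
  rw [intervalIntegral.integral_const, sub_zero, smul_eq_mul, mul_comm, rpow_sq_mul ha (norm_nonneg w)]

/-- With `κ = a + 1/3` one has `wt r · r^(1/3) = (r / (1 + δ r))^(a + 1/3)`, which increases in `r`.
Bounding it by its value at `q = ‖w‖²` and integrating `r^(-1/3) / 2` over `(0, q)` gives the
constant `3/4`. -/
lemma potential_le_wt (ha : 0 ≤ a) (hδ : 0 ≤ δ) (w : Space m) :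
    potential a (a + 1 / 3) δ w ≤ wt a (a + 1 / 3) δ (‖w‖ ^ 2) * ‖w‖ ^ 2 := by
  by_cases hw : w = 0
  · simp [hw, potential]
  set q := ‖w‖ ^ 2 with hq
  have hq0 : 0 < q := by positivity
  -- `wt r * r ^ (1 / 3)` is monotone
  have hm : ∀ r, 0 < r → wt a (a + 1 / 3) δ r = r ^ (-(1 / 3) : ℝ) * (r / (1 + δ * r)) ^ (a + 1 / 3) := by
    intro r hr
    have h1 : 0 < 1 + δ * r := by positivity
    rw [Real.div_rpow hr.le h1.le, wt, Real.rpow_neg h1.le, ← mul_div_assoc, ← Real.rpow_add hr]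
    rw [div_eq_mul_inv]; congr 2; ring
  have h1 : potential a (a + 1 / 3) δ w ≤
      ∫ r in (0 : ℝ)..q, (q / (1 + δ * q)) ^ (a + 1 / 3) / 2 * r ^ (-(1 / 3) : ℝ) := by
    refine intervalIntegral.integral_mono_on_of_le_Ioo hq0.le
      ((continuous_wt_max ha hδ).intervalIntegrable _ _)
      ((intervalIntegral.intervalIntegrable_rpow' (by norm_num)).const_mul _) fun r hr => ?_
    have h2 : 0 < 1 + δ * r := by have := hr.1; positivity
    have h3 : 0 < 1 + δ * q := by positivity
    have h4 : r / (1 + δ * r) ≤ q / (1 + δ * q) := by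
      rw [div_le_div_iff₀ h2 h3]; nlinarith [hr.2]
    have h5 : (r / (1 + δ * r)) ^ (a + 1 / 3) ≤ (q / (1 + δ * q)) ^ (a + 1 / 3) :=
      Real.rpow_le_rpow (div_nonneg hr.1.le h2.le) h4 (by linarith)
    rw [max_eq_left hr.1.le, hm r hr.1]
    have h6 : 0 ≤ r ^ (-(1 / 3) : ℝ) := Real.rpow_nonneg hr.1.le _
    nlinarith
  refine h1.trans ?_
  rw [intervalIntegral.integral_const_mul, integral_rpow (Or.inl (by norm_num)), hm q hq0,
    Real.zero_rpow (by norm_num)]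
  have h7 : q ^ (-(1 / 3) : ℝ) * q = q ^ (-(1 / 3) + 1 : ℝ) := (Real.rpow_add_one hq0.ne' _).symm
  have h8 : 0 ≤ (q / (1 + δ * q)) ^ (a + 1 / 3) := by positivity
  have h9 : 0 ≤ q ^ (-(1 / 3) + 1 : ℝ) := by positivity
  calc (q / (1 + δ * q)) ^ (a + 1 / 3) / 2 * ((q ^ (-(1 / 3) + 1 : ℝ) - 0) / (-(1 / 3) + 1))
      = 3 / 4 * ((q / (1 + δ * q)) ^ (a + 1 / 3) * q ^ (-(1 / 3) + 1 : ℝ)) := by ring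
    _ ≤ (q / (1 + δ * q)) ^ (a + 1 / 3) * q ^ (-(1 / 3) + 1 : ℝ) := by
        nlinarith [mul_nonneg h8 h9]
    _ = _ := by rw [← h7]; ring

lemma tendsto_wt_one_div (q : ℝ) :
    Tendsto (fun k : ℕ => wt a κ (1 / ((k : ℝ) + 1)) q) atTop (𝓝 (q ^ a)) := by
  have h1 : Tendsto (fun k : ℕ => 1 + 1 / ((k : ℝ) + 1) * q) atTop (𝓝 1) := by
    simpa using (tendsto_one_div_add_atTop_nhds_zero_nat.mul_const q).const_add 1
  have h2 := (h1.rpow_const (p := -κ) (Or.inl one_ne_zero)).const_mul (q ^ a)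
  simpa [wt] using h2

/-- Removal of the truncation: the weights converge to `r ^ a` below the majorant `r ^ a`. For `a =
(p - 2) / 2` the limit is `‖w‖ ^ p / p`. -/
lemma tendsto_potential (ha : 0 ≤ a) (hκ : 0 ≤ κ) (w : Space m) :
    Tendsto (fun k : ℕ => potential a κ (1 / ((k : ℝ) + 1)) w) atTop
      (𝓝 (‖w‖ ^ (2 * a + 2) / (2 * a + 2))) := by
  have hlim : ‖w‖ ^ (2 * a + 2) / (2 * a + 2) = ∫ r in (0 : ℝ)..‖w‖ ^ 2, r ^ a / 2 := by
    rw [intervalIntegral.integral_div, integral_rpow (Or.inl (by linarith)),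
      Real.zero_rpow (by linarith), sq_rpow_eq _ (norm_nonneg w)]
    rw [sub_zero, div_div]
    congr 1
    · congr 1; ring
    · ring
  rw [hlim]
  refine intervalIntegral.tendsto_integral_filter_of_dominated_convergence
    (fun r => (max r 0) ^ a) (Eventually.of_forall fun k =>
      (continuous_wt_max ha (by positivity)).aestronglyMeasurable)
    (Eventually.of_forall fun k => Eventually.of_forall fun r _ => ?_) ?_
    (Eventually.of_forall fun r hr => ?_)
  · have h0 : (0 : ℝ) ≤ 1 / ((k : ℝ) + 1) := by positivity
    have h1 := wt_nonneg (a := a) (κ := κ) h0 (le_max_right r 0)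
    have h2 := wt_le_rpow (a := a) hκ h0 (le_max_right r 0)
    rw [Real.norm_eq_abs, abs_of_nonneg (by positivity)]
    linarith
  · exact ((continuous_id.max continuous_const).rpow_const fun _ => Or.inr ha).intervalIntegrable _ _
  · rw [uIoc_of_le (sq_nonneg _)] at hr
    rw [max_eq_left hr.1.le]
    exact (tendsto_wt_one_div r).div_const 2

end TruncatedPower

/-! ### Weak derivatives tested against `C¹` functions -/

section WeakDerivatives

variable {m : ℕ}

lemma space_eq_sum (w : Space m) : w = ∑ i, w i • basisVec i := by
  ext j
  simp [Finset.sum_apply, Pi.single_apply]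

lemma clm_eq_sum {F : Type*} [NormedAddCommGroup F] [NormedSpace ℝ F] (A : Space m →L[ℝ] F)
    (w : Space m) : A w = ∑ i, w i • A (basisVec i) := by
  conv_lhs => rw [space_eq_sum w]
  simp

lemma fderiv_moll_of_contDiff {F : Type*} [NormedAddCommGroup F] [NormedSpace ℝ F]
    [CompleteSpace F] {φ : Space m → F} (hφ : ContDiff ℝ 1 φ)
    (hc : HasCompactSupport φ) (n : ℕ) (x w : Space m) :
    fderiv ℝ (moll n φ) x w = moll n (fun y => fderiv ℝ φ y w) x := by
  have h := hc.hasFDerivAt_convolution_right (ContinuousLinearMap.lsmul ℝ ℝ)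
    (μ := (volume : Measure (Space m)))
    (kernel_continuous (m := m) n).locallyIntegrable hφ x
  rw [moll, h.fderiv, convolution_def, ContinuousLinearMap.integral_apply]
  · rw [moll, convolution_def]; rfl
  · exact ((hc.fderiv (𝕜 := ℝ)).convolutionExists_right
      ((ContinuousLinearMap.lsmul ℝ ℝ).precompR (Space m) : _ →L[ℝ] (Space m →L[ℝ] F) →L[ℝ] _)
      (kernel_continuous (m := m) n).locallyIntegrable (hφ.continuous_fderiv (by norm_num)) x)

lemma tendsto_moll_of_continuous {F : Type*} [NormedAddCommGroup F] [NormedSpace ℝ F]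
    [CompleteSpace F] {φ : Space m → F} (hφ : Continuous φ)
    (x : Space m) : Tendsto (fun n => moll n φ x) atTop (𝓝 (φ x)) :=
  ContDiffBump.convolution_tendsto_right_of_continuous (φ := fun n => mollBump m n)
    tendsto_one_div_add_atTop_nhds_zero_nat hφ x

lemma norm_moll_le_const {F : Type*} [NormedAddCommGroup F] [NormedSpace ℝ F]
    {φ : Space m → F} (hφ : Continuous φ) {C : ℝ} (hC : ∀ x, ‖φ x‖ ≤ C) (n : ℕ) (x : Space m) :
    ‖moll n φ x‖ ≤ C := by
  refine (norm_moll_le n φ x).trans ?_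
  have := moll_mono n hφ.norm.locallyIntegrable (locallyIntegrable_const C)
    (Eventually.of_forall hC) x
  rwa [moll_const] at this

lemma moll_eq_zero {F : Type*} [NormedAddCommGroup F] [NormedSpace ℝ F]
    {φ : Space m → F} (n : ℕ) {x : Space m} (hx : x ∉ Metric.cthickening 1 (tsupport φ)) :
    moll n φ x = 0 := by
  have : moll n φ x = moll n (0 : Space m → F) x := by
    refine moll_congr_ball n fun y hy => ?_
    by_contra h
    exact hx (Metric.mem_cthickening_of_dist_le x y 1 _ (subset_tsupport _ h)
      (by rw [dist_eq_norm]; exact hy.le))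
  rw [this, moll_apply]; simp

lemma hasCompactSupport_moll {F : Type*} [NormedAddCommGroup F] [NormedSpace ℝ F]
    {φ : Space m → F} (hc : HasCompactSupport φ) (n : ℕ) : HasCompactSupport (moll n φ) :=
  HasCompactSupport.intro (IsCompact.cthickening (r := 1) hc) fun _ hx => moll_eq_zero n hx

lemma tendsto_integral_moll_smul {F : Type*} [NormedAddCommGroup F] [NormedSpace ℝ F]
    {φ : Space m → ℝ} (hφ : Continuous φ) (hc : HasCompactSupport φ) {f : Space m → F}
    (hf : LocallyIntegrable f volume) :
    Tendsto (fun n => ∫ x, moll n φ x • f x) atTop (𝓝 (∫ x, φ x • f x)) := by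
  obtain ⟨C, hC⟩ := hc.exists_bound_of_continuous hφ
  set K := Metric.cthickening 1 (tsupport φ) with hK
  have hKc : IsCompact K := IsCompact.cthickening hc
  refine tendsto_integral_of_dominated_convergence (fun x => K.indicator (fun x => C * ‖f x‖) x)
    (fun n => ((moll_continuous n hφ.locallyIntegrable).aestronglyMeasurable.smul
      hf.aestronglyMeasurable)) ?_ (fun n => Eventually.of_forall fun x => ?_)
    (Eventually.of_forall fun x => ?_)
  · rw [integrable_indicator_iff hKc.measurableSet]
    exact ((hf.integrableOn_isCompact hKc).norm).const_mul C
  · by_cases hx : x ∈ K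
    · rw [indicator_of_mem hx, norm_smul]
      gcongr
      exact norm_moll_le_const hφ hC n x
    · rw [indicator_of_notMem hx, moll_eq_zero n hx]; simp
  · exact (tendsto_moll_of_continuous hφ x).smul_const _

lemma HasCompactSupport.fderiv_apply_const {F : Type*} [NormedAddCommGroup F] [NormedSpace ℝ F]
    {φ : Space m → F} (hc : HasCompactSupport φ) (w : Space m) :
    HasCompactSupport fun x => fderiv ℝ φ x w :=
  (hc.fderiv (𝕜 := ℝ)).comp_left (g := fun A : Space m →L[ℝ] F => A w) (by simp)

lemma ContDiff.continuous_fderiv_const {F : Type*} [NormedAddCommGroup F] [NormedSpace ℝ F]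
    {φ : Space m → F} (hφ : ContDiff ℝ 1 φ) (w : Space m) :
    Continuous fun x => fderiv ℝ φ x w :=
  (hφ.continuous_fderiv (by norm_num)).clm_apply continuous_const

/-- A weak derivative may be tested against `C¹` functions. -/
lemma HasWeakPartial.integral_eq {i : Fin m} {f g : Space m → Space m} (h : HasWeakPartial i f g)
    {φ : Space m → ℝ} (hφ : ContDiff ℝ 1 φ) (hc : HasCompactSupport φ) :
    ∫ x, fderiv ℝ φ x (basisVec i) • f x = -∫ x, φ x • g x := by
  have h1 := tendsto_integral_moll_smul (ContDiff.continuous_fderiv_const hφ (basisVec i))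
    (HasCompactSupport.fderiv_apply_const hc (basisVec i)) h.1
  have h2 := (tendsto_integral_moll_smul hφ.continuous hc h.2.1).neg
  -- The mollified test function is smooth and mollification commutes with its derivative, so the
  -- definition applies for each `n`. This class of tests is needed because `radField` is only known
  -- to be `C¹`.
  refine tendsto_nhds_unique (h1.congr fun n => ?_) h2
  rw [← h.2.2 (moll n φ) (moll_contDiff n hφ.continuous.locallyIntegrable)
    (hasCompactSupport_moll hc n)]
  congr 1; ext1 x
  rw [fderiv_moll_of_contDiff hφ hc]

lemma integrable_smul_of_compact {F : Type*} [NormedAddCommGroup F] [NormedSpace ℝ F]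
    {φ : Space m → ℝ} (hφ : Continuous φ) (hc : HasCompactSupport φ)
    {f : Space m → F} (hf : LocallyIntegrable f volume) : Integrable (fun x => φ x • f x) volume :=
  hf.integrable_smul_left_of_hasCompactSupport hφ hc

lemma LocallyIntegrable.clm_comp {F G : Type*} [NormedAddCommGroup F] [NormedSpace ℝ F]
    [NormedAddCommGroup G] [NormedSpace ℝ G] (A : F →L[ℝ] G)
    {f : Space m → F} (hf : LocallyIntegrable f volume) :
    LocallyIntegrable (fun x => A (f x)) volume := fun x => by
  obtain ⟨s, hs, h⟩ := hf x
  exact ⟨s, hs, A.integrable_comp h⟩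

lemma LocallyIntegrable.coord {f : Space m → Space m} (hf : LocallyIntegrable f volume)
    (k : Fin m) : LocallyIntegrable (fun x => f x k) volume :=
  LocallyIntegrable.clm_comp (EuclideanSpace.proj k : Space m →L[ℝ] ℝ) hf

lemma integral_smul_coord {φ : Space m → ℝ} (hφ : Continuous φ) (hc : HasCompactSupport φ)
    {f : Space m → Space m} (hf : LocallyIntegrable f volume) (k : Fin m) :
    (∫ x, φ x • f x) k = ∫ x, φ x * f x k := by
  have := (EuclideanSpace.proj k : Space m →L[ℝ] ℝ).integral_comp_comm
    (integrable_smul_of_compact hφ hc hf)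
  simpa using this.symm

lemma HasWeakPartial.integral_coord {i : Fin m} {f g : Space m → Space m}
    (h : HasWeakPartial i f g) {φ : Space m → ℝ} (hφ : ContDiff ℝ 1 φ) (hc : HasCompactSupport φ)
    (k : Fin m) :
    ∫ x, fderiv ℝ φ x (basisVec i) * f x k = -∫ x, φ x * g x k := by
  have := congrArg (fun w : Space m => w k) (h.integral_eq hφ hc)
  simp only [PiLp.neg_apply] at this
  rwa [integral_smul_coord (ContDiff.continuous_fderiv_const hφ _)
    (HasCompactSupport.fderiv_apply_const hc _) h.1, integral_smul_coord hφ.continuous hc h.2.1]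
    at this

/-- A divergence-free field is orthogonal to gradients. -/
lemma integral_fderiv_eq_zero {v : Space m → Space m} {Dv : Fin m → Space m → Space m}
    (hv : ∀ i, HasWeakPartial i v (Dv i)) (hdiv : ∀ᵐ x, divergence Dv x = 0)
    {φ : Space m → ℝ} (hφ : ContDiff ℝ 1 φ) (hc : HasCompactSupport φ) :
    ∫ x, fderiv ℝ φ x (v x) = 0 := by
  have e : ∀ x, fderiv ℝ φ x (v x) = ∑ i, fderiv ℝ φ x (basisVec i) * v x i := by
    intro x; rw [clm_eq_sum]; simp [mul_comm]
  simp only [e]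
  rw [integral_finsetSum]
  · rw [Finset.sum_congr rfl fun i _ => (hv i).integral_coord hφ hc i, Finset.sum_neg_distrib,
      ← integral_finsetSum]
    · rw [neg_eq_zero]
      refine integral_eq_zero_of_ae ?_
      filter_upwards [hdiv] with x hx
      rw [← Finset.mul_sum, Pi.zero_apply]
      rw [divergence] at hx
      rw [hx, mul_zero]
    · exact fun i _ => integrable_smul_of_compact hφ.continuous hc (LocallyIntegrable.coord (hv i).2.1 i)
  · exact fun i _ => integrable_smul_of_compact (ContDiff.continuous_fderiv_const hφ _)
      (HasCompactSupport.fderiv_apply_const hc _) (LocallyIntegrable.coord (hv i).1 i)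

lemma integrable_fderiv_apply {F : Type*} [NormedAddCommGroup F] [NormedSpace ℝ F]
    {v : Space m → Space m} (hv : LocallyIntegrable v volume)
    {φ : Space m → F} (hφ : ContDiff ℝ 1 φ) (hc : HasCompactSupport φ) :
    Integrable (fun x => fderiv ℝ φ x (v x)) volume := by
  have e : ∀ x, fderiv ℝ φ x (v x) = ∑ i, v x i • fderiv ℝ φ x (basisVec i) := fun x => clm_eq_sum _ _
  simp only [e]
  exact integrable_finsetSum _ fun i _ =>
    (LocallyIntegrable.coord hv i).integrable_smul_right_of_hasCompactSupport
      (ContDiff.continuous_fderiv_const hφ _) (HasCompactSupport.fderiv_apply_const hc _)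

lemma integral_fderiv_eq_zero_vec {v : Space m → Space m} {Dv : Fin m → Space m → Space m}
    (hv : ∀ i, HasWeakPartial i v (Dv i)) (hl : LocallyIntegrable v volume)
    (hdiv : ∀ᵐ x, divergence Dv x = 0)
    {φ : Space m → Space m} (hφ : ContDiff ℝ 1 φ) (hc : HasCompactSupport φ) :
    ∫ x, fderiv ℝ φ x (v x) = 0 := by
  ext k
  have h1 := (EuclideanSpace.proj k : Space m →L[ℝ] ℝ).integral_comp_comm
    (integrable_fderiv_apply hl hφ hc)
  have h2 : ∀ x, (EuclideanSpace.proj k : Space m →L[ℝ] ℝ) (fderiv ℝ φ x (v x)) =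
      fderiv ℝ (fun y => (EuclideanSpace.proj k : Space m →L[ℝ] ℝ) (φ y)) x (v x) := by
    intro x
    have h3 := ((EuclideanSpace.proj k : Space m →L[ℝ] ℝ).hasFDerivAt.comp x
      (hφ.differentiable (by norm_num) x).hasFDerivAt).fderiv
    exact (congrArg (fun A : Space m →L[ℝ] ℝ => A (v x)) h3).symm
  simp only [h2] at h1
  exact h1.symm.trans (integral_fderiv_eq_zero hv hdiv
    ((EuclideanSpace.proj k : Space m →L[ℝ] ℝ).contDiff.comp hφ)
    (hc.comp_left (g := (EuclideanSpace.proj k : Space m →L[ℝ] ℝ)) (by simp)))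

end WeakDerivatives

/-! ### Integrable majorants at a fixed time -/

section Slices

variable {m : ℕ}

lemma sq_le_one_add_rpow {r p : ℝ} (hr : 0 ≤ r) (hp : 2 ≤ p) : r ^ 2 ≤ 1 + r ^ p := by
  rcases le_total r 1 with h | h
  · have := pow_le_one₀ (n := 2) hr h
    have := Real.rpow_nonneg hr p
    linarith
  · have := Real.rpow_le_rpow_of_exponent_le h hp
    rw [Real.rpow_two] at this
    linarith

lemma pow_le_one_add_pow {r : ℝ} (hr : 0 ≤ r) {j k : ℕ} (hjk : j ≤ k) : r ^ j ≤ 1 + r ^ k := by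
  rcases le_total r 1 with h | h
  · have := pow_le_one₀ (n := j) hr h
    have := pow_nonneg hr k
    linarith
  · have := pow_le_pow_right₀ h hjk
    linarith

/-- Young's inequality with `1/6 + 1/3 + 1/2 = 1`. The factor `a` will be the cube root of the
vorticity, `b` a field in `L^m` with `m ≥ 3`, and `c` a gradient in `L^p` with `p ≥ 2`. -/
lemma young_six_three_two {a b c : ℝ} (hb : 0 ≤ b) :
    a * b * c ≤ a ^ 6 + b ^ 3 + c ^ 2 := by
  have h1 : a ^ 2 * b ^ 2 ≤ a ^ 6 + b ^ 3 := by
    -- With `x = a²` the product expands to `x³ - 3 x b² + 2 b³`, the arithmetic–geometric mean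
    -- inequality for `x, b, b`.
    have h2 : 0 ≤ (a ^ 2 + 2 * b) * (a ^ 2 - b) ^ 2 := by positivity
    have h3 : 0 ≤ a ^ 6 := by positivity
    have h4 : 0 ≤ b ^ 3 := by positivity
    nlinarith
  nlinarith [sq_nonneg (a * b - c), sq_nonneg (a * b + c), sq_nonneg c]

/-- Dominated convergence against a compactly supported weight. -/
lemma tendsto_integral_of_le_weight {F : Type*} [NormedAddCommGroup F] [NormedSpace ℝ F]
    {f : ℕ → Space m → F} {f' : Space m → F}
    {c V : Space m → ℝ} (hc : Continuous c) (hcs : HasCompactSupport c)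
    (hf : ∀ n, AEStronglyMeasurable (f n) volume) (hV : Integrable V volume) (hV0 : ∀ x, 0 ≤ V x)
    (hfg : ∀ n x, ‖f n x‖ ≤ |c x| * (1 + V x + moll n V x))
    (hlim : ∀ᵐ x, Tendsto (fun n => f n x) atTop (𝓝 (f' x))) :
    Integrable f' volume ∧ Tendsto (fun n => ∫ x, f n x) atTop (𝓝 (∫ x, f' x)) := by
  obtain ⟨C, hC⟩ := hcs.exists_bound_of_continuous hc
  have hC0 : 0 ≤ C := (norm_nonneg _).trans (hC 0)
  refine tendsto_integral_of_le_moll (G := fun x => |c x| + C * V x) (V := fun x => C * V x) hf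
    (((hc.integrable_of_hasCompactSupport hcs).abs).add (hV.const_mul C)) (hV.const_mul C)
    (fun n => Eventually.of_forall fun x => (hfg n x).trans ?_) hlim
  have h1 : |c x| ≤ C := hC x
  have h2 := moll_nonneg n hV0 x
  rw [moll_const_mul]
  have h3 := mul_le_mul_of_nonneg_right h1 (hV0 x)
  have h4 := mul_le_mul_of_nonneg_right h1 h2
  nlinarith

/-- The bound does not depend on `n`, because mollification preserves the integral of the majorant.
-/
lemma norm_integral_le_of_le_weight {F : Type*} [NormedAddCommGroup F] [NormedSpace ℝ F]
    {f : Space m → F}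
    {c V : Space m → ℝ} (hc : Continuous c) (hcs : HasCompactSupport c) {C : ℝ}
    (hC : ∀ x, |c x| ≤ C) (n : ℕ)
    (hV : Integrable V volume) (hV0 : ∀ x, 0 ≤ V x)
    (hfg : ∀ x, ‖f x‖ ≤ |c x| * (1 + V x + moll n V x)) :
    ‖∫ x, f x‖ ≤ (∫ x, |c x|) + 2 * C * ∫ x, V x := by
  have hi1 := (hc.integrable_of_hasCompactSupport hcs (μ := volume)).abs
  have hi2 : Integrable (fun x => C * V x) volume := hV.const_mul C
  have hi3 : Integrable (fun x => C * moll n V x) volume := (integrable_moll n hV).const_mul C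
  have h : ‖∫ x, f x‖ ≤ ∫ x, ((|c x| + C * V x) + C * moll n V x) := by
    refine norm_integral_le_of_norm_le ((hi1.add hi2).add hi3) (Eventually.of_forall fun x =>
      (hfg x).trans ?_)
    have h2 := moll_nonneg n hV0 x
    have h3 := mul_le_mul_of_nonneg_right (hC x) (hV0 x)
    have h4 := mul_le_mul_of_nonneg_right (hC x) h2
    nlinarith
  rw [integral_add (f := fun x => |c x| + C * V x) (hi1.add hi2) hi3, integral_add hi1 hi2,
    integral_const_mul, integral_const_mul, integral_moll n hV] at h
  linarith

/-- The velocity `v` and vorticity `f` at a fixed time, with their weak gradients. -/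
structure Slice (p : ℝ) (v f : Space m → Space m) (Dv Df : Fin m → Space m → Space m) : Prop where
  two_le : 2 ≤ p
  three_le : 3 ≤ m
  memLp_v : MemLp v (m : ℝ≥0∞) volume
  memLp_f : MemLp f (m : ℝ≥0∞) volume
  memLp_f' : MemLp f (ENNReal.ofReal p) volume
  memLp_Dv : ∀ i, MemLp (Dv i) (ENNReal.ofReal p) volume
  memLp_Df : ∀ i, MemLp (Df i) (ENNReal.ofReal p) volume
  weak_v : ∀ i, HasWeakPartial i v (Dv i)
  weak_f : ∀ i, HasWeakPartial i f (Df i)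
  div_v : ∀ᵐ x, divergence Dv x = 0
  div_f : ∀ᵐ x, divergence Df x = 0

/-- The function controlling all integrands at a fixed time. -/
def majorant (p Λ : ℝ) (v f : Space m → Space m) (Dv Df : Fin m → Space m → Space m)
    (x : Space m) : ℝ :=
  ‖v x‖ ^ m + ‖f x‖ ^ m + ‖f x‖ ^ p + (∑ i, (‖Df i x‖ / Λ) ^ p + ∑ i, (‖Dv i x‖ / Λ) ^ p)

/-- The nonlinear term `v · ∇f - f · ∇v`. -/
def nonlin (v f : Space m → Space m) (Dv Df : Fin m → Space m → Space m) (x : Space m) :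
    Space m := advect v Df x - advect f Dv x

variable {p Λ : ℝ} {v f : Space m → Space m} {Dv Df : Fin m → Space m → Space m}

lemma abs_coord_le (w : Space m) (i : Fin m) : |w i| ≤ ‖w‖ := by
  have := PiLp.norm_apply_le w i
  simpa using this

lemma norm_advect_le (v : Space m → Space m) (D : Fin m → Space m → Space m) (x : Space m) :
    ‖advect v D x‖ ≤ ∑ i, ‖v x‖ * ‖D i x‖ := by
  refine (norm_sum_le _ _).trans (Finset.sum_le_sum fun i _ => ?_)
  rw [norm_smul]
  gcongr
  exact abs_coord_le _ _

lemma memLp_integrable_rpow (hp : 2 ≤ p) {g : Space m → Space m}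
    (hg : MemLp g (ENNReal.ofReal p) volume) : Integrable (fun x => ‖g x‖ ^ p) volume := by
  have := hg.integrable_norm_rpow (by simp; linarith) ENNReal.ofReal_ne_top
  rwa [ENNReal.toReal_ofReal (by linarith)] at this

lemma memLp_integrable_pow (hm : 3 ≤ m) {g : Space m → Space m}
    (hg : MemLp g (m : ℝ≥0∞) volume) : Integrable (fun x => ‖g x‖ ^ m) volume :=
  hg.integrable_norm_pow (by omega)

lemma memLp_locallyIntegrable_rpow (hp : 2 ≤ p) {g : Space m → Space m}
    (hg : MemLp g (ENNReal.ofReal p) volume) : LocallyIntegrable g volume :=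
  hg.locallyIntegrable (by rw [ENNReal.one_le_ofReal]; linarith)

lemma majorant_nonneg (hΛ : 0 < Λ) (x : Space m) : 0 ≤ majorant p Λ v f Dv Df x := by
  unfold majorant
  have h1 : ∀ D : Fin m → Space m → Space m, 0 ≤ ∑ i, (‖D i x‖ / Λ) ^ p :=
    fun D => Finset.sum_nonneg fun i _ => by positivity
  have := h1 Df
  have := h1 Dv
  positivity

lemma pow_norm_v_le_majorant (hΛ : 0 < Λ) (x : Space m) :
    ‖v x‖ ^ m ≤ majorant p Λ v f Dv Df x := by
  have := majorant_nonneg (p := p) (v := 0) (f := f) (Dv := Dv) (Df := Df) hΛ x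
  unfold majorant at *
  have h0 : 0 ≤ ‖(0 : Space m → Space m) x‖ ^ m := by positivity
  have h1 : ‖(0 : Space m → Space m) x‖ ^ m ≤ ‖v x‖ ^ m :=
    pow_le_pow_left₀ (norm_nonneg _) (by simp) _
  have h2 : 0 ≤ ‖f x‖ ^ m := by positivity
  have h3 : 0 ≤ ‖f x‖ ^ p := by positivity
  have h4 : ∀ D : Fin m → Space m → Space m, 0 ≤ ∑ i, (‖D i x‖ / Λ) ^ p :=
    fun D => Finset.sum_nonneg fun i _ => by positivity
  linarith [h4 Df, h4 Dv]

lemma majorant_pieces (hΛ : 0 < Λ) (x : Space m) :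
    ‖f x‖ ^ m ≤ majorant p Λ v f Dv Df x ∧ ‖f x‖ ^ p ≤ majorant p Λ v f Dv Df x ∧
      (∀ i, (‖Df i x‖ / Λ) ^ p ≤ majorant p Λ v f Dv Df x) ∧
      (∀ i, (‖Dv i x‖ / Λ) ^ p ≤ majorant p Λ v f Dv Df x) := by
  unfold majorant
  have h1 : 0 ≤ ‖v x‖ ^ m := by positivity
  have h2 : 0 ≤ ‖f x‖ ^ m := by positivity
  have h3 : 0 ≤ ‖f x‖ ^ p := by positivity
  have h4 : ∀ D : Fin m → Space m → Space m, 0 ≤ ∑ i, (‖D i x‖ / Λ) ^ p :=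
    fun D => Finset.sum_nonneg fun i _ => by positivity
  have h5 : ∀ (D : Fin m → Space m → Space m) i, (‖D i x‖ / Λ) ^ p ≤ ∑ i, (‖D i x‖ / Λ) ^ p :=
    fun D i => Finset.single_le_sum (f := fun i => (‖D i x‖ / Λ) ^ p)
      (fun i _ => by positivity) (Finset.mem_univ i)
  have h6 := h4 Df
  have h7 := h4 Dv
  exact ⟨by linarith, by linarith, fun i => by linarith [h5 Df i], fun i => by linarith [h5 Dv i]⟩

namespace Slice

lemma two_le_exp (h : Slice p v f Dv Df) : (1 : ℝ≥0∞) ≤ (m : ℝ≥0∞) := by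
  have := h.three_le
  exact_mod_cast (by omega : 1 ≤ m)

lemma loc_v (h : Slice p v f Dv Df) : LocallyIntegrable v volume :=
  h.memLp_v.locallyIntegrable h.two_le_exp

lemma loc_f (h : Slice p v f Dv Df) : LocallyIntegrable f volume :=
  h.memLp_f.locallyIntegrable h.two_le_exp

lemma loc_Df (h : Slice p v f Dv Df) (i : Fin m) : LocallyIntegrable (Df i) volume :=
  memLp_locallyIntegrable_rpow h.two_le (h.memLp_Df i)

lemma integrable_div_rpow (h : Slice p v f Dv Df) (Λ : ℝ) (hΛ : 0 < Λ) {g : Space m → Space m}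
    (hg : MemLp g (ENNReal.ofReal p) volume) : Integrable (fun x => (‖g x‖ / Λ) ^ p) volume := by
  have := (memLp_integrable_rpow h.two_le hg).div_const (Λ ^ p)
  refine this.congr (Eventually.of_forall fun x => ?_)
  exact (Real.div_rpow (norm_nonneg _) hΛ.le _).symm

lemma integrable_majorant (h : Slice p v f Dv Df) (hΛ : 0 < Λ) :
    Integrable (majorant p Λ v f Dv Df) volume := by
  unfold majorant
  refine (((memLp_integrable_pow h.three_le h.memLp_v).add
    (memLp_integrable_pow h.three_le h.memLp_f)).add (memLp_integrable_rpow h.two_le h.memLp_f')).add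
    (Integrable.add ?_ ?_)
  · exact integrable_finsetSum _ fun i _ => h.integrable_div_rpow Λ hΛ (h.memLp_Df i)
  · exact integrable_finsetSum _ fun i _ => h.integrable_div_rpow Λ hΛ (h.memLp_Dv i)

lemma loc_majorant (h : Slice p v f Dv Df) (hΛ : 0 < Λ) :
    LocallyIntegrable (majorant p Λ v f Dv Df) volume := (h.integrable_majorant hΛ).locallyIntegrable

lemma moll_rpow_le (h : Slice p v f Dv Df) (hΛ : 0 < Λ) (n : ℕ) (x : Space m) :
    ‖moll n f x‖ ^ p ≤ moll n (majorant p Λ v f Dv Df) x := by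
  have h1 := (memLp_integrable_rpow h.two_le h.memLp_f').locallyIntegrable
  refine (rpow_norm_moll_le n (by linarith [h.two_le]) h.loc_f h1 x).trans ?_
  exact moll_mono n h1 (h.loc_majorant hΛ)
    (Eventually.of_forall fun y => (majorant_pieces hΛ y).2.1) x

lemma moll_pow_le (h : Slice p v f Dv Df) (hΛ : 0 < Λ) (n : ℕ) (x : Space m) :
    ‖moll n f x‖ ^ m ≤ moll n (majorant p Λ v f Dv Df) x := by
  have h1 := (memLp_integrable_pow h.three_le h.memLp_f).locallyIntegrable
  have h2 := rpow_norm_moll_le n (q := m) (by exact_mod_cast (by have := h.three_le; omega : 1 ≤ m))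
    h.loc_f (by simpa only [Real.rpow_natCast] using h1) x
  simp only [Real.rpow_natCast] at h2
  refine h2.trans ?_
  exact moll_mono n h1 (h.loc_majorant hΛ)
    (Eventually.of_forall fun y => (majorant_pieces hΛ y).1) x

lemma moll_grad_rpow_le (h : Slice p v f Dv Df) (hΛ : 0 < Λ) (n : ℕ) (i : Fin m) (x : Space m) :
    (‖moll n (Df i) x‖ / Λ) ^ p ≤ moll n (majorant p Λ v f Dv Df) x := by
  have h1 := (memLp_integrable_rpow h.two_le (h.memLp_Df i)).locallyIntegrable
  have h2 := rpow_norm_moll_le n (by linarith [h.two_le]) (h.loc_Df i) h1 x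
  rw [Real.div_rpow (norm_nonneg _) hΛ.le, div_le_iff₀' (by positivity), ← moll_const_mul]
  refine h2.trans (moll_mono n h1 ((h.loc_majorant hΛ).smul (Λ ^ p))
    (Eventually.of_forall fun y => ?_) x)
  have h3 := (majorant_pieces (p := p) (v := v) (f := f) (Dv := Dv) (Df := Df) hΛ y).2.2.1 i
  rw [Real.div_rpow (norm_nonneg _) hΛ.le, div_le_iff₀' (by positivity)] at h3
  exact h3

lemma moll_sq_le (h : Slice p v f Dv Df) (hΛ : 0 < Λ) (n : ℕ) (x : Space m) :
    ‖moll n f x‖ ^ 2 ≤ 1 + moll n (majorant p Λ v f Dv Df) x :=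
  (sq_le_one_add_rpow (norm_nonneg _) h.two_le).trans (by linarith [h.moll_rpow_le hΛ n x])

lemma moll_cube_le (h : Slice p v f Dv Df) (hΛ : 0 < Λ) (n : ℕ) (x : Space m) :
    ‖moll n f x‖ ^ 3 ≤ 1 + moll n (majorant p Λ v f Dv Df) x :=
  (pow_le_one_add_pow (norm_nonneg _) h.three_le).trans (by linarith [h.moll_pow_le hΛ n x])

lemma moll_grad_sq_le (h : Slice p v f Dv Df) (hΛ : 0 < Λ) (n : ℕ) (i : Fin m) (x : Space m) :
    (‖moll n (Df i) x‖ / Λ) ^ 2 ≤ 1 + moll n (majorant p Λ v f Dv Df) x :=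
  (sq_le_one_add_rpow (by positivity) h.two_le).trans (by linarith [h.moll_grad_rpow_le hΛ n i x])

lemma cube_v_le (h : Slice p v f Dv Df) (hΛ : 0 < Λ) (x : Space m) :
    ‖v x‖ ^ 3 ≤ 1 + majorant p Λ v f Dv Df x :=
  (pow_le_one_add_pow (norm_nonneg _) h.three_le).trans
    (by linarith [pow_norm_v_le_majorant (p := p) (v := v) (f := f) (Dv := Dv) (Df := Df) hΛ x])

lemma cube_f_le (h : Slice p v f Dv Df) (hΛ : 0 < Λ) (x : Space m) :
    ‖f x‖ ^ 3 ≤ 1 + majorant p Λ v f Dv Df x :=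
  (pow_le_one_add_pow (norm_nonneg _) h.three_le).trans
    (by linarith [(majorant_pieces (p := p) (v := v) (f := f) (Dv := Dv) (Df := Df) hΛ x).1])

lemma grad_sq_le (h : Slice p v f Dv Df) (hΛ : 0 < Λ) (i : Fin m) (x : Space m) :
    (‖Df i x‖ / Λ) ^ 2 ≤ 1 + majorant p Λ v f Dv Df x ∧
    (‖Dv i x‖ / Λ) ^ 2 ≤ 1 + majorant p Λ v f Dv Df x := by
  have h1 := majorant_pieces (p := p) (v := v) (f := f) (Dv := Dv) (Df := Df) hΛ x
  exact ⟨(sq_le_one_add_rpow (by positivity) h.two_le).trans (by linarith [h1.2.2.1 i]),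
    (sq_le_one_add_rpow (by positivity) h.two_le).trans (by linarith [h1.2.2.2 i])⟩

/-- Young's inequality is applied to gradients divided by `Λ`, and `Λ` is multiplied back
afterwards. When `Λ` is the size of the gradients, the majorant has bounded integral and the whole
estimate is linear in that size. -/
lemma mul_norm_nonlin_le (h : Slice p v f Dv Df) (hΛ : 0 < Λ) {a : ℝ} (ha : 0 ≤ a) (x : Space m) :
    a * ‖nonlin v f Dv Df x‖ ≤
      2 * m * Λ * (a ^ 6 + 2 + 2 * majorant p Λ v f Dv Df x) := by
  have h1 : ‖nonlin v f Dv Df x‖ ≤ ∑ i, (‖v x‖ * ‖Df i x‖ + ‖f x‖ * ‖Dv i x‖) := by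
    rw [Finset.sum_add_distrib]
    exact (norm_sub_le _ _).trans (add_le_add (norm_advect_le _ _ _) (norm_advect_le _ _ _))
  have h2 : ∀ i : Fin m, a * (‖v x‖ * ‖Df i x‖ + ‖f x‖ * ‖Dv i x‖) ≤
      2 * Λ * (a ^ 6 + 2 + 2 * majorant p Λ v f Dv Df x) := by
    intro i
    have e1 := young_six_three_two (a := a) (c := ‖Df i x‖ / Λ) (norm_nonneg (v x))
    have e2 := young_six_three_two (a := a) (c := ‖Dv i x‖ / Λ) (norm_nonneg (f x))
    have e3 := h.grad_sq_le hΛ i x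
    have e4 := h.cube_f_le hΛ x
    have e5 := h.cube_v_le hΛ x
    have e6 : a * ‖v x‖ * (‖Df i x‖ / Λ) + a * ‖f x‖ * (‖Dv i x‖ / Λ) ≤
      2 * (a ^ 6 + 2 + 2 * majorant p Λ v f Dv Df x) := by
      have := e3.1; have := e3.2; linarith
    calc a * (‖v x‖ * ‖Df i x‖ + ‖f x‖ * ‖Dv i x‖)
        = Λ * (a * ‖v x‖ * (‖Df i x‖ / Λ) + a * ‖f x‖ * (‖Dv i x‖ / Λ)) := by
          field_simp
      _ ≤ Λ * (2 * (a ^ 6 + 2 + 2 * majorant p Λ v f Dv Df x)) := by gcongr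
      _ = _ := by ring
  calc a * ‖nonlin v f Dv Df x‖ ≤ a * ∑ i, (‖v x‖ * ‖Df i x‖ + ‖f x‖ * ‖Dv i x‖) := by gcongr
    _ = ∑ i, a * (‖v x‖ * ‖Df i x‖ + ‖f x‖ * ‖Dv i x‖) := Finset.mul_sum _ _ _
    _ ≤ ∑ _i : Fin m, 2 * Λ * (a ^ 6 + 2 + 2 * majorant p Λ v f Dv Df x) :=
        Finset.sum_le_sum fun i _ => h2 i
    _ = _ := by simp; ring

lemma aestronglyMeasurable_advect {v : Space m → Space m} {D : Fin m → Space m → Space m}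
    (hv : AEStronglyMeasurable v volume) (hD : ∀ i, AEStronglyMeasurable (D i) volume) :
    AEStronglyMeasurable (advect v D) volume := by
  unfold advect
  refine Finset.aestronglyMeasurable_fun_sum _ fun i _ =>
    AEStronglyMeasurable.smul (f := fun x => v x i) ?_ (hD i)
  exact (EuclideanSpace.proj i : Space m →L[ℝ] ℝ).continuous.comp_aestronglyMeasurable hv

lemma aestronglyMeasurable_nonlin (h : Slice p v f Dv Df) :
    AEStronglyMeasurable (nonlin v f Dv Df) volume :=
  (aestronglyMeasurable_advect h.memLp_v.1 fun i => (h.memLp_Df i).1).sub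
    (aestronglyMeasurable_advect h.memLp_f.1 fun i => (h.memLp_Dv i).1)

lemma loc_nonlin (h : Slice p v f Dv Df) : LocallyIntegrable (nonlin v f Dv Df) volume := by
  have h1 : LocallyIntegrable (fun x => 2 * m * 1 * (1 ^ 6 + 2 + 2 * majorant p 1 v f Dv Df x))
      (volume : Measure (Space m)) :=
    ((locallyIntegrable_const _).add ((h.loc_majorant one_pos).smul (2 : ℝ))).smul (2 * m * 1 : ℝ)
  refine h1.mono h.aestronglyMeasurable_nonlin (Eventually.of_forall fun x => ?_)
  have := h.mul_norm_nonlin_le one_pos zero_le_one x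
  rw [one_mul] at this
  exact this.trans (le_abs_self _)

end Slice

end Slices

/-! ### The forms in the energy balance and their limits under mollification -/

section Functionals

variable {m : ℕ}

/-- `|∇f|² = ∑ᵢ |∂ᵢ f|²`. -/
def gradSq (D : Fin m → Space m → Space m) (x : Space m) : ℝ := ∑ i, ‖D i x‖ ^ 2

/-- `|∇η|²` for a scalar function. -/
def cutGradSq (η : Space m → ℝ) (x : Space m) : ℝ := ∑ i, fderiv ℝ η x (basisVec i) ^ 2

/-- `∫ χ ∇f : β''(f) ∇f`. -/
def dissipForm (a δ : ℝ) (χ : Space m → ℝ) (f : Space m → Space m)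
    (D : Fin m → Space m → Space m) : ℝ :=
  ∫ x, χ x * ∑ i, inner ℝ (radDeriv a (a + 1 / 3) δ (f x) (D i x)) (D i x)

/-- `∫ ∇χ · ∇(β(f))`. -/
def crossForm (a δ : ℝ) (χ : Space m → ℝ) (f : Space m → Space m)
    (D : Fin m → Space m → Space m) : ℝ :=
  ∫ x, ∑ i, fderiv ℝ χ x (basisVec i) * inner ℝ (radField a (a + 1 / 3) δ (f x)) (D i x)

/-- `∫ χ β'(f) · N`. -/
def transForm (a δ : ℝ) (χ : Space m → ℝ) (f N : Space m → Space m) : ℝ :=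
  ∫ x, χ x * inner ℝ (radField a (a + 1 / 3) δ (f x)) (N x)

/-- The weighted dissipation `∫ η² h(f) |∇f|²`. -/
def wDissip (a δ : ℝ) (η : Space m → ℝ) (f : Space m → Space m)
    (D : Fin m → Space m → Space m) : ℝ :=
  ∫ x, η x ^ 2 * (wt a (a + 1 / 3) δ (‖f x‖ ^ 2) * gradSq D x)

/-- The cutoff error `∫ |∇η|² h(f) |f|²`. -/
def wCut (a δ : ℝ) (η : Space m → ℝ) (f : Space m → Space m) : ℝ :=
  ∫ x, cutGradSq η x * (wt a (a + 1 / 3) δ (‖f x‖ ^ 2) * ‖f x‖ ^ 2)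

/-- The weighted mass `∫ η² h(f) |f|²`. -/
def wMass (a δ : ℝ) (η : Space m → ℝ) (f : Space m → Space m) : ℝ :=
  ∫ x, η x ^ 2 * (wt a (a + 1 / 3) δ (‖f x‖ ^ 2) * ‖f x‖ ^ 2)

lemma gradSq_nonneg (D : Fin m → Space m → Space m) (x : Space m) : 0 ≤ gradSq D x :=
  Finset.sum_nonneg fun _ _ => sq_nonneg _

lemma cutGradSq_nonneg (η : Space m → ℝ) (x : Space m) : 0 ≤ cutGradSq η x :=
  Finset.sum_nonneg fun _ _ => sq_nonneg _

lemma continuous_cutGradSq {η : Space m → ℝ} (hη : ContDiff ℝ 1 η) : Continuous (cutGradSq η) :=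
  continuous_finsetSum _ fun _ _ => (ContDiff.continuous_fderiv_const hη _).pow 2

lemma hasCompactSupport_cutGradSq {η : Space m → ℝ} (hc : HasCompactSupport η) :
    HasCompactSupport (cutGradSq η) := by
  refine (hc.fderiv (𝕜 := ℝ)).mono fun x hx (h : fderiv ℝ η x = 0) => hx ?_
  simp [cutGradSq, h]

/-- Mollified gradients. -/
def mollGrad (n : ℕ) (D : Fin m → Space m → Space m) (i : Fin m) : Space m → Space m :=
  moll n (D i)

variable {a δ p Λ : ℝ} {v f : Space m → Space m} {Dv Df : Fin m → Space m → Space m}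
  {χ : Space m → ℝ}

lemma norm_radField_le (ha : 0 ≤ a) (hδ : 0 < δ) (w : Space m) :
    ‖radField a (a + 1 / 3) δ w‖ ≤ δ ^ (-(a + 1 / 3)) * ‖w‖ ^ (1 / 3 : ℝ) := by
  rw [norm_radField hδ.le]
  exact wt_mul_le_third hδ (norm_nonneg w) ha

lemma tendsto_radDeriv {κ : ℝ} (ha : 0 ≤ a) (hδ : 0 ≤ δ) {w ξ : ℕ → Space m} {w₀ ξ₀ : Space m}
    (hw : Tendsto w atTop (𝓝 w₀)) (hξ : Tendsto ξ atTop (𝓝 ξ₀)) :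
    Tendsto (fun n => radDeriv a κ δ (w n) (ξ n)) atTop (𝓝 (radDeriv a κ δ w₀ ξ₀)) := by
  have h1 : Tendsto (fun n => radDeriv a κ δ (w n)) atTop (𝓝 (radDeriv a κ δ w₀)) :=
    ((continuous_radDeriv ha hδ).tendsto w₀).comp hw
  have h2 : Continuous fun z : (Space m →L[ℝ] Space m) × Space m => z.1 z.2 :=
    isBoundedBilinearMap_apply.continuous
  exact (h2.tendsto (radDeriv a κ δ w₀, ξ₀)).comp (h1.prodMk_nhds hξ)

lemma rpow_third_pow_six {r : ℝ} (hr : 0 ≤ r) : (r ^ (1 / 3 : ℝ)) ^ 6 = r ^ 2 := by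
  rw [← Real.rpow_natCast, ← Real.rpow_mul hr]
  norm_num

namespace Slice

lemma moll_maj_nonneg (hΛ : 0 < Λ) (n : ℕ) (x : Space m) :
    0 ≤ moll n (majorant p Λ v f Dv Df) x := moll_nonneg n (majorant_nonneg hΛ) x

/-- Young's inequality with the middle factor equal to `1`: the field contributes `r^(1/3)`, whose
sixth power is `r²`, and the gradient appears squared. -/
lemma cross_bound (h : Slice p v f Dv Df) (ha : 0 ≤ a) (hδ : 0 < δ) (hΛ : 0 < Λ) (n : ℕ)
    (x : Space m) :
    ‖∑ i, fderiv ℝ χ x (basisVec i) * inner ℝ (radField a (a + 1 / 3) δ (moll n f x))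
      (mollGrad n Df i x)‖ ≤
      |Λ * (3 * δ ^ (-(a + 1 / 3)) * ∑ i, |fderiv ℝ χ x (basisVec i)|)| *
        (1 + majorant p Λ v f Dv Df x + moll n (majorant p Λ v f Dv Df) x) := by
  have hM := majorant_nonneg (p := p) (v := v) (f := f) (Dv := Dv) (Df := Df) hΛ x
  have hM' := moll_maj_nonneg (p := p) (v := v) (f := f) (Dv := Dv) (Df := Df) hΛ n x
  have hδ' : 0 ≤ δ ^ (-(a + 1 / 3)) := by positivity
  rw [abs_of_nonneg (by positivity)]
  refine (norm_sum_le _ _).trans ?_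
  rw [Finset.mul_sum, Finset.mul_sum, Finset.sum_mul]
  refine Finset.sum_le_sum fun i _ => ?_
  rw [norm_mul, Real.norm_eq_abs]
  set r := ‖moll n f x‖
  have h1 : ‖inner ℝ (radField a (a + 1 / 3) δ (moll n f x)) (mollGrad n Df i x)‖ ≤
      δ ^ (-(a + 1 / 3)) * r ^ (1 / 3 : ℝ) * ‖mollGrad n Df i x‖ :=
    (norm_inner_le_norm _ _).trans (mul_le_mul_of_nonneg_right (norm_radField_le ha hδ _)
      (norm_nonneg _))
  have h2 := young_six_three_two (a := r ^ (1 / 3 : ℝ)) (b := 1) (c := ‖mollGrad n Df i x‖ / Λ)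
    zero_le_one
  rw [rpow_third_pow_six (norm_nonneg _)] at h2
  have h3 := h.moll_sq_le hΛ n x
  have h4 := h.moll_grad_sq_le hΛ n i x
  have h5 : r ^ (1 / 3 : ℝ) * ‖mollGrad n Df i x‖ ≤
      Λ * (3 * (1 + majorant p Λ v f Dv Df x + moll n (majorant p Λ v f Dv Df) x)) := by
    calc r ^ (1 / 3 : ℝ) * ‖mollGrad n Df i x‖
        = Λ * (r ^ (1 / 3 : ℝ) * 1 * (‖mollGrad n Df i x‖ / Λ)) := by field_simp
      _ ≤ _ := by
        refine mul_le_mul_of_nonneg_left (h2.trans ?_) hΛ.le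
        unfold mollGrad
        linarith
  calc |fderiv ℝ χ x (basisVec i)| *
        ‖inner ℝ (radField a (a + 1 / 3) δ (moll n f x)) (mollGrad n Df i x)‖
      ≤ |fderiv ℝ χ x (basisVec i)| * (δ ^ (-(a + 1 / 3)) * r ^ (1 / 3 : ℝ) *
          ‖mollGrad n Df i x‖) := by gcongr
    _ = |fderiv ℝ χ x (basisVec i)| * δ ^ (-(a + 1 / 3)) * (r ^ (1 / 3 : ℝ) *
          ‖mollGrad n Df i x‖) := by ring
    _ ≤ |fderiv ℝ χ x (basisVec i)| * δ ^ (-(a + 1 / 3)) *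
        (Λ * (3 * (1 + majorant p Λ v f Dv Df x + moll n (majorant p Λ v f Dv Df) x))) := by gcongr
    _ = _ := by ring

/-- At a fixed point `b` is a constant, so it can be moved inside the convolution, and Young's
inequality is applied under the integral sign. This replaces a commutator estimate: the mollified
nonlinear term is controlled without comparing it to the nonlinear term of mollified fields. -/
lemma mul_norm_moll_nonlin_le (h : Slice p v f Dv Df) (hΛ : 0 < Λ) {b : ℝ} (hb : 0 ≤ b) (n : ℕ)
    (x : Space m) : b * ‖moll n (nonlin v f Dv Df) x‖ ≤
      2 * m * Λ * (b ^ 6 + 2 + 2 * moll n (majorant p Λ v f Dv Df) x) := by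
  have hl := h.loc_majorant hΛ
  calc b * ‖moll n (nonlin v f Dv Df) x‖ ≤ b * moll n (fun y => ‖nonlin v f Dv Df y‖) x := by
        gcongr; exact norm_moll_le _ _ _
    _ = moll n (fun y => b * ‖nonlin v f Dv Df y‖) x := (moll_const_mul _ _ _ _).symm
    _ ≤ moll n (fun y => 2 * m * Λ * ((b ^ 6 + 2) + 2 * majorant p Λ v f Dv Df y)) x := by
        refine moll_mono n ((LocallyIntegrable.norm_comp h.loc_nonlin).smul b)
          (((locallyIntegrable_const _).add (hl.smul (2 : ℝ))).smul (2 * m * Λ)) ?_ x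
        exact Eventually.of_forall fun y => h.mul_norm_nonlin_le hΛ hb y
    _ = _ := by
        rw [moll_const_mul, moll_add n (g := fun y => 2 * majorant p Λ v f Dv Df y)
            (locallyIntegrable_const _) (hl.smul (2 : ℝ)), moll_const,
          moll_const_mul]

lemma trans_bound (h : Slice p v f Dv Df) (ha : 0 ≤ a) (hδ : 0 < δ) (hΛ : 0 < Λ) (n : ℕ)
    (x : Space m) :
    ‖χ x * inner ℝ (radField a (a + 1 / 3) δ (moll n f x)) (moll n (nonlin v f Dv Df) x)‖ ≤
      |Λ * (6 * m * δ ^ (-(a + 1 / 3)) * χ x)| *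
        (1 + majorant p Λ v f Dv Df x + moll n (majorant p Λ v f Dv Df) x) := by
  have hM := majorant_nonneg (p := p) (v := v) (f := f) (Dv := Dv) (Df := Df) hΛ x
  have hM' := moll_maj_nonneg (p := p) (v := v) (f := f) (Dv := Dv) (Df := Df) hΛ n x
  have hδ' : 0 ≤ δ ^ (-(a + 1 / 3)) := by positivity
  rw [norm_mul, Real.norm_eq_abs, abs_mul, abs_mul, abs_of_pos hΛ,
    abs_of_nonneg (by positivity : 0 ≤ 6 * m * δ ^ (-(a + 1 / 3)))]
  set r := ‖moll n f x‖
  have h1 : ‖inner ℝ (radField a (a + 1 / 3) δ (moll n f x)) (moll n (nonlin v f Dv Df) x)‖ ≤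
      δ ^ (-(a + 1 / 3)) * r ^ (1 / 3 : ℝ) * ‖moll n (nonlin v f Dv Df) x‖ :=
    (norm_inner_le_norm _ _).trans (mul_le_mul_of_nonneg_right (norm_radField_le ha hδ _)
      (norm_nonneg _))
  have h2 := h.mul_norm_moll_nonlin_le hΛ (b := r ^ (1 / 3 : ℝ)) (by positivity) n x
  rw [rpow_third_pow_six (norm_nonneg _)] at h2
  have h3 := h.moll_sq_le hΛ n x
  have h4 : r ^ (1 / 3 : ℝ) * ‖moll n (nonlin v f Dv Df) x‖ ≤ 6 * m * Λ *
      (1 + majorant p Λ v f Dv Df x + moll n (majorant p Λ v f Dv Df) x) := by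
    refine h2.trans ?_
    have : r ^ 2 + 2 + 2 * moll n (majorant p Λ v f Dv Df) x ≤
      3 * (1 + majorant p Λ v f Dv Df x + moll n (majorant p Λ v f Dv Df) x) := by linarith
    calc 2 * m * Λ * (r ^ 2 + 2 + 2 * moll n (majorant p Λ v f Dv Df) x)
        ≤ 2 * m * Λ * (3 * (1 + majorant p Λ v f Dv Df x + moll n (majorant p Λ v f Dv Df) x)) := by
          gcongr
      _ = _ := by ring
  calc |χ x| * ‖inner ℝ (radField a (a + 1 / 3) δ (moll n f x)) (moll n (nonlin v f Dv Df) x)‖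
      ≤ |χ x| * (δ ^ (-(a + 1 / 3)) * r ^ (1 / 3 : ℝ) * ‖moll n (nonlin v f Dv Df) x‖) := by gcongr
    _ = |χ x| * δ ^ (-(a + 1 / 3)) * (r ^ (1 / 3 : ℝ) * ‖moll n (nonlin v f Dv Df) x‖) := by ring
    _ ≤ |χ x| * δ ^ (-(a + 1 / 3)) * (6 * m * Λ *
      (1 + majorant p Λ v f Dv Df x + moll n (majorant p Λ v f Dv Df) x)) := by gcongr
    _ = _ := by ring

lemma continuous_moll_f (h : Slice p v f Dv Df) (n : ℕ) : Continuous (moll n f) :=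
  moll_continuous n h.loc_f

lemma continuous_mollGrad (h : Slice p v f Dv Df) (n : ℕ) (i : Fin m) :
    Continuous (mollGrad n Df i) := moll_continuous n (h.loc_Df i)

lemma ae_tendsto (h : Slice p v f Dv Df) : ∀ᵐ x, Tendsto (fun n => moll n f x) atTop (𝓝 (f x)) ∧
    (∀ i, Tendsto (fun n => mollGrad n Df i x) atTop (𝓝 (Df i x))) ∧
    Tendsto (fun n => moll n (nonlin v f Dv Df) x) atTop (𝓝 (nonlin v f Dv Df x)) := by
  filter_upwards [tendsto_moll_ae h.loc_f, ae_all_iff.2 fun i => tendsto_moll_ae (h.loc_Df i),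
    tendsto_moll_ae h.loc_nonlin] with x h1 h2 h3
  exact ⟨h1, h2, h3⟩

lemma continuous_sum_abs_fderiv (hχ : ContDiff ℝ 1 χ) :
    Continuous fun x => ∑ i, |fderiv ℝ χ x (basisVec i)| :=
  continuous_finsetSum _ fun _ _ => (ContDiff.continuous_fderiv_const hχ _).abs

lemma hasCompactSupport_sum_abs_fderiv (hc : HasCompactSupport χ) :
    HasCompactSupport fun x => ∑ i, |fderiv ℝ χ x (basisVec i)| := by
  refine (hc.fderiv (𝕜 := ℝ)).mono fun x hx (h : fderiv ℝ χ x = 0) => hx ?_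
  simp [h]

lemma tendsto_crossForm (h : Slice p v f Dv Df) (ha : 0 ≤ a) (hδ : 0 < δ)
    (hχ : ContDiff ℝ 1 χ) (hc : HasCompactSupport χ) :
    Tendsto (fun n => crossForm a δ χ (moll n f) (mollGrad n Df)) atTop
      (𝓝 (crossForm a δ χ f Df)) := by
  refine (tendsto_integral_of_le_weight
    (c := fun x => 1 * (3 * δ ^ (-(a + 1 / 3)) * ∑ i, |fderiv ℝ χ x (basisVec i)|))
    (continuous_const.mul (continuous_const.mul (continuous_sum_abs_fderiv hχ)))
    ((hasCompactSupport_sum_abs_fderiv hc).mul_left.mul_left) (fun n => ?_)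
    (h.integrable_majorant one_pos) (majorant_nonneg one_pos)
    (fun n x => h.cross_bound ha hδ one_pos n x) ?_).2
  · refine Continuous.aestronglyMeasurable (continuous_finsetSum _ fun i _ =>
      (ContDiff.continuous_fderiv_const hχ _).mul (Continuous.inner
        ((continuous_radField ha hδ.le).comp (h.continuous_moll_f n)) (h.continuous_mollGrad n i)))
  · filter_upwards [h.ae_tendsto] with x hx
    exact tendsto_finsetSum _ fun i _ => (Tendsto.inner
      (((continuous_radField ha hδ.le).tendsto _).comp hx.1) (hx.2.1 i)).const_mul _

lemma tendsto_transForm (h : Slice p v f Dv Df) (ha : 0 ≤ a) (hδ : 0 < δ)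
    (hχ : Continuous χ) (hc : HasCompactSupport χ) :
    Tendsto (fun n => transForm a δ χ (moll n f) (moll n (nonlin v f Dv Df))) atTop
      (𝓝 (transForm a δ χ f (nonlin v f Dv Df))) := by
  refine (tendsto_integral_of_le_weight
    (c := fun x => 1 * (6 * m * δ ^ (-(a + 1 / 3)) * χ x))
    (continuous_const.mul (continuous_const.mul hχ)) (hc.mul_left.mul_left) (fun n => ?_)
    (h.integrable_majorant one_pos) (majorant_nonneg one_pos)
    (fun n x => h.trans_bound ha hδ one_pos n x) ?_).2
  · exact Continuous.aestronglyMeasurable (hχ.mul (Continuous.inner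
      ((continuous_radField ha hδ.le).comp (h.continuous_moll_f n))
      (moll_continuous n h.loc_nonlin)))
  · filter_upwards [h.ae_tendsto] with x hx
    exact (Tendsto.inner (((continuous_radField ha hδ.le).tendsto _).comp hx.1) hx.2.2).const_mul _

/-- Bounds for the lower order terms that are uniform in the mollification. -/
lemma exists_abs_forms_le (ha : 0 ≤ a) (hδ : 0 < δ) (hχ : ContDiff ℝ 1 χ)
    (hc : HasCompactSupport χ) :
    ∃ A : ℝ, 0 ≤ A ∧ ∀ (p Λ : ℝ) (v f : Space m → Space m) (Dv Df : Fin m → Space m → Space m),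
      Slice p v f Dv Df → 0 < Λ → ∀ n,
      |crossForm a δ χ (moll n f) (mollGrad n Df)| ≤
        A * Λ * (1 + ∫ x, majorant p Λ v f Dv Df x) ∧
      |transForm a δ χ (moll n f) (moll n (nonlin v f Dv Df))| ≤
        A * Λ * (1 + ∫ x, majorant p Λ v f Dv Df x) := by
  -- The constant depends on the weight `c` alone and is chosen before the fields, so one constant
  -- serves all times.
  have aux : ∀ c : Space m → ℝ, Continuous c → HasCompactSupport c → ∃ A : ℝ, 0 ≤ A ∧
      ∀ (p Λ : ℝ) (v f : Space m → Space m) (Dv Df : Fin m → Space m → Space m),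
      Slice p v f Dv Df → 0 < Λ → ∀ (n : ℕ) (F : Space m → ℝ), (∀ x, ‖F x‖ ≤ |Λ * c x| *
        (1 + majorant p Λ v f Dv Df x + moll n (majorant p Λ v f Dv Df) x)) →
      |∫ x, F x| ≤ A * Λ * (1 + ∫ x, majorant p Λ v f Dv Df x) := by
    intro c hc hcs
    obtain ⟨C, hC⟩ := hcs.exists_bound_of_continuous hc
    have hC0 : 0 ≤ C := (norm_nonneg _).trans (hC 0)
    have hI : 0 ≤ ∫ x, |c x| := integral_nonneg fun x => abs_nonneg _
    refine ⟨(∫ x, |c x|) + 2 * C, by positivity, fun p Λ v f Dv Df h hΛ n F hF => ?_⟩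
    have h1 := norm_integral_le_of_le_weight (c := fun x => Λ * c x) (C := Λ * C)
      (continuous_const.mul hc) hcs.mul_left (fun x => by
        rw [abs_mul, abs_of_pos hΛ]; exact mul_le_mul_of_nonneg_left (hC x) hΛ.le) n
      (h.integrable_majorant hΛ) (majorant_nonneg hΛ) hF
    have h2 : ∫ x, |Λ * c x| = Λ * ∫ x, |c x| := by
      rw [← integral_const_mul]; congr 1; ext x; rw [abs_mul, abs_of_pos hΛ]
    rw [h2] at h1
    have h3 : 0 ≤ ∫ x, majorant p Λ v f Dv Df x := integral_nonneg fun x => majorant_nonneg hΛ x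
    refine h1.trans ?_
    have h4 : 0 ≤ Λ * C := by positivity
    have h5 : 0 ≤ Λ * (∫ x, |c x|) * ∫ x, majorant p Λ v f Dv Df x := by positivity
    nlinarith
  obtain ⟨A, hA, h1⟩ := aux (fun x => 3 * δ ^ (-(a + 1 / 3)) * ∑ i, |fderiv ℝ χ x (basisVec i)|)
    (continuous_const.mul (continuous_sum_abs_fderiv hχ))
    (hasCompactSupport_sum_abs_fderiv hc).mul_left
  obtain ⟨B, hB, h2⟩ := aux (fun x => 6 * m * δ ^ (-(a + 1 / 3)) * χ x)
    (continuous_const.mul hχ.continuous) hc.mul_left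
  refine ⟨A + B, by positivity, fun p Λ v f Dv Df h hΛ n => ?_⟩
  have h3 : 0 ≤ ∫ x, majorant p Λ v f Dv Df x := integral_nonneg fun x => majorant_nonneg hΛ x
  have e1 := h1 p Λ v f Dv Df h hΛ n _ fun x => h.cross_bound (χ := χ) ha hδ hΛ n x
  have e2 := h2 p Λ v f Dv Df h hΛ n _ fun x => h.trans_bound (χ := χ) ha hδ hΛ n x
  have h4 : 0 ≤ A * Λ * (1 + ∫ x, majorant p Λ v f Dv Df x) := by positivity
  have h5 : 0 ≤ B * Λ * (1 + ∫ x, majorant p Λ v f Dv Df x) := by positivity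
  have h6 : (A + B) * Λ * (1 + ∫ x, majorant p Λ v f Dv Df x) =
    A * Λ * (1 + ∫ x, majorant p Λ v f Dv Df x) + B * Λ * (1 + ∫ x, majorant p Λ v f Dv Df x) := by
    ring
  rw [h6]
  exact ⟨e1.trans (by linarith), e2.trans (by linarith)⟩

lemma gradSq_moll_le (h : Slice p v f Dv Df) (n : ℕ) (x : Space m) :
    gradSq (mollGrad n Df) x ≤
      m * (1 + majorant p 1 v f Dv Df x + moll n (majorant p 1 v f Dv Df) x) := by
  have h1 : ∀ i : Fin m, ‖mollGrad n Df i x‖ ^ 2 ≤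
      1 + majorant p 1 v f Dv Df x + moll n (majorant p 1 v f Dv Df) x := by
    intro i
    have := h.moll_grad_sq_le one_pos n i x
    have hM := majorant_nonneg (p := p) (v := v) (f := f) (Dv := Dv) (Df := Df) one_pos x
    rw [div_one] at this
    unfold mollGrad
    linarith
  refine (Finset.sum_le_sum fun i _ => h1 i).trans (le_of_eq ?_)
  simp; ring

/-- For fixed `δ` the weight is bounded, so at a fixed time the square of the gradient dominates.
That bound is quadratic in a gradient which is only integrable in time, hence it does not permit
passing to the limit under the time integral. -/
lemma tendsto_dissipForm (h : Slice p v f Dv Df) (ha : 0 ≤ a) (hδ : 0 < δ)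
    (hχ : Continuous χ) (hc : HasCompactSupport χ) :
    Tendsto (fun n => dissipForm a δ χ (moll n f) (mollGrad n Df)) atTop
      (𝓝 (dissipForm a δ χ f Df)) := by
  set C := (1 + 2 * (a + (a + 1 / 3))) * δ ^ (-a) with hC
  have hC0 : 0 ≤ C := by positivity
  refine (tendsto_integral_of_le_weight
    (c := fun x => C * m * χ x) (continuous_const.mul hχ) hc.mul_left (fun n => ?_)
    (h.integrable_majorant one_pos) (majorant_nonneg one_pos) (fun n x => ?_) ?_).2
  · refine Continuous.aestronglyMeasurable (hχ.mul (continuous_finsetSum _ fun i _ =>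
      Continuous.inner (Continuous.clm_apply ((continuous_radDeriv ha hδ.le).comp
        (h.continuous_moll_f n)) (h.continuous_mollGrad n i)) (h.continuous_mollGrad n i)))
  · have h1 : ‖∑ i, inner ℝ (radDeriv a (a + 1 / 3) δ (moll n f x) (mollGrad n Df i x))
        (mollGrad n Df i x)‖ ≤ C * gradSq (mollGrad n Df) x := by
      rw [gradSq, Finset.mul_sum]
      refine (norm_sum_le _ _).trans (Finset.sum_le_sum fun i _ => ?_)
      refine (norm_inner_le_norm _ _).trans ?_
      have h2 := norm_radDeriv_apply_le ha (by linarith : 0 ≤ a + 1 / 3) hδ.le (moll n f x)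
        (mollGrad n Df i x)
      have h3 := wt_le_const (κ := a + 1 / 3) ha (by linarith) hδ (sq_nonneg ‖moll n f x‖)
      calc _ ≤ (1 + 2 * (a + (a + 1 / 3))) * wt a (a + 1 / 3) δ (‖moll n f x‖ ^ 2) *
            ‖mollGrad n Df i x‖ * ‖mollGrad n Df i x‖ := by gcongr
        _ ≤ (1 + 2 * (a + (a + 1 / 3))) * δ ^ (-a) *
            ‖mollGrad n Df i x‖ * ‖mollGrad n Df i x‖ := by gcongr
        _ = _ := by rw [hC]; ring
    have h2 := h.gradSq_moll_le n x
    rw [norm_mul, abs_mul, abs_of_nonneg (by positivity : 0 ≤ C * m), Real.norm_eq_abs]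
    calc _ ≤ |χ x| * (C * (m * (1 + majorant p 1 v f Dv Df x +
          moll n (majorant p 1 v f Dv Df) x))) := by
          gcongr; exact h1.trans (mul_le_mul_of_nonneg_left h2 hC0)
      _ = _ := by ring
  · filter_upwards [h.ae_tendsto] with x hx
    exact (tendsto_finsetSum _ fun i _ =>
      (tendsto_radDeriv ha hδ.le hx.1 (hx.2.1 i)).inner (hx.2.1 i)).const_mul _

lemma tendsto_wDissip (h : Slice p v f Dv Df) (ha : 0 ≤ a) (hδ : 0 < δ) {η : Space m → ℝ}
    (hη : Continuous η) (hc : HasCompactSupport η) :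
    Integrable (fun x => η x ^ 2 * (wt a (a + 1 / 3) δ (‖f x‖ ^ 2) * gradSq Df x)) volume ∧
    Tendsto (fun n => wDissip a δ η (moll n f) (mollGrad n Df)) atTop
      (𝓝 (wDissip a δ η f Df)) := by
  have hc2 : HasCompactSupport fun x => δ ^ (-a) * m * η x ^ 2 :=
    hc.comp_left (g := fun y => δ ^ (-a) * m * y ^ 2) (by simp)
  refine tendsto_integral_of_le_weight
    (c := fun x => δ ^ (-a) * m * η x ^ 2) (continuous_const.mul (hη.pow 2)) hc2 (fun n => ?_)
    (h.integrable_majorant one_pos) (majorant_nonneg one_pos) (fun n x => ?_) ?_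
  · exact Continuous.aestronglyMeasurable ((hη.pow 2).mul (((continuous_wt_norm_sq ha hδ.le).comp
      (h.continuous_moll_f n)).mul (continuous_finsetSum _ fun i _ =>
        (h.continuous_mollGrad n i).norm.pow 2)))
  · have h3 := wt_le_const (κ := a + 1 / 3) ha (by linarith) hδ (sq_nonneg ‖moll n f x‖)
    have h4 := wt_nonneg (a := a) (κ := a + 1 / 3) hδ.le (sq_nonneg ‖moll n f x‖)
    have h2 := h.gradSq_moll_le n x
    have h5 := gradSq_nonneg (mollGrad n Df) x
    have h6 : 0 ≤ η x ^ 2 * (wt a (a + 1 / 3) δ (‖moll n f x‖ ^ 2) * gradSq (mollGrad n Df) x) := by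
      positivity
    have h7 : 0 ≤ δ ^ (-a) * m * η x ^ 2 := by positivity
    rw [Real.norm_eq_abs, abs_of_nonneg h6, abs_of_nonneg h7]
    calc η x ^ 2 * (wt a (a + 1 / 3) δ (‖moll n f x‖ ^ 2) * gradSq (mollGrad n Df) x)
        ≤ η x ^ 2 * (δ ^ (-a) * (m * (1 + majorant p 1 v f Dv Df x +
          moll n (majorant p 1 v f Dv Df) x))) := by gcongr
      _ = _ := by ring
  · filter_upwards [h.ae_tendsto] with x hx
    refine Tendsto.const_mul _ (Tendsto.mul ?_ ?_)
    · exact ((continuous_wt_norm_sq ha hδ.le).tendsto _).comp hx.1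
    · exact tendsto_finsetSum _ fun i _ => (hx.2.1 i).norm.pow 2

lemma tendsto_weighted_mass (h : Slice p v f Dv Df) (ha : 0 ≤ a) (hδ : 0 < δ) {c : Space m → ℝ}
    (hcc : Continuous c) (hc : HasCompactSupport c) :
    Integrable (fun x => c x * (wt a (a + 1 / 3) δ (‖f x‖ ^ 2) * ‖f x‖ ^ 2)) volume ∧
    Tendsto (fun n => ∫ x, c x * (wt a (a + 1 / 3) δ (‖moll n f x‖ ^ 2) * ‖moll n f x‖ ^ 2)) atTop
      (𝓝 (∫ x, c x * (wt a (a + 1 / 3) δ (‖f x‖ ^ 2) * ‖f x‖ ^ 2))) := by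
  refine tendsto_integral_of_le_weight
    (c := fun x => δ ^ (-a) * c x) (continuous_const.mul hcc) hc.mul_left (fun n => ?_)
    (h.integrable_majorant one_pos) (majorant_nonneg one_pos) (fun n x => ?_) ?_
  · exact Continuous.aestronglyMeasurable (hcc.mul (((continuous_wt_norm_sq ha hδ.le).comp
      (h.continuous_moll_f n)).mul ((h.continuous_moll_f n).norm.pow 2)))
  · have h3 := wt_le_const (κ := a + 1 / 3) ha (by linarith) hδ (sq_nonneg ‖moll n f x‖)
    have h4 := wt_nonneg (a := a) (κ := a + 1 / 3) hδ.le (sq_nonneg ‖moll n f x‖)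
    have h2 := h.moll_sq_le one_pos n x
    have hM := majorant_nonneg (p := p) (v := v) (f := f) (Dv := Dv) (Df := Df) one_pos x
    have h5 : 0 ≤ wt a (a + 1 / 3) δ (‖moll n f x‖ ^ 2) * ‖moll n f x‖ ^ 2 := by positivity
    rw [norm_mul, Real.norm_eq_abs, Real.norm_eq_abs, abs_of_nonneg h5, abs_mul,
      abs_of_nonneg (by positivity : 0 ≤ δ ^ (-a))]
    calc |c x| * (wt a (a + 1 / 3) δ (‖moll n f x‖ ^ 2) * ‖moll n f x‖ ^ 2)
        ≤ |c x| * (δ ^ (-a) * (1 + majorant p 1 v f Dv Df x +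
          moll n (majorant p 1 v f Dv Df) x)) := by gcongr; linarith
      _ = _ := by ring
  · filter_upwards [h.ae_tendsto] with x hx
    refine Tendsto.const_mul _ (Tendsto.mul ?_ (hx.1.norm.pow 2))
    exact ((continuous_wt_norm_sq ha hδ.le).tendsto _).comp hx.1

/-- Convergence of the transport term when only the vorticity is mollified. -/
lemma tendsto_transForm_nonlin (h : Slice p v f Dv Df) (ha : 0 ≤ a) (hδ : 0 < δ)
    (hχ : Continuous χ) (hc : HasCompactSupport χ) :
    Tendsto (fun n => transForm a δ χ (moll n f) (nonlin v (moll n f) Dv (mollGrad n Df))) atTop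
      (𝓝 (transForm a δ χ f (nonlin v f Dv Df))) := by
  refine (tendsto_integral_of_le_weight
    (c := fun x => 6 * m * δ ^ (-(a + 1 / 3)) * χ x)
    (continuous_const.mul hχ) (hc.mul_left) (fun n => ?_)
    (h.integrable_majorant one_pos) (majorant_nonneg one_pos)
    (fun n x => ?_) ?_).2
  · refine hχ.aestronglyMeasurable.mul (AEStronglyMeasurable.inner
      ((continuous_radField ha hδ.le).comp (h.continuous_moll_f n)).aestronglyMeasurable ?_)
    exact (aestronglyMeasurable_advect h.memLp_v.1
      fun i => (h.continuous_mollGrad n i).aestronglyMeasurable).sub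
      (aestronglyMeasurable_advect (h.continuous_moll_f n).aestronglyMeasurable
        fun i => (h.memLp_Dv i).1)
  · have hM := majorant_nonneg (p := p) (v := v) (f := f) (Dv := Dv) (Df := Df) one_pos x
    have hM' := moll_maj_nonneg (p := p) (v := v) (f := f) (Dv := Dv) (Df := Df) one_pos n x
    set M := 1 + majorant p 1 v f Dv Df x + moll n (majorant p 1 v f Dv Df) x with hMdef
    set r := ‖moll n f x‖ with hr
    set b := r ^ (1 / 3 : ℝ) with hb
    have hb0 : 0 ≤ b := by positivity
    -- The mollified field enters twice, as the weight `r^(1/3)` and as the stretching factor `r`.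
    -- The latter appears to the third power, which the `L^m` part of the majorant covers since `m ≥
    -- 3`.
    have e1 : b * ‖nonlin v (moll n f) Dv (mollGrad n Df) x‖ ≤ 6 * m * M := by
      have h1 : ‖nonlin v (moll n f) Dv (mollGrad n Df) x‖ ≤
          ∑ i, (‖v x‖ * ‖mollGrad n Df i x‖ + r * ‖Dv i x‖) := by
        rw [Finset.sum_add_distrib]
        exact (norm_sub_le _ _).trans (add_le_add (norm_advect_le _ _ _) (norm_advect_le _ _ _))
      have h2 : ∀ i : Fin m, b * (‖v x‖ * ‖mollGrad n Df i x‖ + r * ‖Dv i x‖) ≤ 6 * M := by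
        intro i
        have y1 := young_six_three_two (a := b) (c := ‖mollGrad n Df i x‖) (norm_nonneg (v x))
        have y2 := young_six_three_two (a := b) (c := ‖Dv i x‖) (norm_nonneg (moll n f x))
        rw [hb, rpow_third_pow_six (norm_nonneg _), ← hb] at y1 y2
        have z1 := h.moll_sq_le one_pos n x
        have z2 := h.moll_cube_le one_pos n x
        have z3 := h.cube_v_le one_pos x
        have z4 := h.moll_grad_sq_le one_pos n i x
        have z5 := (h.grad_sq_le one_pos i x).2
        rw [div_one] at z4 z5
        unfold mollGrad at *
        rw [mul_add, ← mul_assoc, ← mul_assoc]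
        linarith
      calc b * ‖nonlin v (moll n f) Dv (mollGrad n Df) x‖
          ≤ b * ∑ i, (‖v x‖ * ‖mollGrad n Df i x‖ + r * ‖Dv i x‖) := by gcongr
        _ = ∑ i, b * (‖v x‖ * ‖mollGrad n Df i x‖ + r * ‖Dv i x‖) := Finset.mul_sum _ _ _
        _ ≤ ∑ _i : Fin m, 6 * M := Finset.sum_le_sum fun i _ => h2 i
        _ = _ := by simp; ring
    rw [norm_mul, Real.norm_eq_abs, abs_mul,
      abs_of_nonneg (by positivity : 0 ≤ 6 * m * δ ^ (-(a + 1 / 3)))]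
    have h1 : ‖inner ℝ (radField a (a + 1 / 3) δ (moll n f x))
        (nonlin v (moll n f) Dv (mollGrad n Df) x)‖ ≤
        δ ^ (-(a + 1 / 3)) * b * ‖nonlin v (moll n f) Dv (mollGrad n Df) x‖ :=
      (norm_inner_le_norm _ _).trans (mul_le_mul_of_nonneg_right (norm_radField_le ha hδ _)
        (norm_nonneg _))
    calc _ ≤ |χ x| * (δ ^ (-(a + 1 / 3)) * b * ‖nonlin v (moll n f) Dv (mollGrad n Df) x‖) := by gcongr
      _ = |χ x| * δ ^ (-(a + 1 / 3)) * (b * ‖nonlin v (moll n f) Dv (mollGrad n Df) x‖) := by ring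
      _ ≤ |χ x| * δ ^ (-(a + 1 / 3)) * (6 * m * M) := by gcongr
      _ = _ := by ring
  · filter_upwards [h.ae_tendsto] with x hx
    refine (Tendsto.inner (((continuous_radField ha hδ.le).tendsto _).comp hx.1) ?_).const_mul _
    refine Tendsto.sub (tendsto_finsetSum _ fun i _ => (hx.2.1 i).const_smul _)
      (tendsto_finsetSum _ fun i _ => Tendsto.smul_const ?_ _)
    exact ((EuclideanSpace.proj i : Space m →L[ℝ] ℝ).continuous.tendsto _).comp hx.1

end Slice

end Functionals

/-! ### Integration by parts for smooth vorticity; Hölder–Sobolev -/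

section SmoothEstimates

variable {m : ℕ}

/-- The classical gradient of a smooth field. -/
def classGrad (f : Space m → Space m) (i : Fin m) (x : Space m) : Space m :=
  fderiv ℝ f x (basisVec i)

lemma fderiv_apply_eq_advect (f v : Space m → Space m) (x : Space m) :
    fderiv ℝ f x (v x) = advect v (classGrad f) x := clm_eq_sum _ _

lemma sum_sq_coord (w : Space m) : ∑ i, (w i) ^ 2 = ‖w‖ ^ 2 := by
  rw [EuclideanSpace.norm_sq_eq]; simp

lemma abs_fderiv_apply_le (η : Space m → ℝ) (x w : Space m) :
    |fderiv ℝ η x w| ≤ √(cutGradSq η x) * ‖w‖ := by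
  rw [clm_eq_sum]
  refine Real.abs_le_sqrt (Finset.sum_mul_sq_le_sq_mul_sq Finset.univ (fun i => w i)
    (fun i => fderiv ℝ η x (basisVec i))) |>.trans ?_
  rw [sum_sq_coord, mul_comm]
  change √(cutGradSq η x * ‖w‖ ^ 2) ≤ _
  rw [Real.sqrt_mul (cutGradSq_nonneg η x), Real.sqrt_sq (norm_nonneg w)]

lemma norm_fderiv_apply_le (f : Space m → Space m) (x w : Space m) :
    ‖fderiv ℝ f x w‖ ≤ √(gradSq (classGrad f) x) * ‖w‖ := by
  rw [clm_eq_sum]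
  have h1 : ‖∑ i, w i • fderiv ℝ f x (basisVec i)‖ ≤ ∑ i, |w i| * ‖classGrad f i x‖ :=
    (norm_sum_le _ _).trans (le_of_eq (by simp [norm_smul, classGrad]))
  refine h1.trans ((Real.le_sqrt (Finset.sum_nonneg fun i _ => by positivity)
    (by positivity)).2 (Finset.sum_mul_sq_le_sq_mul_sq Finset.univ (fun i => |w i|)
    (fun i => ‖classGrad f i x‖)) |>.trans ?_)
  simp only [sq_abs]
  rw [sum_sq_coord, mul_comm]
  change √(gradSq (classGrad f) x * ‖w‖ ^ 2) ≤ _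
  rw [ Real.sqrt_mul (gradSq_nonneg _ x), Real.sqrt_sq (norm_nonneg w)]

variable {a δ : ℝ} {f v : Space m → Space m} {Dv : Fin m → Space m → Space m} {χ : Space m → ℝ}

lemma hasFDerivAt_weighted_potential (ha : 0 ≤ a) (hδ : 0 ≤ δ) (hχ : ContDiff ℝ 1 χ)
    (hf : ContDiff ℝ 1 f) (x w : Space m) :
    fderiv ℝ (fun y => χ y * potential a (a + 1 / 3) δ (f y)) x w =
      fderiv ℝ χ x w * potential a (a + 1 / 3) δ (f x) +
      χ x * inner ℝ (radField a (a + 1 / 3) δ (f x)) (fderiv ℝ f x w) := by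
  have h1 := (hχ.differentiable (by norm_num) x).hasFDerivAt
  have h2 := (hasFDerivAt_potential (a := a) (κ := a + 1 / 3) ha hδ (f x)).comp x
    (hf.differentiable (by norm_num) x).hasFDerivAt
  have h3 := h1.mul h2
  change fderiv ℝ (χ * (potential a (a + 1 / 3) δ ∘ f)) x w = _
  rw [h3.fderiv]
  simp
  ring

lemma fderiv_weighted_radField {κ : ℝ} (ha : 0 ≤ a) (hδ : 0 ≤ δ) (hχ : ContDiff ℝ 1 χ)
    (hf : ContDiff ℝ 1 f) (x w : Space m) :
    fderiv ℝ (fun y => χ y • radField a κ δ (f y)) x w =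
      fderiv ℝ χ x w • radField a κ δ (f x) +
      χ x • radDeriv a κ δ (f x) (fderiv ℝ f x w) := by
  have h1 := (hχ.differentiable (by norm_num) x).hasFDerivAt
  have h2 := (hasFDerivAt_radField (a := a) (κ := κ) ha hδ (f x)).comp x
    (hf.differentiable (by norm_num) x).hasFDerivAt
  have h3 := h1.smul h2
  change fderiv ℝ (χ • (radField a κ δ ∘ f)) x w = _
  rw [h3.fderiv]
  simp [add_comm]

lemma integrable_inner_of_compact {φ : Space m → Space m} (hφ : Continuous φ)
    (hc : HasCompactSupport φ) {g : Space m → Space m} (hg : LocallyIntegrable g volume) :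
    Integrable (fun x => inner ℝ (φ x) (g x)) volume := by
  have e : ∀ x, inner ℝ (φ x) (g x) = ∑ k, φ x k • g x k := by
    intro x; rw [PiLp.inner_apply]; simp [mul_comm]
  simp only [e]
  refine integrable_finsetSum _ fun k _ => integrable_smul_of_compact (φ := fun x => φ x k)
    ((EuclideanSpace.proj k : Space m →L[ℝ] ℝ).continuous.comp hφ)
    (hc.comp_left (g := fun w : Space m => w k) (by simp)) (LocallyIntegrable.coord hg k)

lemma HasWeakPartial.integral_inner {i : Fin m} {g Dg : Space m → Space m}
    (h : HasWeakPartial i g Dg) {φ : Space m → Space m} (hφ : ContDiff ℝ 1 φ)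
    (hc : HasCompactSupport φ) :
    ∫ x, inner ℝ (fderiv ℝ φ x (basisVec i)) (g x) = -∫ x, inner ℝ (φ x) (Dg x) := by
  have e : ∀ (u w : Space m), inner ℝ u w = ∑ k, u k * w k := by
    intro u w; rw [PiLp.inner_apply]; simp [mul_comm]
  have hk : ∀ k : Fin m, ContDiff ℝ 1 fun x => φ x k := fun k =>
    (EuclideanSpace.proj k : Space m →L[ℝ] ℝ).contDiff.comp hφ
  have hck : ∀ k : Fin m, HasCompactSupport fun x => φ x k := fun k =>
    hc.comp_left (g := fun w : Space m => w k) (by simp)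
  have hd : ∀ (k : Fin m) x, (fderiv ℝ φ x (basisVec i)) k =
      fderiv ℝ (fun x => φ x k) x (basisVec i) := by
    intro k x
    have h3 := ((EuclideanSpace.proj k : Space m →L[ℝ] ℝ).hasFDerivAt.comp x
      (hφ.differentiable (by norm_num) x).hasFDerivAt).fderiv
    exact (congrArg (fun A : Space m →L[ℝ] ℝ => A (basisVec i)) h3).symm
  simp only [e, hd]
  rw [integral_finsetSum, integral_finsetSum, ← Finset.sum_neg_distrib]
  · exact Finset.sum_congr rfl fun k _ => h.integral_coord (hk k) (hck k) k
  · exact fun k _ => integrable_smul_of_compact (hk k).continuous (hck k)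
      (LocallyIntegrable.coord h.2.1 k)
  · exact fun k _ => integrable_smul_of_compact (ContDiff.continuous_fderiv_const (hk k) _)
      (HasCompactSupport.fderiv_apply_const (hck k) _) (LocallyIntegrable.coord h.1 k)

/-- The chain rule makes `β'(f) · (v·∇)f` the derivative of the potential along `v`. Testing `div v
= 0` against `χ β(f)` moves the derivative onto the cutoff. -/
lemma integral_transport (ha : 0 ≤ a) (hδ : 0 ≤ δ) (hχ : ContDiff ℝ 1 χ)
    (hc : HasCompactSupport χ) (hf : ContDiff ℝ 1 f) (hv : ∀ i, HasWeakPartial i v (Dv i))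
    (hl : LocallyIntegrable v volume) (hdiv : ∀ᵐ x, divergence Dv x = 0) :
    Integrable (fun x => χ x * inner ℝ (radField a (a + 1 / 3) δ (f x)) (advect v (classGrad f) x))
      volume ∧
    Integrable (fun x => fderiv ℝ χ x (v x) * potential a (a + 1 / 3) δ (f x)) volume ∧
    ∫ x, χ x * inner ℝ (radField a (a + 1 / 3) δ (f x)) (advect v (classGrad f) x) =
      -∫ x, fderiv ℝ χ x (v x) * potential a (a + 1 / 3) δ (f x) := by
  have hpc : Continuous fun x => potential a (a + 1 / 3) δ (f x) :=
    (contDiff_potential ha hδ).continuous.comp hf.continuous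
  have hφ : ContDiff ℝ 1 fun y => χ y * potential a (a + 1 / 3) δ (f y) :=
    hχ.mul ((contDiff_potential ha hδ).comp hf)
  have hφc : HasCompactSupport fun y => χ y * potential a (a + 1 / 3) δ (f y) := hc.mul_right
  have h0 := integral_fderiv_eq_zero hv hdiv hφ hφc
  have hi := integrable_fderiv_apply hl hφ hφc
  simp only [hasFDerivAt_weighted_potential ha hδ hχ hf, fderiv_apply_eq_advect f v] at h0 hi
  have hi2 : Integrable (fun x => fderiv ℝ χ x (v x) * potential a (a + 1 / 3) δ (f x)) volume := by
    have e : ∀ x, fderiv ℝ χ x (v x) * potential a (a + 1 / 3) δ (f x) =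
        ∑ i, (fderiv ℝ χ x (basisVec i) * potential a (a + 1 / 3) δ (f x)) • v x i := by
      intro x
      rw [clm_eq_sum, Finset.sum_mul]
      refine Finset.sum_congr rfl fun i _ => ?_
      simp only [smul_eq_mul]; ring
    simp only [e]
    exact integrable_finsetSum _ fun i _ => integrable_smul_of_compact
      ((ContDiff.continuous_fderiv_const hχ _).mul hpc)
      (HasCompactSupport.fderiv_apply_const hc _).mul_right (LocallyIntegrable.coord hl i)
  have hi1 : Integrable (fun x => χ x * inner ℝ (radField a (a + 1 / 3) δ (f x))
      (advect v (classGrad f) x)) volume := by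
    refine (hi.sub hi2).congr (Eventually.of_forall fun x => ?_)
    simp
  refine ⟨hi1, hi2, ?_⟩
  rw [integral_add hi2 hi1] at h0
  linarith

/-- The derivative `∂_j v` is tested against `χ f_j β'(f)` and the results are summed over `j`. No
derivative of `v` survives; the derivative falls on the cutoff and on the radial field, while its
action on `f_j` sums to the divergence of `f`. -/
lemma integral_stretch (ha : 0 ≤ a) (hδ : 0 ≤ δ) (hχ : ContDiff ℝ 1 χ)
    (hc : HasCompactSupport χ) (hf : ContDiff ℝ 1 f) (hv : ∀ i, HasWeakPartial i v (Dv i))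
    (hl : LocallyIntegrable v volume) (hdiv : ∀ x, divergence (classGrad f) x = 0) :
    Integrable (fun x => χ x * inner ℝ (radField a (a + 1 / 3) δ (f x)) (advect f Dv x)) volume ∧
    Integrable (fun x => fderiv ℝ χ x (f x) * inner ℝ (radField a (a + 1 / 3) δ (f x)) (v x) +
      χ x * inner ℝ (radDeriv a (a + 1 / 3) δ (f x) (fderiv ℝ f x (f x))) (v x)) volume ∧
    ∫ x, χ x * inner ℝ (radField a (a + 1 / 3) δ (f x)) (advect f Dv x) =
      -∫ x, (fderiv ℝ χ x (f x) * inner ℝ (radField a (a + 1 / 3) δ (f x)) (v x) +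
      χ x * inner ℝ (radDeriv a (a + 1 / 3) δ (f x) (fderiv ℝ f x (f x))) (v x)) := by
  set Φ : Fin m → Space m → Space m :=
    fun j y => (χ y * f y j) • radField a (a + 1 / 3) δ (f y) with hΦ
  have hfj : ∀ j, ContDiff ℝ 1 fun y => f y j := fun j =>
    (EuclideanSpace.proj j : Space m →L[ℝ] ℝ).contDiff.comp hf
  have hχj : ∀ j, ContDiff ℝ 1 fun y => χ y * f y j := fun j => hχ.mul (hfj j)
  have hΦd : ∀ j, ContDiff ℝ 1 (Φ j) := fun j =>
    (hχj j).smul ((contDiff_radField ha hδ).comp hf)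
  have hΦc : ∀ j, HasCompactSupport (Φ j) := fun j => (hc.mul_right).smul_right
  have e1 : ∀ x, χ x * inner ℝ (radField a (a + 1 / 3) δ (f x)) (advect f Dv x) =
      ∑ j, inner ℝ (Φ j x) (Dv j x) := by
    intro x
    rw [advect, inner_sum, Finset.mul_sum]
    refine Finset.sum_congr rfl fun j _ => ?_
    rw [hΦ, inner_smul_right, inner_smul_left]
    simp only [conj_trivial]; ring
  have hdfj : ∀ j x w, fderiv ℝ (fun y => f y j) x w = (fderiv ℝ f x w) j := by
    intro j x w
    have h3 := ((EuclideanSpace.proj j : Space m →L[ℝ] ℝ).hasFDerivAt.comp x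
      (hf.differentiable (by norm_num) x).hasFDerivAt).fderiv
    exact congrArg (fun A : Space m →L[ℝ] ℝ => A w) h3
  have e2 : ∀ x, ∑ j, inner ℝ (fderiv ℝ (Φ j) x (basisVec j)) (v x) =
      fderiv ℝ χ x (f x) * inner ℝ (radField a (a + 1 / 3) δ (f x)) (v x) +
      χ x * inner ℝ (radDeriv a (a + 1 / 3) δ (f x) (fderiv ℝ f x (f x))) (v x) := by
    intro x
    have h1 : ∀ j, fderiv ℝ (Φ j) x (basisVec j) =
        (fderiv ℝ χ x (basisVec j) * f x j + χ x * classGrad f j x j) •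
          radField a (a + 1 / 3) δ (f x) +
        (χ x * f x j) • radDeriv a (a + 1 / 3) δ (f x) (fderiv ℝ f x (basisVec j)) := by
      intro j
      rw [hΦ]
      simp only
      rw [fderiv_weighted_radField ha hδ (hχj j) hf x]
      have h2 := (hχ.differentiable (by norm_num) x).hasFDerivAt.mul
        ((hfj j).differentiable (by norm_num) x).hasFDerivAt
      have h3 : fderiv ℝ (fun y => χ y * f y j) x (basisVec j) =
          fderiv ℝ χ x (basisVec j) * f x j + χ x * classGrad f j x j := by
        change fderiv ℝ (χ * fun y => f y j) x (basisVec j) = _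
        rw [h2.fderiv]
        simp only [add_apply, smul_apply, smul_eq_mul, hdfj, classGrad]
        ring
      rw [h3]
    simp only [h1, inner_add_left, inner_smul_left, conj_trivial]
    rw [Finset.sum_add_distrib, ← Finset.sum_mul, Finset.sum_add_distrib, ← Finset.mul_sum]
    -- The only use of the divergence of `f`; without it a term with `β'(f) · v` and a full
    -- derivative of `f` would remain.
    have h4 : ∑ j, classGrad f j x j = 0 := hdiv x
    rw [h4, mul_zero, add_zero]
    congr 1
    · congr 1
      rw [clm_eq_sum]
      exact Finset.sum_congr rfl fun j _ => by simp [mul_comm]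
    · rw [clm_eq_sum (fderiv ℝ f x) (f x), map_sum, sum_inner, Finset.mul_sum]
      refine Finset.sum_congr rfl fun j _ => ?_
      rw [map_smul, inner_smul_left]
      simp only [conj_trivial]; ring
  have i1 : ∀ j, Integrable (fun x => inner ℝ (Φ j x) (Dv j x)) volume := fun j =>
    integrable_inner_of_compact (hΦd j).continuous (hΦc j) (hv j).2.1
  have i2 : ∀ j, Integrable (fun x => inner ℝ (fderiv ℝ (Φ j) x (basisVec j)) (v x)) volume :=
    fun j => integrable_inner_of_compact (ContDiff.continuous_fderiv_const (hΦd j) _)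
      (HasCompactSupport.fderiv_apply_const (hΦc j) _) hl
  simp only [← e2]
  simp only [e1]
  refine ⟨integrable_finsetSum _ fun j _ => i1 j, integrable_finsetSum _ fun j _ => i2 j, ?_⟩
  rw [integral_finsetSum _ fun j _ => i1 j, integral_finsetSum _ fun j _ => i2 j,
    ← Finset.sum_neg_distrib]
  refine Finset.sum_congr rfl fun j _ => ?_
  rw [(hv j).integral_inner (hΦd j) (hΦc j), neg_neg]

/-- The Sobolev exponent `2m / (m - 2)`. -/
def sobExp (m : ℕ) : NNReal := (1 / 2 - 1 / (m : NNReal))⁻¹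

lemma sobExp_inv (hm : 3 ≤ m) : ((sobExp m : NNReal) : ℝ)⁻¹ = 1 / 2 - 1 / (m : ℝ) := by
  have h : (1 : NNReal) / (m : NNReal) ≤ 1 / 2 := by
    apply one_div_le_one_div_of_le (by norm_num)
    exact_mod_cast (by omega : 2 ≤ m)
  rw [sobExp, NNReal.coe_inv, inv_inv, NNReal.coe_sub h]
  simp

lemma holderTriple_sobExp (hm : 3 ≤ m) :
    ENNReal.HolderTriple (m : ℝ≥0∞) (sobExp m : ℝ≥0∞) 2 := by
  have hm0 : (0 : ℝ) < m := by exact_mod_cast (by omega : 0 < m)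
  have hm2 : (1 : ℝ) / m < 1 / 2 := by
    apply one_div_lt_one_div_of_lt (by norm_num)
    exact_mod_cast (by omega : 2 < m)
  have hs := sobExp_inv hm
  have hs0 : sobExp m ≠ 0 := by
    intro h; rw [h] at hs; simp at hs; rw [one_div] at hm2; linarith
  constructor
  have e1 : ((m : ℝ≥0∞))⁻¹ = (((m : NNReal)⁻¹ : NNReal) : ℝ≥0∞) := by
    rw [ENNReal.coe_inv (by exact_mod_cast (by omega : m ≠ 0))]; simp
  have e2 : ((sobExp m : ℝ≥0∞))⁻¹ = (((sobExp m)⁻¹ : NNReal) : ℝ≥0∞) := by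
    rw [ENNReal.coe_inv hs0]
  have e3 : (2 : ℝ≥0∞)⁻¹ = (((2 : NNReal)⁻¹ : NNReal) : ℝ≥0∞) := by
    rw [ENNReal.coe_inv (by norm_num)]; simp
  rw [e1, e2, e3, ← ENNReal.coe_add]
  congr 1
  apply NNReal.coe_injective
  push_cast
  rw [hs]; simp

/-- The Sobolev constant. -/
def sobConst (m : ℕ) : ℝ := (SNormLESNormFDerivOfEqConst (Space m) (volume : Measure (Space m))
  ((2 : NNReal) : ℝ) : NNReal)

lemma sobConst_nonneg (m : ℕ) : 0 ≤ sobConst m := NNReal.coe_nonneg _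

lemma eLpNorm_two_sq {B : Space m → ℝ} (hB : Continuous B) (hc : HasCompactSupport B) :
    eLpNorm B 2 volume * eLpNorm B 2 volume = ENNReal.ofReal (∫ x, B x ^ 2) := by
  have hm : MemLp B 2 volume := hB.memLp_of_hasCompactSupport hc
  have h := lpNorm_eq_integral_norm_rpow_toReal (p := 2) (f := B) (μ := volume)
    (by norm_num) (by norm_num) hB.aestronglyMeasurable
  rw [← ofReal_lpNorm hm, ← ENNReal.ofReal_mul lpNorm_nonneg, h]
  congr 1
  have h0 : 0 ≤ ∫ x, ‖B x‖ ^ (2 : ℝ≥0∞).toReal := integral_nonneg fun x => by positivity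
  rw [← Real.rpow_add_of_nonneg h0 (by simp) (by simp)]
  simp [show (2 : ℝ)⁻¹ + 2⁻¹ = 1 by norm_num]

/-- Hölder's inequality puts `|v₁| |g|` in `L²` from `L^m` and `L^(2m/(m-2))`; Cauchy–Schwarz pairs
it with `B`. The Sobolev inequality bounds the norm of `g` by that of its gradient, hence again by
the `L²` norm of `B`. -/
lemma holder_sobolev (hm : 3 ≤ m) {v₁ g : Space m → Space m} (hv : MemLp v₁ (m : ℝ≥0∞) volume)
    (hg : ContDiff ℝ 1 g) (hgc : HasCompactSupport g) {B : Space m → ℝ} (hB : Continuous B)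
    (hBc : HasCompactSupport B) (hgB : ∀ x, ‖fderiv ℝ g x‖ ≤ B x) :
    Integrable (fun x => ‖v₁ x‖ * ‖g x‖ * B x) volume ∧
    ∫ x, ‖v₁ x‖ * ‖g x‖ * B x ≤ sobConst m * lpNorm v₁ (m : ℝ≥0∞) volume * ∫ x, B x ^ 2 := by
  have := holderTriple_sobExp hm
  have hgm : AEStronglyMeasurable (fun x => ‖g x‖) volume := hg.continuous.norm.aestronglyMeasurable
  have hvm : AEStronglyMeasurable (fun x => ‖v₁ x‖) volume := hv.1.norm
  have h1 : eLpNorm ((fun x => ‖v₁ x‖) • fun x => ‖g x‖) 2 volume ≤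
      eLpNorm v₁ (m : ℝ≥0∞) volume * eLpNorm g (sobExp m) volume := by
    have := eLpNorm_smul_le_mul_eLpNorm (p := (m : ℝ≥0∞)) (q := (sobExp m : ℝ≥0∞)) (r := 2)
      hgm hvm
    rwa [eLpNorm_norm, eLpNorm_norm] at this
  have h2 : eLpNorm (((fun x => ‖v₁ x‖) • fun x => ‖g x‖) • B) 1 volume ≤
      eLpNorm ((fun x => ‖v₁ x‖) • fun x => ‖g x‖) 2 volume * eLpNorm B 2 volume :=
    eLpNorm_smul_le_mul_eLpNorm (p := 2) (q := 2) (r := 1) hB.aestronglyMeasurable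
      (hvm.smul hgm)
  have h3 : eLpNorm g (sobExp m) volume ≤ ENNReal.ofReal (sobConst m) * eLpNorm B 2 volume := by
    have hfr : Module.finrank ℝ (Space m) = m := by simp
    have := eLpNorm_le_eLpNorm_fderiv_of_eq (μ := (volume : Measure (Space m))) hg hgc (p := 2)
      (p' := sobExp m) (by norm_num) (by rw [hfr]; omega) (by
        rw [hfr, sobExp_inv hm]; simp)
    refine this.trans ?_
    rw [sobConst, ENNReal.ofReal_coe_nnreal]
    gcongr
    exact eLpNorm_mono_real hgB
  have h4 : eLpNorm (((fun x => ‖v₁ x‖) • fun x => ‖g x‖) • B) 1 volume ≤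
      ENNReal.ofReal (sobConst m * lpNorm v₁ (m : ℝ≥0∞) volume * ∫ x, B x ^ 2) := by
    calc _ ≤ eLpNorm v₁ (m : ℝ≥0∞) volume * (ENNReal.ofReal (sobConst m) * eLpNorm B 2 volume) *
          eLpNorm B 2 volume := h2.trans (by gcongr; exact h1.trans (by gcongr))
      _ = ENNReal.ofReal (sobConst m) * eLpNorm v₁ (m : ℝ≥0∞) volume *
          (eLpNorm B 2 volume * eLpNorm B 2 volume) := by ring
      _ = _ := by
        rw [eLpNorm_two_sq hB hBc, ← ofReal_lpNorm hv, ← ENNReal.ofReal_mul (sobConst_nonneg m),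
          ← ENNReal.ofReal_mul (mul_nonneg (sobConst_nonneg m) lpNorm_nonneg)]
  have hint : Integrable (((fun x => ‖v₁ x‖) • fun x => ‖g x‖) • B) volume := by
    rw [← memLp_one_iff_integrable]
    exact ⟨(hvm.smul hgm).smul hB.aestronglyMeasurable, h4.trans_lt ENNReal.ofReal_lt_top⟩
  refine ⟨hint, ?_⟩
  have h5 : ‖∫ x, (((fun x => ‖v₁ x‖) • fun x => ‖g x‖) • B) x‖ ≤
      sobConst m * lpNorm v₁ (m : ℝ≥0∞) volume * ∫ x, B x ^ 2 := by
    have h6 := enorm_integral_le_lintegral_enorm (μ := volume)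
      (((fun x => ‖v₁ x‖) • fun x => ‖g x‖) • B)
    rw [← eLpNorm_one_eq_lintegral_enorm] at h6
    have h7 := h6.trans h4
    rw [← ofReal_norm] at h7
    exact (ENNReal.ofReal_le_ofReal_iff (mul_nonneg (mul_nonneg (NNReal.coe_nonneg _)
      lpNorm_nonneg) (integral_nonneg fun x => sq_nonneg _))).1 h7
  exact (le_abs_self _).trans h5

/-- The constant in the gradient bounds. -/
def gradConst (a : ℝ) : ℝ := 4 + (1 + 2 * (a + (a + 1 / 3)))

lemma continuous_classGrad (hf : ContDiff ℝ 1 f) (i : Fin m) : Continuous (classGrad f i) :=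
  ContDiff.continuous_fderiv_const hf _

lemma continuous_gradSq {D : Fin m → Space m → Space m} (hD : ∀ i, Continuous (D i)) :
    Continuous (gradSq D) := continuous_finsetSum _ fun i _ => (hD i).norm.pow 2

end SmoothEstimates

/-! ### The transport and stretching estimate for smooth vorticity -/

section SmoothEstimates

variable {m : ℕ} {a δ : ℝ} {f v : Space m → Space m} {Dv : Fin m → Space m → Space m}
  {η : Space m → ℝ}

/-- The square root of the truncated weight. -/
def halfWt (a δ : ℝ) (f : Space m → Space m) (x : Space m) : ℝ :=
  wt (a / 2) ((a + 1 / 3) / 2) δ (‖f x‖ ^ 2)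

lemma halfWt_sq (hδ : 0 ≤ δ) (x : Space m) :
    halfWt a δ f x ^ 2 = wt a (a + 1 / 3) δ (‖f x‖ ^ 2) := wt_half_sq hδ (sq_nonneg _)

lemma halfWt_nonneg (hδ : 0 ≤ δ) (x : Space m) : 0 ≤ halfWt a δ f x := wt_nonneg hδ (sq_nonneg _)

lemma continuous_halfWt (ha : 0 ≤ a) (hδ : 0 ≤ δ) (hf : Continuous f) :
    Continuous (halfWt a δ f) := (continuous_wt_norm_sq (by linarith) hδ).comp hf

/-- The modulus of `η h^{1/2}(f) f`. -/
def cutAmp (a δ : ℝ) (η : Space m → ℝ) (f : Space m → Space m) (x : Space m) : ℝ :=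
  |η x| * (halfWt a δ f x * ‖f x‖)

/-- A majorant of the gradient of `η h^{1/2}(f) f`. -/
def cutGradAmp (a δ : ℝ) (η : Space m → ℝ) (f : Space m → Space m) (x : Space m) : ℝ :=
  gradConst a * (√(cutGradSq η x) * (halfWt a δ f x * ‖f x‖) +
    |η x| * (halfWt a δ f x * √(gradSq (classGrad f) x)))

lemma gradConst_nonneg (ha : 0 ≤ a) : 0 ≤ gradConst a := by unfold gradConst; linarith

lemma cutAmp_nonneg (hδ : 0 ≤ δ) (x : Space m) : 0 ≤ cutAmp a δ η f x :=
  mul_nonneg (abs_nonneg _) (mul_nonneg (halfWt_nonneg hδ x) (norm_nonneg _))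

lemma cutGradAmp_nonneg (ha : 0 ≤ a) (hδ : 0 ≤ δ) (x : Space m) : 0 ≤ cutGradAmp a δ η f x := by
  have h0 := halfWt_nonneg (a := a) (f := f) hδ x
  have h1 := gradConst_nonneg ha
  unfold cutGradAmp
  positivity

lemma continuous_cutAmp (ha : 0 ≤ a) (hδ : 0 ≤ δ) (hη : Continuous η) (hf : Continuous f) :
    Continuous (cutAmp a δ η f) := hη.abs.mul ((continuous_halfWt ha hδ hf).mul hf.norm)

lemma continuous_cutGradAmp (ha : 0 ≤ a) (hδ : 0 ≤ δ) (hη : ContDiff ℝ 1 η) (hf : ContDiff ℝ 1 f) :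
    Continuous (cutGradAmp a δ η f) := by
  have h1 := continuous_halfWt ha hδ hf.continuous
  have h2 := continuous_gradSq fun i => continuous_classGrad hf i
  exact continuous_const.mul (((continuous_cutGradSq hη).sqrt.mul (h1.mul hf.continuous.norm)).add
    (hη.continuous.abs.mul (h1.mul h2.sqrt)))

lemma hasCompactSupport_cutAmp (hc : HasCompactSupport η) : HasCompactSupport (cutAmp a δ η f) :=
  hc.mono fun x hx (h0 : η x = 0) => hx (by simp [cutAmp, h0])

lemma hasCompactSupport_cutGradAmp (hc : HasCompactSupport η) :
    HasCompactSupport (cutGradAmp a δ η f) := by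
  refine HasCompactSupport.mul_left (HasCompactSupport.add ?_ ?_)
  · exact HasCompactSupport.mul_right
      ((hasCompactSupport_cutGradSq hc).comp_left (g := Real.sqrt) Real.sqrt_zero)
  · exact HasCompactSupport.mul_right (hc.comp_left (g := fun y : ℝ => |y|) (by simp))

/-- Halving both exponents of the weight produces `h^(1/2)`. The Sobolev inequality can therefore be
applied to `η h^(1/2)(f) f`, whose squared gradient is bounded by the weighted dissipation plus the
cutoff error. -/
lemma norm_fderiv_cut_le (ha : 0 ≤ a) (hδ : 0 ≤ δ) (hη : ContDiff ℝ 1 η) (hf : ContDiff ℝ 1 f)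
    (x : Space m) :
    ‖fderiv ℝ (fun x => η x • radField (a / 2) ((a + 1 / 3) / 2) δ (f x)) x‖ ≤
      cutGradAmp a δ η f x := by
  refine ContinuousLinearMap.opNorm_le_bound _ (cutGradAmp_nonneg ha hδ x) fun w => ?_
  rw [fderiv_weighted_radField (by linarith) hδ hη hf]
  refine (norm_add_le _ _).trans ?_
  rw [norm_smul, norm_smul, norm_radField hδ, Real.norm_eq_abs, Real.norm_eq_abs]
  have e1 := abs_fderiv_apply_le η x w
  have e2 := norm_radDeriv_apply_le (a := a / 2) (κ := (a + 1 / 3) / 2) (by linarith)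
    (by linarith) hδ (f x) (fderiv ℝ f x w)
  have e3 := norm_fderiv_apply_le f x w
  have h0 := halfWt_nonneg (a := a) (f := f) hδ x
  unfold cutGradAmp
  change |fderiv ℝ η x w| * (halfWt a δ f x * ‖f x‖) + _ ≤ _
  change _ ≤ (1 + 2 * (a / 2 + (a + 1 / 3) / 2)) * halfWt a δ f x * _ at e2
  set s := √(cutGradSq η x)
  set g := √(gradSq (classGrad f) x)
  set H := halfWt a δ f x
  have hs : 0 ≤ s := Real.sqrt_nonneg _
  have hg : 0 ≤ g := Real.sqrt_nonneg _
  set c := 1 + 2 * (a / 2 + (a + 1 / 3) / 2) with hcdef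
  have hc0 : 0 ≤ c := by rw [hcdef]; linarith
  have hc1 : c ≤ gradConst a := by rw [hcdef]; unfold gradConst; linarith
  have hc2 : 1 ≤ gradConst a := by unfold gradConst; linarith
  have k0 : |fderiv ℝ η x w| * (H * ‖f x‖) ≤ (s * ‖w‖) * (H * ‖f x‖) :=
    mul_le_mul_of_nonneg_right e1 (by positivity)
  have k0' := e2.trans (mul_le_mul_of_nonneg_left e3 (mul_nonneg hc0 h0))
  have k0'' := mul_le_mul_of_nonneg_left k0' (abs_nonneg (η x))
  have k1 : s * (H * ‖f x‖) ≤ gradConst a * (s * (H * ‖f x‖)) :=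
    le_mul_of_one_le_left (by positivity) hc2
  have k2 : c * (|η x| * (H * g)) ≤ gradConst a * (|η x| * (H * g)) :=
    mul_le_mul_of_nonneg_right hc1 (by positivity)
  have k3 := mul_le_mul_of_nonneg_right (add_le_add k1 k2) (norm_nonneg w)
  linarith

lemma integrable_wCut (ha : 0 ≤ a) (hδ : 0 ≤ δ) (hη : ContDiff ℝ 1 η) (hc : HasCompactSupport η)
    (hf : Continuous f) :
    Integrable (fun x => cutGradSq η x * (wt a (a + 1 / 3) δ (‖f x‖ ^ 2) * ‖f x‖ ^ 2)) volume :=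
  Continuous.integrable_of_hasCompactSupport
    ((continuous_cutGradSq hη).mul (((continuous_wt_norm_sq ha hδ).comp hf).mul (hf.norm.pow 2)))
    (hasCompactSupport_cutGradSq hc).mul_right

lemma integrable_wDissip (ha : 0 ≤ a) (hδ : 0 ≤ δ) (hη : ContDiff ℝ 1 η)
    (hc : HasCompactSupport η) (hf : ContDiff ℝ 1 f) :
    Integrable (fun x => η x ^ 2 * (wt a (a + 1 / 3) δ (‖f x‖ ^ 2) * gradSq (classGrad f) x))
      volume :=
  Continuous.integrable_of_hasCompactSupport
    ((hη.continuous.pow 2).mul (((continuous_wt_norm_sq ha hδ).comp hf.continuous).mul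
      (continuous_gradSq fun i => continuous_classGrad hf i)))
    (HasCompactSupport.mul_right (hc.comp_left (g := fun y : ℝ => y ^ 2) (by simp)))

lemma integrable_sq_of_compact {A : Space m → ℝ} (hA : Continuous A) (hc : HasCompactSupport A) :
    Integrable (fun x => A x ^ 2) volume := by
  simp only [pow_two]
  exact (hA.mul hA).integrable_of_hasCompactSupport hc.mul_right

lemma integrable_cutAmp_sq (ha : 0 ≤ a) (hδ : 0 ≤ δ) (hη : ContDiff ℝ 1 η)
    (hc : HasCompactSupport η) (hf : ContDiff ℝ 1 f) :
    Integrable (fun x => cutAmp a δ η f x ^ 2) volume :=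
  integrable_sq_of_compact (continuous_cutAmp ha hδ hη.continuous hf.continuous)
    (hasCompactSupport_cutAmp hc)

lemma integrable_cutGradAmp_sq (ha : 0 ≤ a) (hδ : 0 ≤ δ) (hη : ContDiff ℝ 1 η)
    (hc : HasCompactSupport η) (hf : ContDiff ℝ 1 f) :
    Integrable (fun x => cutGradAmp a δ η f x ^ 2) volume :=
  integrable_sq_of_compact (continuous_cutGradAmp ha hδ hη hf) (hasCompactSupport_cutGradAmp hc)

lemma integral_cutAmp_sq (hδ : 0 ≤ δ) : ∫ x, cutAmp a δ η f x ^ 2 = wMass a δ η f := by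
  unfold wMass
  congr 1; ext x
  rw [cutAmp, mul_pow, sq_abs, mul_pow, halfWt_sq hδ]

lemma integral_cutGradAmp_sq_le (ha : 0 ≤ a) (hδ : 0 ≤ δ) (hη : ContDiff ℝ 1 η)
    (hc : HasCompactSupport η) (hf : ContDiff ℝ 1 f) : ∫ x, cutGradAmp a δ η f x ^ 2 ≤
      2 * gradConst a ^ 2 * (wCut a δ η f + wDissip a δ η f (classGrad f)) := by
  have h1 := integrable_wCut ha hδ hη hc hf.continuous
  have h2 := integrable_wDissip ha hδ hη hc hf
  have : ∫ x, cutGradAmp a δ η f x ^ 2 ≤ ∫ x, 2 * gradConst a ^ 2 *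
      (cutGradSq η x * (wt a (a + 1 / 3) δ (‖f x‖ ^ 2) * ‖f x‖ ^ 2) +
        η x ^ 2 * (wt a (a + 1 / 3) δ (‖f x‖ ^ 2) * gradSq (classGrad f) x)) := by
    refine integral_mono (integrable_cutGradAmp_sq ha hδ hη hc hf) ((h1.add h2).const_mul _)
      fun x => ?_
    have q1 : (√(cutGradSq η x) * (halfWt a δ f x * ‖f x‖)) ^ 2 =
        cutGradSq η x * (wt a (a + 1 / 3) δ (‖f x‖ ^ 2) * ‖f x‖ ^ 2) := by
      rw [mul_pow, mul_pow, Real.sq_sqrt (cutGradSq_nonneg η x), halfWt_sq hδ]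
    have q2 : (|η x| * (halfWt a δ f x * √(gradSq (classGrad f) x))) ^ 2 =
        η x ^ 2 * (wt a (a + 1 / 3) δ (‖f x‖ ^ 2) * gradSq (classGrad f) x) := by
      rw [mul_pow, mul_pow, Real.sq_sqrt (gradSq_nonneg _ x), halfWt_sq hδ, sq_abs]
    simp only [cutGradAmp]
    rw [← q1, ← q2, mul_pow, mul_comm 2, mul_assoc]
    exact mul_le_mul_of_nonneg_left add_sq_le (sq_nonneg _)
  rwa [integral_const_mul, integral_add h1 h2] at this

lemma fderiv_sq_apply (hη : ContDiff ℝ 1 η) (x w : Space m) :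
    fderiv ℝ (fun x => η x ^ 2) x w = 2 * η x * fderiv ℝ η x w := by
  have := ((hη.differentiable (by norm_num) x).hasFDerivAt.pow 2)
  rw [this.fderiv]
  simp

/-- The integrand of the transport term after integration by parts. -/
def transDensity (a δ : ℝ) (η : Space m → ℝ) (f v : Space m → Space m) (x : Space m) : ℝ :=
  (fderiv ℝ (fun x => η x ^ 2) x (f x) * inner ℝ (radField a (a + 1 / 3) δ (f x)) (v x) +
    η x ^ 2 * inner ℝ (radDeriv a (a + 1 / 3) δ (f x) (fderiv ℝ f x (f x))) (v x)) -
    fderiv ℝ (fun x => η x ^ 2) x (v x) * potential a (a + 1 / 3) δ (f x)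

/-- Transport and stretching are both integrated by parts, so that only `v` itself remains and its
`L^m` norm can enter. -/
lemma transForm_eq_integral_transDensity (ha : 0 ≤ a) (hδ : 0 ≤ δ) (hη : ContDiff ℝ 1 η)
    (hc : HasCompactSupport η) (hf : ContDiff ℝ 1 f) (hdf : ∀ x, divergence (classGrad f) x = 0)
    (hv : ∀ i, HasWeakPartial i v (Dv i)) (hl : LocallyIntegrable v volume)
    (hdv : ∀ᵐ x, divergence Dv x = 0) :
    transForm a δ (fun x => η x ^ 2) f (nonlin v f Dv (classGrad f)) =
      ∫ x, transDensity a δ η f v x := by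
  have hχ : ContDiff ℝ 1 fun x => η x ^ 2 := hη.pow 2
  have hχc : HasCompactSupport fun x => η x ^ 2 :=
    hc.comp_left (g := fun y : ℝ => y ^ 2) (by simp)
  obtain ⟨t1, t2, t3⟩ := integral_transport ha hδ hχ hχc hf hv hl hdv
  obtain ⟨s1, s2, s3⟩ := integral_stretch ha hδ hχ hχc hf hv hl hdf
  unfold transDensity
  rw [integral_sub s2 t2]
  unfold transForm nonlin
  simp only [inner_sub_right, mul_sub]
  rw [integral_sub t1 s1, t3, s3]
  ring

/-- The weight `h = H²` is shared between two factors: `|η| H |f|`, the Sobolev function, and `|∇η|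
H |f| + |η| H |∇f|`, its gradient. The term containing the potential has the same shape thanks to
`potential_le_wt`. -/
lemma norm_transDensity_le (ha : 0 ≤ a) (hδ : 0 ≤ δ) (hη : ContDiff ℝ 1 η) (x : Space m) :
    ‖transDensity a δ η f v x‖ ≤ ‖v x‖ * cutAmp a δ η f x * cutGradAmp a δ η f x := by
  unfold transDensity
  rw [fderiv_sq_apply hη, fderiv_sq_apply hη]
  have h0 := halfWt_nonneg (a := a) (f := f) hδ x
  have e1 := abs_fderiv_apply_le η x (f x)
  have e2 := abs_fderiv_apply_le η x (v x)
  have e3 := norm_radDeriv_apply_le (a := a) (κ := a + 1 / 3) ha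
    (by linarith) hδ (f x) (fderiv ℝ f x (f x))
  have e4 := norm_fderiv_apply_le f x (f x)
  have e5 := norm_radField (κ := a + 1 / 3) (a := a) hδ (f x)
  have e6 := potential_le_wt ha hδ (f x)
  have e7 := potential_nonneg (a := a) (κ := a + 1 / 3) hδ (f x)
  have hw : wt a (a + 1 / 3) δ (‖f x‖ ^ 2) = halfWt a δ f x ^ 2 := (halfWt_sq hδ x).symm
  rw [hw] at e3 e5 e6
  unfold cutAmp cutGradAmp
  set s := √(cutGradSq η x)
  set g := √(gradSq (classGrad f) x)
  set H := halfWt a δ f x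
  have hs : 0 ≤ s := Real.sqrt_nonneg _
  have hg : 0 ≤ g := Real.sqrt_nonneg _
  set c := 1 + 2 * (a + (a + 1 / 3)) with hcdef
  have hc0 : 0 ≤ c := by rw [hcdef]; linarith
  have b1 : ‖2 * η x * fderiv ℝ η x (f x) * inner ℝ (radField a (a + 1 / 3) δ (f x)) (v x)‖ ≤
      2 * |η x| * (s * ‖f x‖) * ((H ^ 2 * ‖f x‖) * ‖v x‖) := by
    rw [norm_mul, norm_mul, norm_mul, Real.norm_eq_abs, Real.norm_eq_abs, Real.norm_eq_abs,
      abs_two]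
    gcongr
    exact (norm_inner_le_norm _ _).trans (by rw [e5])
  have b2 : ‖η x ^ 2 * inner ℝ (radDeriv a (a + 1 / 3) δ (f x) (fderiv ℝ f x (f x))) (v x)‖ ≤
      |η x| ^ 2 * ((c * H ^ 2 * (g * ‖f x‖)) * ‖v x‖) := by
    rw [norm_mul, Real.norm_eq_abs, abs_pow]
    refine mul_le_mul_of_nonneg_left ((norm_inner_le_norm _ _).trans ?_) (by positivity)
    refine mul_le_mul_of_nonneg_right (e3.trans ?_) (norm_nonneg _)
    exact mul_le_mul_of_nonneg_left e4 (by positivity)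
  have b3 : ‖2 * η x * fderiv ℝ η x (v x) * potential a (a + 1 / 3) δ (f x)‖ ≤
      2 * |η x| * (s * ‖v x‖) * (H ^ 2 * ‖f x‖ ^ 2) := by
    rw [norm_mul, norm_mul, norm_mul, Real.norm_eq_abs, Real.norm_eq_abs, Real.norm_eq_abs,
      Real.norm_eq_abs, abs_two, abs_of_nonneg e7]
    gcongr
  have b4 := (norm_sub_le (2 * η x * fderiv ℝ η x (f x) *
      inner ℝ (radField a (a + 1 / 3) δ (f x)) (v x) +
      η x ^ 2 * inner ℝ (radDeriv a (a + 1 / 3) δ (f x) (fderiv ℝ f x (f x))) (v x))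
      (2 * η x * fderiv ℝ η x (v x) * potential a (a + 1 / 3) δ (f x))).trans
    (add_le_add ((norm_add_le _ _).trans (add_le_add b1 b2)) b3)
  refine b4.trans ?_
  -- The derivative of `η²` gives a factor `2` in each of the two cutoff terms, hence the `4`. The
  -- rest of `gradConst` is the operator bound for `radDeriv`.
  have hK4 : 4 ≤ gradConst a := by unfold gradConst; linarith
  have hKc : c ≤ gradConst a := by unfold gradConst; linarith
  have k1 : 4 * (s * (H * ‖f x‖)) ≤ gradConst a * (s * (H * ‖f x‖)) :=
    mul_le_mul_of_nonneg_right hK4 (by positivity)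
  have k2 : c * (|η x| * (H * g)) ≤ gradConst a * (|η x| * (H * g)) :=
    mul_le_mul_of_nonneg_right hKc (by positivity)
  have k3 := mul_le_mul_of_nonneg_left (add_le_add k1 k2)
    (show 0 ≤ ‖v x‖ * (|η x| * (H * ‖f x‖)) by positivity)
  refine le_trans (le_of_eq ?_) (k3.trans (le_of_eq ?_)) <;> ring

lemma mul_le_sq_add_sq {A B M l : ℝ} (hl : 0 < l) :
    M * A * B ≤ l * B ^ 2 + M ^ 2 / l * A ^ 2 := by
  have h4 : l * B ^ 2 + M ^ 2 / l * A ^ 2 - M * A * B =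
    ((l * B - M * A / 2) ^ 2 + 3 / 4 * (M * A) ^ 2) / l := by field_simp; ring
  have h5 : 0 ≤ ((l * B - M * A / 2) ^ 2 + 3 / 4 * (M * A) ^ 2) / l := by positivity
  linarith

/-- The transport term is controlled by the dissipation. -/
lemma abs_transForm_smooth_le (hm : 3 ≤ m) (ha : 0 ≤ a) (hδ : 0 ≤ δ)
    (hη : ContDiff ℝ 1 η) (hc : HasCompactSupport η) (hf : ContDiff ℝ 1 f)
    (hdf : ∀ x, divergence (classGrad f) x = 0) (hv : ∀ i, HasWeakPartial i v (Dv i))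
    (hl : LocallyIntegrable v volume) (hdv : ∀ᵐ x, divergence Dv x = 0) {v₁ : Space m → Space m}
    (hv₁ : MemLp v₁ (m : ℝ≥0∞) volume) {M : ℝ} (hM : ∀ x, ‖v x - v₁ x‖ ≤ M) {l : ℝ} (hlam : 0 < l) :
    |transForm a δ (fun x => η x ^ 2) f (nonlin v f Dv (classGrad f))| ≤
      (sobConst m * lpNorm v₁ (m : ℝ≥0∞) volume + l) *
        (2 * gradConst a ^ 2 * (wCut a δ η f + wDissip a δ η f (classGrad f))) +
      M ^ 2 / l * wMass a δ η f := by
  have hgA : ∀ x, ‖η x • radField (a / 2) ((a + 1 / 3) / 2) δ (f x)‖ = cutAmp a δ η f x :=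
    fun x => by
      rw [norm_smul, norm_radField hδ, Real.norm_eq_abs]; rfl
  have hgd : ContDiff ℝ 1 fun x => η x • radField (a / 2) ((a + 1 / 3) / 2) δ (f x) :=
    hη.smul ((contDiff_radField (by linarith) hδ).comp hf)
  have hgs : HasCompactSupport fun x => η x • radField (a / 2) ((a + 1 / 3) / 2) δ (f x) :=
    hc.smul_right
  obtain ⟨hI, hIle⟩ := holder_sobolev hm hv₁ hgd hgs (continuous_cutGradAmp ha hδ hη hf)
    (hasCompactSupport_cutGradAmp hc) (norm_fderiv_cut_le ha hδ hη hf)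
  simp only [hgA] at hI hIle
  have hBsq := integrable_cutGradAmp_sq ha hδ hη hc hf
  have hAsq := integrable_cutAmp_sq ha hδ hη hc hf
  -- The part `v₁` of the velocity is left for Hölder–Sobolev. The bounded remainder is separated by
  -- Young's inequality with parameter `l`, and costs mass instead of an `L^m` norm.
  have hfin : ∀ x, ‖transDensity a δ η f v x‖ ≤ ‖v₁ x‖ * cutAmp a δ η f x * cutGradAmp a δ η f x +
      (l * cutGradAmp a δ η f x ^ 2 + M ^ 2 / l * cutAmp a δ η f x ^ 2) := by
    intro x
    have hA0 := cutAmp_nonneg (a := a) (η := η) (f := f) hδ x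
    have hB0 := cutGradAmp_nonneg (η := η) (f := f) ha hδ x
    have h1 : ‖v x‖ ≤ ‖v₁ x‖ + M := by
      have := norm_add_le (v₁ x) (v x - v₁ x)
      rw [add_sub_cancel] at this
      linarith [hM x]
    have h2 := mul_le_mul_of_nonneg_right h1 (mul_nonneg hA0 hB0)
    have h3 := mul_le_sq_add_sq (A := cutAmp a δ η f x) (B := cutGradAmp a δ η f x) (M := M) hlam
    have h4 := norm_transDensity_le (f := f) (v := v) ha hδ hη x
    linarith
  have hBi := integral_cutGradAmp_sq_le ha hδ hη hc hf
  have hS : 0 ≤ sobConst m * lpNorm v₁ (m : ℝ≥0∞) volume :=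
    mul_nonneg (sobConst_nonneg m) lpNorm_nonneg
  rw [transForm_eq_integral_transDensity ha hδ hη hc hf hdf hv hl hdv]
  have h1 : |∫ x, transDensity a δ η f v x| ≤
      ∫ x, (‖v₁ x‖ * cutAmp a δ η f x * cutGradAmp a δ η f x +
      (l * cutGradAmp a δ η f x ^ 2 + M ^ 2 / l * cutAmp a δ η f x ^ 2)) :=
    norm_integral_le_of_norm_le (hI.add ((hBsq.const_mul l).add (hAsq.const_mul _)))
      (Eventually.of_forall hfin)
  rw [integral_add (g := fun x => l * cutGradAmp a δ η f x ^ 2 + M ^ 2 / l * cutAmp a δ η f x ^ 2)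
      hI ((hBsq.const_mul l).add (hAsq.const_mul _)),
    integral_add (hBsq.const_mul l) (hAsq.const_mul _), integral_const_mul,
    integral_const_mul, integral_cutAmp_sq hδ] at h1
  have h2 := mul_le_mul_of_nonneg_left hBi (add_nonneg hS hlam.le)
  linarith

end SmoothEstimates

/-! ### Estimates at a fixed time for fields with weak gradients -/

namespace Slice

variable {m : ℕ} {a δ p : ℝ} {f v : Space m → Space m} {Dv Df : Fin m → Space m → Space m}
  {η ψ : Space m → ℝ}

lemma classGrad_moll (h : Slice p v f Dv Df) (n : ℕ) : classGrad (moll n f) = mollGrad n Df := by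
  ext1 i; ext1 x
  exact fderiv_moll (h.weak_f i) n x

lemma divergence_mollGrad (h : Slice p v f Dv Df) (n : ℕ) (x : Space m) :
    divergence (mollGrad n Df) x = 0 := by
  have h1 : ∀ i : Fin m, (mollGrad n Df i x) i = moll n (fun y => Df i y i) x := fun i =>
    (moll_clm n (EuclideanSpace.proj i : Space m →L[ℝ] ℝ) (h.loc_Df i) x).symm
  unfold divergence
  simp only [h1]
  rw [← moll_sum n _ fun i _ => LocallyIntegrable.coord (h.loc_Df i) i, moll_apply]
  refine (integral_congr_ae ?_).trans (integral_zero _ _)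
  filter_upwards [h.div_f] with y hy
  change _ • divergence Df y = 0
  rw [hy, smul_zero]

/-- Only the vorticity is mollified, so the smooth estimate applies with the original velocity.
Every term in it converges as the mollification is removed. -/
lemma abs_transForm_le (h : Slice p v f Dv Df) (ha : 0 ≤ a) (hδ : 0 < δ) (hη : ContDiff ℝ 1 η)
    (hc : HasCompactSupport η) {v₁ : Space m → Space m} (hv₁ : MemLp v₁ (m : ℝ≥0∞) volume) {M : ℝ}
    (hM : ∀ x, ‖v x - v₁ x‖ ≤ M) {l : ℝ} (hl : 0 < l) :
    |transForm a δ (fun x => η x ^ 2) f (nonlin v f Dv Df)| ≤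
      (sobConst m * lpNorm v₁ (m : ℝ≥0∞) volume + l) *
        (2 * gradConst a ^ 2 * (wCut a δ η f + wDissip a δ η f Df)) +
      M ^ 2 / l * wMass a δ η f := by
  have hc2 : HasCompactSupport fun x => η x ^ 2 :=
    hc.comp_left (g := fun y : ℝ => y ^ 2) (by simp)
  have t1 := h.tendsto_transForm_nonlin ha hδ (hη.continuous.pow 2) hc2
  have t2 := (h.tendsto_wDissip ha hδ hη.continuous hc).2
  have t3 := (h.tendsto_weighted_mass ha hδ (continuous_cutGradSq hη)
    (hasCompactSupport_cutGradSq hc)).2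
  have t4 := (h.tendsto_weighted_mass ha hδ (hη.continuous.pow 2) hc2).2
  refine le_of_tendsto_of_tendsto t1.abs
    (((t3.add t2).const_mul (2 * gradConst a ^ 2)).const_mul
      (sobConst m * lpNorm v₁ (m : ℝ≥0∞) volume + l) |>.add (t4.const_mul (M ^ 2 / l)))
    (Eventually.of_forall fun n => ?_)
  have h1 := abs_transForm_smooth_le (a := a) (δ := δ) (f := moll n f) (v := v) (Dv := Dv)
    (η := η) h.three_le ha hδ.le hη hc (moll_contDiff n h.loc_f)
    (by rw [h.classGrad_moll]; exact h.divergence_mollGrad n) h.weak_v h.loc_v h.div_v hv₁ hM hl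
  rw [h.classGrad_moll] at h1
  exact h1

lemma aestronglyMeasurable_inner_radDeriv {f g : Space m → Space m} (ha : 0 ≤ a) (hδ : 0 ≤ δ)
    (hf : AEStronglyMeasurable f volume) (hg : AEStronglyMeasurable g volume) :
    AEStronglyMeasurable (fun x => (inner ℝ (radDeriv a (a + 1 / 3) δ (f x) (g x)) (g x) : ℝ))
      volume := by
  have h1 : AEStronglyMeasurable (fun x => radDeriv a (a + 1 / 3) δ (f x)) volume :=
    (continuous_radDeriv ha hδ).comp_aestronglyMeasurable hf
  have h2 : AEStronglyMeasurable (fun x => radDeriv a (a + 1 / 3) δ (f x) (g x)) volume :=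
    isBoundedBilinearMap_apply.continuous.comp_aestronglyMeasurable (h1.prodMk hg)
  exact h2.inner hg

lemma integrable_dissipForm (h : Slice p v f Dv Df) (ha : 0 ≤ a) (hδ : 0 < δ)
    (hη : Continuous η) (hc : HasCompactSupport η) :
    Integrable (fun x => η x ^ 2 * ∑ i, inner ℝ (radDeriv a (a + 1 / 3) δ (f x) (Df i x)) (Df i x))
      volume ∧
    (∀ x, 1 / 3 * (η x ^ 2 * (wt a (a + 1 / 3) δ (‖f x‖ ^ 2) * gradSq Df x)) ≤
      η x ^ 2 * ∑ i, inner ℝ (radDeriv a (a + 1 / 3) δ (f x) (Df i x)) (Df i x)) ∧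
    (∀ x, η x ^ 2 * ∑ i, inner ℝ (radDeriv a (a + 1 / 3) δ (f x) (Df i x)) (Df i x) ≤
      (1 + 2 * (a + (a + 1 / 3))) *
        (η x ^ 2 * (wt a (a + 1 / 3) δ (‖f x‖ ^ 2) * gradSq Df x))) := by
  have hlow : ∀ x, 1 / 3 * (η x ^ 2 * (wt a (a + 1 / 3) δ (‖f x‖ ^ 2) * gradSq Df x)) ≤
      η x ^ 2 * ∑ i, inner ℝ (radDeriv a (a + 1 / 3) δ (f x) (Df i x)) (Df i x) := by
    intro x
    have h1 : 1 / 3 * (wt a (a + 1 / 3) δ (‖f x‖ ^ 2) * gradSq Df x) ≤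
        ∑ i, inner ℝ (radDeriv a (a + 1 / 3) δ (f x) (Df i x)) (Df i x) := by
      unfold gradSq
      rw [Finset.mul_sum, Finset.mul_sum]
      exact Finset.sum_le_sum fun i _ => radDeriv_coercive ha hδ.le _ _
    have h2 := mul_le_mul_of_nonneg_left h1 (sq_nonneg (η x))
    linarith
  have hup : ∀ x, η x ^ 2 * ∑ i, inner ℝ (radDeriv a (a + 1 / 3) δ (f x) (Df i x)) (Df i x) ≤
      (1 + 2 * (a + (a + 1 / 3))) *
        (η x ^ 2 * (wt a (a + 1 / 3) δ (‖f x‖ ^ 2) * gradSq Df x)) := by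
    intro x
    have h1 : ∑ i, inner ℝ (radDeriv a (a + 1 / 3) δ (f x) (Df i x)) (Df i x) ≤
        (1 + 2 * (a + (a + 1 / 3))) * (wt a (a + 1 / 3) δ (‖f x‖ ^ 2) * gradSq Df x) := by
      unfold gradSq
      rw [Finset.mul_sum, Finset.mul_sum]
      refine Finset.sum_le_sum fun i _ => (real_inner_le_norm _ _).trans ?_
      have := mul_le_mul_of_nonneg_right (norm_radDeriv_apply_le (a := a) (κ := a + 1 / 3) ha
        (by linarith) hδ.le (f x) (Df i x)) (norm_nonneg (Df i x))
      linarith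
    have h2 := mul_le_mul_of_nonneg_left h1 (sq_nonneg (η x))
    linarith
  refine ⟨?_, hlow, hup⟩
  refine (((h.tendsto_wDissip ha hδ hη hc).1).const_mul (1 + 2 * (a + (a + 1 / 3)))).mono' ?_
    (Eventually.of_forall fun x => ?_)
  · refine ((hη.pow 2).aestronglyMeasurable).mul ?_
    exact Finset.aestronglyMeasurable_fun_sum _ fun i _ => aestronglyMeasurable_inner_radDeriv ha
      hδ.le h.memLp_f.1 (h.memLp_Df i).1
  · rw [Real.norm_eq_abs, abs_of_nonneg]
    · exact hup x
    · refine le_trans ?_ (hlow x)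
      have := wt_nonneg (a := a) (κ := a + 1 / 3) hδ.le (sq_nonneg ‖f x‖)
      have := gradSq_nonneg Df x
      positivity

lemma dissipForm_bounds (h : Slice p v f Dv Df) (ha : 0 ≤ a) (hδ : 0 < δ)
    (hη : Continuous η) (hc : HasCompactSupport η) :
    1 / 3 * wDissip a δ η f Df ≤ dissipForm a δ (fun x => η x ^ 2) f Df ∧
    dissipForm a δ (fun x => η x ^ 2) f Df ≤
      (1 + 2 * (a + (a + 1 / 3))) * wDissip a δ η f Df := by
  obtain ⟨h1, h2, h3⟩ := h.integrable_dissipForm ha hδ hη hc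
  have h4 := (h.tendsto_wDissip ha hδ hη hc).1
  unfold wDissip dissipForm
  rw [← integral_const_mul, ← integral_const_mul]
  exact ⟨integral_mono (h4.const_mul _) h1 h2, integral_mono h1 (h4.const_mul _) h3⟩

/-- Pointwise completion of the square, with a free parameter: it is fixed when the dissipation has
to be absorbed, and tends to zero together with the cutoff gradient in the final limit. -/
lemma abs_crossForm_le (h : Slice p v f Dv Df) (ha : 0 ≤ a) (hδ : 0 < δ) (hη : ContDiff ℝ 1 η)
    (hc : HasCompactSupport η) {ε : ℝ} (hε : 0 < ε) :
    |crossForm a δ (fun x => η x ^ 2) f Df| ≤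
      ε * wDissip a δ η f Df + 1 / ε * wCut a δ η f := by
  have i1 := (h.tendsto_wDissip ha hδ hη.continuous hc).1
  have i2 := (h.tendsto_weighted_mass ha hδ (continuous_cutGradSq hη)
    (hasCompactSupport_cutGradSq hc)).1
  unfold wDissip wCut crossForm
  rw [← integral_const_mul, ← integral_const_mul, ← integral_add (i1.const_mul _) (i2.const_mul _),
    ← Real.norm_eq_abs]
  refine norm_integral_le_of_norm_le ((i1.const_mul _).add (i2.const_mul _))
    (Eventually.of_forall fun x => ?_)
  set H := wt a (a + 1 / 3) δ (‖f x‖ ^ 2) with hH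
  have hH0 : 0 ≤ H := wt_nonneg hδ.le (sq_nonneg _)
  set s := √(cutGradSq η x) with hs
  set g := √(gradSq Df x) with hg
  have hs2 : cutGradSq η x = s ^ 2 := (Real.sq_sqrt (cutGradSq_nonneg η x)).symm
  have hg2 : gradSq Df x = g ^ 2 := (Real.sq_sqrt (gradSq_nonneg Df x)).symm
  have h1 : ∑ i : Fin m, |fderiv ℝ η x (basisVec i)| * ‖Df i x‖ ≤ s * g := by
    refine Real.sum_mul_le_sqrt_mul_sqrt _ _ _ |>.trans (le_of_eq ?_)
    simp only [sq_abs]; rfl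
  have h2 : ‖∑ i, fderiv ℝ (fun x => η x ^ 2) x (basisVec i) *
      (inner ℝ (radField a (a + 1 / 3) δ (f x)) (Df i x) : ℝ)‖ ≤
      2 * |η x| * (H * ‖f x‖) * ∑ i : Fin m, |fderiv ℝ η x (basisVec i)| * ‖Df i x‖ := by
    refine (norm_sum_le _ _).trans ?_
    rw [Finset.mul_sum]
    refine Finset.sum_le_sum fun i _ => ?_
    rw [fderiv_sq_apply hη, norm_mul, Real.norm_eq_abs, abs_mul, abs_mul, abs_two]
    have h3 := norm_inner_le_norm (𝕜 := ℝ) (radField a (a + 1 / 3) δ (f x)) (Df i x)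
    rw [norm_radField hδ.le] at h3
    have h4 := mul_le_mul_of_nonneg_left h3
      (show 0 ≤ 2 * |η x| * |fderiv ℝ η x (basisVec i)| by positivity)
    linarith
  have h5 := mul_le_mul_of_nonneg_left h1 (show 0 ≤ 2 * |η x| * (H * ‖f x‖) by positivity)
  refine (h2.trans h5).trans ?_
  rw [hs2, hg2]
  have h6 : ε * (η x ^ 2 * (H * g ^ 2)) + 1 / ε * (s ^ 2 * (H * ‖f x‖ ^ 2)) -
      2 * |η x| * (H * ‖f x‖) * (s * g) = H * (ε * (|η x| * g) - s * ‖f x‖) ^ 2 / ε := by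
    rw [← sq_abs (η x)]; field_simp; ring
  have h7 : 0 ≤ H * (ε * (|η x| * g) - s * ‖f x‖) ^ 2 / ε := by positivity
  linarith

lemma wDissip_nonneg (hδ : 0 ≤ δ) : 0 ≤ wDissip a δ η f Df :=
  integral_nonneg fun _ => mul_nonneg (sq_nonneg _)
    (mul_nonneg (wt_nonneg hδ (sq_nonneg _)) (gradSq_nonneg _ _))

lemma wCut_nonneg (hδ : 0 ≤ δ) : 0 ≤ wCut a δ η f :=
  integral_nonneg fun _ => mul_nonneg (cutGradSq_nonneg _ _)
    (mul_nonneg (wt_nonneg hδ (sq_nonneg _)) (sq_nonneg _))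

/-- Weak form of the transport term. -/
lemma integral_smul_advect (h : Slice p v f Dv Df) (hψ : ContDiff ℝ 1 ψ)
    (hc : HasCompactSupport ψ) :
    Integrable (fun x => ψ x • advect v Df x) volume ∧
    Integrable (fun x => fderiv ℝ ψ x (v x) • f x) volume ∧
    ∫ x, ψ x • advect v Df x = -∫ x, fderiv ℝ ψ x (v x) • f x := by
  have hcub : ∀ r : ℝ, 0 ≤ r → r ^ 2 ≤ 1 + r ^ 3 := fun r hr =>
    pow_le_one_add_pow hr (by norm_num)
  have hvsq : ∀ x, ‖v x‖ ^ 2 ≤ 2 + majorant p 1 v f Dv Df x := fun x => by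
    linarith [hcub _ (norm_nonneg (v x)), h.cube_v_le one_pos x]
  obtain ⟨i1, t1⟩ := tendsto_integral_of_le_weight
    (f := fun n x => ψ x • advect v (mollGrad n Df) x) (f' := fun x => ψ x • advect v Df x)
    (c := fun x => 3 * m * ψ x) (continuous_const.mul hψ.continuous) hc.mul_left
    (fun n => hψ.continuous.aestronglyMeasurable.smul (aestronglyMeasurable_advect h.memLp_v.1
      fun i => (h.continuous_mollGrad n i).aestronglyMeasurable))
    (h.integrable_majorant one_pos) (majorant_nonneg one_pos)
    (fun n x => by
      have h1 : ‖advect v (mollGrad n Df) x‖ ≤ ∑ _i : Fin m,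
          (3 * (1 + majorant p 1 v f Dv Df x + moll n (majorant p 1 v f Dv Df) x)) := by
        refine (norm_advect_le _ _ _).trans (Finset.sum_le_sum fun i _ => ?_)
        have h2 := h.moll_grad_sq_le one_pos n i x
        rw [div_one] at h2
        have h3 := two_mul_le_add_sq ‖v x‖ ‖mollGrad n Df i x‖
        have h4 := hvsq x
        have h5 := majorant_nonneg (p := p) (v := v) (f := f) (Dv := Dv) (Df := Df) one_pos x
        have h6 := moll_maj_nonneg (p := p) (v := v) (f := f) (Dv := Dv) (Df := Df) one_pos n x
        unfold mollGrad at h3 ⊢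
        nlinarith
      simp only [Finset.sum_const, Finset.card_univ, Fintype.card_fin, nsmul_eq_mul] at h1
      rw [norm_smul, Real.norm_eq_abs, abs_mul, abs_of_nonneg (show (0 : ℝ) ≤ 3 * m by positivity)]
      have := mul_le_mul_of_nonneg_left h1 (abs_nonneg (ψ x))
      linarith)
    (by
      filter_upwards [h.ae_tendsto] with x hx
      unfold advect
      exact (tendsto_finsetSum _ fun i _ => (hx.2.1 i).const_smul _).const_smul _)
  obtain ⟨i2, t2⟩ := tendsto_integral_of_le_weight
    (f := fun n x => fderiv ℝ ψ x (v x) • moll n f x) (f' := fun x => fderiv ℝ ψ x (v x) • f x)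
    (c := fun x => 3 * ∑ i, |fderiv ℝ ψ x (basisVec i)|)
    (continuous_const.mul (continuous_sum_abs_fderiv hψ)) (hasCompactSupport_sum_abs_fderiv hc).mul_left
    (fun n => (integrable_fderiv_apply h.loc_v hψ hc).1.smul
      (h.continuous_moll_f n).aestronglyMeasurable)
    (h.integrable_majorant one_pos) (majorant_nonneg one_pos)
    (fun n x => by
      set s := ∑ i, |fderiv ℝ ψ x (basisVec i)| with hs
      have hs0 : 0 ≤ s := Finset.sum_nonneg fun _ _ => abs_nonneg _
      have h1 : |fderiv ℝ ψ x (v x)| ≤ s * ‖v x‖ := by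
        rw [clm_eq_sum]
        refine (Finset.abs_sum_le_sum_abs _ _).trans ?_
        rw [hs, Finset.sum_mul]
        refine Finset.sum_le_sum fun i _ => ?_
        rw [smul_eq_mul, abs_mul, mul_comm]
        exact mul_le_mul_of_nonneg_left (abs_coord_le _ _) (abs_nonneg _)
      have h2 := h.moll_sq_le one_pos n x
      have h3 := two_mul_le_add_sq ‖v x‖ ‖moll n f x‖
      have h4 := hvsq x
      have h5 := majorant_nonneg (p := p) (v := v) (f := f) (Dv := Dv) (Df := Df) one_pos x
      have h6 := moll_maj_nonneg (p := p) (v := v) (f := f) (Dv := Dv) (Df := Df) one_pos n x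
      rw [norm_smul, Real.norm_eq_abs, abs_mul (3 : ℝ), abs_of_nonneg hs0, abs_of_pos (three_pos : (0 : ℝ) < 3)]
      have h7 := mul_le_mul_of_nonneg_right h1 (norm_nonneg (moll n f x))
      have h8 : ‖v x‖ * ‖moll n f x‖ ≤
          3 * (1 + majorant p 1 v f Dv Df x + moll n (majorant p 1 v f Dv Df) x) := by
        nlinarith
      have h9 := mul_le_mul_of_nonneg_left h8 hs0
      linarith)
    (by
      filter_upwards [h.ae_tendsto] with x hx
      exact hx.1.const_smul _)
  refine ⟨i1, i2, ?_⟩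
  -- For mollified `f` the product rule is classical and `div v = 0` is tested against `ψ f_n`. The
  -- velocity stays rough.
  have key : ∀ n, ∫ x, ψ x • advect v (mollGrad n Df) x =
      -∫ x, fderiv ℝ ψ x (v x) • moll n f x := by
    intro n
    have hfn : ContDiff ℝ 1 (moll n f) := moll_contDiff n h.loc_f
    have hφ : ContDiff ℝ 1 fun x => ψ x • moll n f x := hψ.smul hfn
    have hφc : HasCompactSupport fun x => ψ x • moll n f x := hc.smul_right
    have e0 := integral_fderiv_eq_zero_vec h.weak_v h.loc_v h.div_v hφ hφc
    have e1 := integrable_fderiv_apply h.loc_v hφ hφc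
    have e2 : ∀ x, fderiv ℝ (fun x => ψ x • moll n f x) x (v x) =
        fderiv ℝ ψ x (v x) • moll n f x + ψ x • advect v (mollGrad n Df) x := by
      intro x
      have h3 := (hψ.differentiable (by norm_num) x).hasFDerivAt.smul
        (hfn.differentiable (by norm_num) x).hasFDerivAt
      change fderiv ℝ (ψ • moll n f) x (v x) = _
      rw [h3.fderiv, ← h.classGrad_moll, ← fderiv_apply_eq_advect]
      simp [add_comm]
    simp only [e2] at e0 e1
    have i3 : Integrable (fun x => fderiv ℝ ψ x (v x) • moll n f x) volume := by
      have e : ∀ x, fderiv ℝ ψ x (v x) • moll n f x =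
          ∑ i, v x i • (fderiv ℝ ψ x (basisVec i) • moll n f x) := by
        intro x
        rw [clm_eq_sum, Finset.sum_smul]
        exact Finset.sum_congr rfl fun i _ => smul_assoc _ _ _
      simp only [e]
      refine integrable_finsetSum _ fun i _ => ?_
      exact (LocallyIntegrable.coord h.loc_v i).integrable_smul_right_of_hasCompactSupport
        ((ContDiff.continuous_fderiv_const hψ _).smul hfn.continuous)
        (HasCompactSupport.fderiv_apply_const hc _).smul_right
    have i4 : Integrable (fun x => ψ x • advect v (mollGrad n Df) x) volume := by
      refine (e1.sub i3).congr (Eventually.of_forall fun x => ?_)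
      simp
    rw [integral_add i3 i4] at e0
    exact eq_neg_of_add_eq_zero_right e0
  exact tendsto_nhds_unique t1 (by simpa only [key] using t2.neg)

/-- Weak form of the nonlinear term. -/
lemma integral_smul_nonlin (h : Slice p v f Dv Df) (h' : Slice p f v Df Dv) (hψ : ContDiff ℝ 1 ψ)
    (hc : HasCompactSupport ψ) :
    Integrable (fun x => ψ x • nonlin v f Dv Df x) volume ∧
    Integrable (fun x => fderiv ℝ ψ x (v x) • f x - fderiv ℝ ψ x (f x) • v x) volume ∧
    ∫ x, ψ x • nonlin v f Dv Df x =
      -∫ x, (fderiv ℝ ψ x (v x) • f x - fderiv ℝ ψ x (f x) • v x) := by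
  obtain ⟨a1, a2, a3⟩ := h.integral_smul_advect hψ hc
  obtain ⟨b1, b2, b3⟩ := h'.integral_smul_advect hψ hc
  unfold nonlin
  simp only [smul_sub]
  refine ⟨a1.sub b1, a2.sub b2, ?_⟩
  rw [integral_sub a1 b1, integral_sub a2 b2, a3, b3]
  abel

end Slice

/-! ### Continuity in time with values in `L^q` -/

section TimeContinuity

variable {m : ℕ} {q : ℝ≥0∞} {S : Set ℝ} {v w : ℝ → Space m → Space m} {k : Space m → ℝ}

/-- Convolution with a scalar kernel. -/
def kconv (k : Space m → ℝ) (f : Space m → Space m) (x : Space m) : Space m :=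
  ∫ y, k (x - y) • f y

lemma hasCompactSupport_reflect (hc : HasCompactSupport k) (x : Space m) :
    HasCompactSupport fun y => k (x - y) := hasCompactSupport_sub_left hc x

/-- Hölder's inequality, with a right-hand side independent of `x` because Lebesgue measure is
invariant under reflection and translation. Convergence in `L^q` thus becomes uniform convergence of
convolutions. -/
lemma enorm_kconv_le (hq : 1 ≤ q) (hk : Continuous k) {f : Space m → Space m}
    (hf : AEStronglyMeasurable f volume) (x : Space m) :
    ‖kconv k f x‖ₑ ≤ eLpNorm k q.conjExponent volume * eLpNorm f q volume := by
  have := ENNReal.HolderConjugate.conjExponent hq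
  have := this.symm
  have hk' : Continuous fun y => k (x - y) := hk.comp (continuous_const.sub continuous_id)
  have h1 := eLpNorm_smul_le_mul_eLpNorm (p := q.conjExponent) (q := q) (r := 1) hf
    hk'.aestronglyMeasurable (μ := volume)
  have h2 : eLpNorm (fun y => k (x - y)) q.conjExponent volume = eLpNorm k q.conjExponent volume :=
    eLpNorm_comp_measurePreserving hk.aestronglyMeasurable (Measure.measurePreserving_sub_left volume x)
  rw [h2] at h1
  refine le_trans ?_ h1
  rw [eLpNorm_one_eq_lintegral_enorm]
  exact enorm_integral_le_lintegral_enorm _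

lemma continuous_kconv (hk : Continuous k) (hc : HasCompactSupport k) {f : Space m → Space m}
    (hf : LocallyIntegrable f volume) : Continuous (kconv k f) := by
  have h := hc.continuous_convolution_left (ContinuousLinearMap.lsmul ℝ ℝ) hk hf (μ := volume)
  refine h.congr fun x => ?_
  rw [convolution_eq_swap]
  rfl

lemma kconv_sub (hk : Continuous k) (hc : HasCompactSupport k) {f g : Space m → Space m}
    (hf : LocallyIntegrable f volume) (hg : LocallyIntegrable g volume) (x : Space m) :
    kconv k (f - g) x = kconv k f x - kconv k g x := by
  have hk' : Continuous fun y => k (x - y) := hk.comp (continuous_const.sub continuous_id)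
  unfold kconv
  rw [← integral_sub (integrable_smul_of_compact hk' (hasCompactSupport_reflect hc x) hf)
    (integrable_smul_of_compact hk' (hasCompactSupport_reflect hc x) hg)]
  simp [smul_sub]

/-- Joint continuity: the change in time is small uniformly in space, and at a fixed time the
convolution is continuous in space. -/
lemma ContinuousInLp.continuousOn_kconv (h : ContinuousInLp S q v) (hq : 1 ≤ q)
    (hk : Continuous k) (hc : HasCompactSupport k) :
    ContinuousOn (fun z : ℝ × Space m => kconv k (v z.1) z.2) (S ×ˢ univ) := by
  rintro ⟨t, x⟩ ⟨ht, -⟩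
  have hl : ∀ s ∈ S, LocallyIntegrable (v s) volume := fun s hs => (h.1 s hs).locallyIntegrable hq
  have h1 : Tendsto (fun z : ℝ × Space m => kconv k (v t) z.2) (𝓝[S ×ˢ univ] (t, x))
      (𝓝 (kconv k (v t) x)) :=
    (((continuous_kconv hk hc (hl t ht)).comp continuous_snd).tendsto (t, x)).mono_left
      nhdsWithin_le_nhds
  have h2 : Tendsto (fun z : ℝ × Space m => eLpNorm k q.conjExponent volume *
      eLpNorm (v z.1 - v t) q volume) (𝓝[S ×ˢ univ] (t, x)) (𝓝 0) := by
    have hfst : Tendsto (fun z : ℝ × Space m => z.1) (𝓝[S ×ˢ univ] (t, x)) (𝓝[S] t) :=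
      tendsto_nhdsWithin_iff.2 ⟨(continuous_fst.tendsto (t, x)).mono_left nhdsWithin_le_nhds,
        eventually_nhdsWithin_of_forall fun z hz => hz.1⟩
    have := ENNReal.Tendsto.const_mul (a := eLpNorm k q.conjExponent volume)
      ((h.2 t ht).comp hfst) (Or.inr (hk.memLp_of_hasCompactSupport hc).2.ne)
    rwa [mul_zero] at this
  have h3 : Tendsto (fun z : ℝ × Space m => kconv k (v z.1 - v t) z.2) (𝓝[S ×ˢ univ] (t, x))
      (𝓝 0) := by
    rw [tendsto_zero_iff_enorm_tendsto_zero]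
    refine tendsto_of_tendsto_of_tendsto_of_le_of_le' tendsto_const_nhds h2
      (Eventually.of_forall fun _ => zero_le) ?_
    filter_upwards [self_mem_nhdsWithin] with z hz
    exact enorm_kconv_le hq hk ((h.1 _ hz.1).1.sub (h.1 t ht).1) _
  have h4 := h3.add h1
  rw [zero_add] at h4
  refine h4.congr' ?_
  filter_upwards [self_mem_nhdsWithin] with z hz
  rw [kconv_sub hk hc (hl _ hz.1) (hl t ht), sub_add_cancel]

lemma ContinuousInLp.continuousOn_integral_smul (h : ContinuousInLp S q v) (hq : 1 ≤ q)
    (hk : Continuous k) (hc : HasCompactSupport k) :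
    ContinuousOn (fun t => ∫ y, k y • v t y) S := by
  have h1 := h.continuousOn_kconv hq (k := fun y => k (-y)) (hk.comp continuous_neg)
    (hc.comp_homeomorph (Homeomorph.neg (Space m)))
  have h2 : ContinuousOn (fun t : ℝ => ((t, 0) : ℝ × Space m)) S := by fun_prop
  refine (h1.comp h2 fun t ht => ⟨ht, mem_univ _⟩).congr fun t _ => ?_
  simp [kconv]

/-- `y ↦ v_i(y) f(y)`. -/
def tensorField (i : Fin m) (v f : Space m → Space m) (y : Space m) : Space m := v y i • f y

lemma eLpNorm_tensorField_le (i : Fin m) {v f : Space m → Space m}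
    (hv : AEStronglyMeasurable v volume) (hf : AEStronglyMeasurable f volume) :
    eLpNorm (tensorField i v f) (m / 2 : ℝ≥0∞) volume ≤
      eLpNorm v m volume * eLpNorm f m volume := by
  have : ENNReal.HolderTriple (m : ℝ≥0∞) (m : ℝ≥0∞) (m / 2 : ℝ≥0∞) := by
    constructor
    rw [ENNReal.inv_div (by simp) (by simp), ← two_mul, div_eq_mul_inv]
  have h1 : AEStronglyMeasurable (fun y => v y i) volume :=
    (EuclideanSpace.proj i : Space m →L[ℝ] ℝ).continuous.comp_aestronglyMeasurable hv
  refine (eLpNorm_smul_le_mul_eLpNorm (p := (m : ℝ≥0∞)) (q := (m : ℝ≥0∞)) (r := (m / 2 : ℝ≥0∞))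
    hf h1).trans ?_
  gcongr
  exact eLpNorm_mono fun y => by rw [Real.norm_eq_abs]; exact abs_coord_le _ _

lemma aestronglyMeasurable_tensorField (i : Fin m) {v f : Space m → Space m}
    (hv : AEStronglyMeasurable v volume) (hf : AEStronglyMeasurable f volume) :
    AEStronglyMeasurable (tensorField i v f) volume :=
  ((EuclideanSpace.proj i : Space m →L[ℝ] ℝ).continuous.comp_aestronglyMeasurable hv).smul hf

lemma one_le_half (hm : 3 ≤ m) : (1 : ℝ≥0∞) ≤ m / 2 := by
  rw [ENNReal.le_div_iff_mul_le (by simp) (by simp)]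
  have : (2 : ℕ) ≤ m := by omega
  rw [one_mul]
  exact_mod_cast this

/-- The difference of products is telescoped and each piece estimated by Hölder from `L^m × L^m` to
`L^(m/2)`. This is what makes the flux of the vorticity equation continuous in time. -/
lemma ContinuousInLp.tensorField (hm : 3 ≤ m) (hv : ContinuousInLp S m v)
    (hw : ContinuousInLp S m w) (i : Fin m) :
    ContinuousInLp S (m / 2 : ℝ≥0∞) fun t => tensorField i (v t) (w t) := by
  refine ⟨fun t ht => ⟨aestronglyMeasurable_tensorField i (hv.1 t ht).1 (hw.1 t ht).1,
    (eLpNorm_tensorField_le i (hv.1 t ht).1 (hw.1 t ht).1).trans_lt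
      (ENNReal.mul_lt_top (hv.1 t ht).2 (hw.1 t ht).2)⟩, fun t ht => ?_⟩
  have hm1 : (1 : ℝ≥0∞) ≤ m := by
    have : 1 ≤ m := by omega
    exact_mod_cast this
  have hV := (hv.1 t ht).2.ne
  have hW := (hw.1 t ht).2.ne
  have lim : Tendsto (fun s => eLpNorm (v s - v t) m volume *
      (eLpNorm (w s - w t) m volume + eLpNorm (w t) m volume) +
      eLpNorm (v t) m volume * eLpNorm (w s - w t) m volume) (𝓝[S] t) (𝓝 0) := by
    have h1 := ENNReal.Tendsto.mul (hv.2 t ht)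
      (Or.inr (by simpa using hW)) ((hw.2 t ht).add_const (eLpNorm (w t) m volume))
      (Or.inr (by simp))
    have h2 := ENNReal.Tendsto.const_mul (a := eLpNorm (v t) m volume) (hw.2 t ht) (Or.inr hV)
    have := h1.add h2
    rwa [zero_mul, mul_zero, zero_add] at this
  refine tendsto_of_tendsto_of_tendsto_of_le_of_le' tendsto_const_nhds lim
    (Eventually.of_forall fun _ => zero_le) ?_
  filter_upwards [self_mem_nhdsWithin] with s hs
  have e : (Vorticity.tensorField i (v s) (w s) - Vorticity.tensorField i (v t) (w t)) =
      Vorticity.tensorField i (v s - v t) (w s) + Vorticity.tensorField i (v t) (w s - w t) := by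
    ext1 y
    simp [Vorticity.tensorField, sub_smul, smul_sub]
  have mv := (hv.1 s hs).1.sub (hv.1 t ht).1
  have mw := (hw.1 s hs).1.sub (hw.1 t ht).1
  rw [e]
  refine (eLpNorm_add_le (aestronglyMeasurable_tensorField i mv (hw.1 s hs).1)
    (aestronglyMeasurable_tensorField i (hv.1 t ht).1 mw) (one_le_half hm)).trans ?_
  refine add_le_add ((eLpNorm_tensorField_le i mv (hw.1 s hs).1).trans ?_)
    (eLpNorm_tensorField_le i (hv.1 t ht).1 mw)
  gcongr
  have := eLpNorm_add_le mw (hw.1 t ht).1 hm1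
  rwa [sub_add_cancel] at this

lemma ContinuousInLp.sub (hq : 1 ≤ q) (hv : ContinuousInLp S q v) (hw : ContinuousInLp S q w) :
    ContinuousInLp S q fun t => v t - w t := by
  refine ⟨fun t ht => (hv.1 t ht).sub (hw.1 t ht), fun t ht => ?_⟩
  have lim := (hv.2 t ht).add (hw.2 t ht)
  rw [zero_add] at lim
  refine tendsto_of_tendsto_of_tendsto_of_le_of_le' tendsto_const_nhds lim
    (Eventually.of_forall fun _ => zero_le) ?_
  filter_upwards [self_mem_nhdsWithin] with s hs
  have e : (v s - w s) - (v t - w t) = (v s - v t) - (w s - w t) := by abel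
  rw [e]
  exact eLpNorm_sub_le ((hv.1 s hs).1.sub (hv.1 t ht).1) ((hw.1 s hs).1.sub (hw.1 t ht).1) hq

lemma ContinuousInLp.continuousOn_lpNorm (hq : 1 ≤ q) (hv : ContinuousInLp S q v) :
    ContinuousOn (fun t => lpNorm (v t) q volume) S := by
  intro t ht
  have h1 : Tendsto (fun s => (eLpNorm (v s - v t) q volume).toReal) (𝓝[S] t) (𝓝 0) := by
    have := (ENNReal.tendsto_toReal ENNReal.zero_ne_top).comp (hv.2 t ht)
    exact this
  rw [ContinuousWithinAt, tendsto_iff_norm_sub_tendsto_zero]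
  refine tendsto_of_tendsto_of_tendsto_of_le_of_le' tendsto_const_nhds h1
    (Eventually.of_forall fun _ => norm_nonneg _) ?_
  filter_upwards [self_mem_nhdsWithin] with s hs
  have ms := hv.1 s hs
  have mt := hv.1 t ht
  have h2 : (eLpNorm (v s - v t) q volume).toReal = lpNorm (v s - v t) q volume :=
    toReal_eLpNorm (ms.1.sub mt.1)
  rw [h2, Real.norm_eq_abs, abs_sub_le_iff]
  have a1 := lpNorm_add_le (ms.sub mt) hq (g := v t)
  have a2 := lpNorm_add_le (mt.sub ms) hq (g := v s)
  rw [sub_add_cancel] at a1 a2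
  rw [lpNorm_sub_comm] at a2
  constructor <;> linarith

end TimeContinuity

/-! ### From weak to classical derivatives in time -/

section WeakTimeDerivative

variable {F : Type*} [NormedAddCommGroup F] [NormedSpace ℝ F] [CompleteSpace F]

/-- A continuous function on an interval whose weak derivative vanishes is constant. -/
lemma eqOn_const_of_integral_deriv_smul {c : ℝ → F} {α β : ℝ} (hαβ : α < β) (hc : Continuous c)
    (h : ∀ θ : ℝ → ℝ, ContDiff ℝ ((⊤ : ℕ∞) : WithTop ℕ∞) θ → HasCompactSupport θ →
      tsupport θ ⊆ Ioo α β → ∫ t, deriv θ t • c t = 0) :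
    ∃ c₀, ∀ t ∈ Ioo α β, c t = c₀ := by
  set r := (β - α) / 4 with hr
  have hr0 : 0 < r := by rw [hr]; linarith
  let b : ContDiffBump ((α + β) / 2 : ℝ) := ⟨r / 2, r, by linarith, by linarith⟩
  set ρ := b.normed volume with hρ
  have hρs : ContDiff ℝ ((⊤ : ℕ∞) : WithTop ℕ∞) ρ := b.contDiff_normed
  have hρc : HasCompactSupport ρ := b.hasCompactSupport_normed
  have hρt : tsupport ρ ⊆ Ioo α β := by
    rw [hρ, b.tsupport_normed_eq, Real.closedBall_eq_Icc]
    intro x hx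
    simp only [b] at hx
    constructor <;> linarith [hx.1, hx.2]
  have hρ1 : ∫ t, ρ t = 1 := b.integral_normed
  set c₀ := ∫ t, ρ t • c t with hc₀
  have key : ∀ᵐ t, t ∈ Ioo α β → c t - c₀ = 0 := by
    refine isOpen_Ioo.ae_eq_zero_of_integral_contDiff_smul_eq_zero
      ((hc.sub continuous_const).locallyIntegrable.locallyIntegrableOn _) fun g hg hgc hgt => ?_
    -- `g - (∫ g) ρ` is the derivative of a test function
    set J := ∫ t, g t with hJ
    set e : ℝ → ℝ := fun t => g t - J * ρ t with he
    have hes : ContDiff ℝ ((⊤ : ℕ∞) : WithTop ℕ∞) e := hg.sub (contDiff_const.mul hρs)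
    have hgi : Integrable g := hg.continuous.integrable_of_hasCompactSupport hgc
    have hρi : Integrable ρ := hρs.continuous.integrable_of_hasCompactSupport hρc
    have hei : Integrable e := hgi.sub (hρi.const_mul J)
    have he0 : ∫ t, e t = 0 := by
      rw [he, integral_sub hgi (hρi.const_mul J), integral_const_mul, hρ1, mul_one, sub_self]
    obtain ⟨α', β', h1, h2, h3⟩ : ∃ α' β', α < α' ∧ β' < β ∧ ∀ t, t ∉ Icc α' β' → e t = 0 := by
      have hK : IsCompact (tsupport g ∪ tsupport ρ) := hgc.isCompact.union hρc.isCompact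
      have hKs : tsupport g ∪ tsupport ρ ⊆ Ioo α β := union_subset hgt hρt
      have hne : (tsupport g ∪ tsupport ρ).Nonempty := by
        by_contra hempty
        rw [not_nonempty_iff_eq_empty, union_empty_iff] at hempty
        have : ρ = 0 := by
          rw [← tsupport_eq_empty_iff]; exact hempty.2
        rw [this] at hρ1
        simp at hρ1
      refine ⟨sInf (tsupport g ∪ tsupport ρ), sSup (tsupport g ∪ tsupport ρ),
        (hKs (hK.sInf_mem hne)).1, (hKs (hK.sSup_mem hne)).2, fun t ht => ?_⟩
      have ht' : t ∉ tsupport g ∪ tsupport ρ := fun hmem =>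
        ht ⟨csInf_le hK.bddBelow hmem, le_csSup hK.bddAbove hmem⟩
      rw [mem_union, not_or] at ht'
      rw [he]
      simp only
      rw [image_eq_zero_of_notMem_tsupport ht'.1, image_eq_zero_of_notMem_tsupport ht'.2]
      simp
    set θ : ℝ → ℝ := fun t => ∫ s in α..t, e s with hθ
    have hθd : ∀ t, HasDerivAt θ (e t) t := fun t =>
      (hes.continuous.integral_hasStrictDerivAt α t).hasDerivAt
    have hθ' : deriv θ = e := funext fun t => (hθd t).deriv
    have hθs : ContDiff ℝ ((⊤ : ℕ∞) : WithTop ℕ∞) θ := by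
      rw [contDiff_infty_iff_deriv, hθ']
      exact ⟨fun t => (hθd t).differentiableAt, hes⟩
    have hθ0 : ∀ t, t ∉ Icc α' β' → θ t = 0 := by
      intro t ht
      rcases lt_or_ge t α' with hlt | hge
      · refine (intervalIntegral.integral_congr (g := fun _ => (0 : ℝ)) fun s hs => ?_).trans
          (by simp)
        exact h3 s fun hh => absurd (hs.2.trans_lt (max_lt h1 hlt)) (not_lt.2 hh.1)
      · have hgt : β' < t := by
          by_contra hcon
          exact ht ⟨hge, not_lt.1 hcon⟩
        -- Beyond the support the primitive equals the total integral of `e`, which is zero by the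
        -- choice of `J`.
        change ∫ s in α..t, e s = 0
        rw [← he0, intervalIntegral.integral_of_le (h1.le.trans hge)]
        refine setIntegral_eq_integral_of_forall_compl_eq_zero fun s hs => h3 s fun hh => hs ?_
        exact ⟨h1.trans_le hh.1, hh.2.trans hgt.le⟩
    have hθc : HasCompactSupport θ := HasCompactSupport.intro isCompact_Icc hθ0
    have hθt : tsupport θ ⊆ Ioo α β := by
      refine (closure_minimal (fun t ht => ?_) isClosed_Icc).trans
        (Icc_subset_Ioo h1 h2)
      by_contra hcon
      exact ht (hθ0 t hcon)
    have h4 := h θ hθs hθc hθt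
    rw [hθ'] at h4
    have hgci : Integrable fun t => g t • c t :=
      (hg.continuous.smul hc).integrable_of_hasCompactSupport hgc.smul_right
    have hρci : Integrable fun t => ρ t • c t :=
      (hρs.continuous.smul hc).integrable_of_hasCompactSupport hρc.smul_right
    simp only [he, sub_smul, mul_smul] at h4
    rw [integral_sub (g := fun t => J • ρ t • c t) hgci (hρci.smul J), integral_smul] at h4
    simp only [smul_sub]
    rw [integral_sub (g := fun t => g t • c₀) hgci (hgi.smul_const _), integral_smul_const]
    exact h4
  refine ⟨c₀, fun t ht => ?_⟩
  -- A set of full measure is dense, and continuity extends the equality from it to the whole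
  -- interval.
  have hd : Dense {t : ℝ | t ∈ Ioo α β → c t - c₀ = 0} := Measure.dense_of_ae key
  by_contra hne
  have ho : IsOpen (Ioo α β ∩ {t | c t - c₀ ≠ 0}) :=
    isOpen_Ioo.inter (isOpen_ne_fun (hc.sub continuous_const) continuous_const)
  obtain ⟨s, hs, hs'⟩ := hd.inter_open_nonempty _ ho ⟨t, ht, sub_ne_zero.2 hne⟩
  exact hs.2 (hs' hs.1)

/-- A weak derivative that is continuous is a classical derivative. -/
lemma hasDerivAt_of_integral_deriv_smul {a A : ℝ → F} {U : Set ℝ} (hU : IsOpen U)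
    (ha : ContinuousOn a U) (hA : ContinuousOn A U)
    (h : ∀ θ : ℝ → ℝ, ContDiff ℝ ((⊤ : ℕ∞) : WithTop ℕ∞) θ → HasCompactSupport θ →
      tsupport θ ⊆ U → ∫ t, (deriv θ t • a t + θ t • A t) = 0) {t₀ : ℝ} (ht₀ : t₀ ∈ U) :
    HasDerivAt a (A t₀) t₀ := by
  obtain ⟨r, hr, hrU⟩ := Metric.nhds_basis_closedBall.mem_iff.1 (hU.mem_nhds ht₀)
  rw [Real.closedBall_eq_Icc] at hrU
  have hle : t₀ - r ≤ t₀ + r := by linarith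
  -- Constant extension outside a compact interval gives globally continuous functions; test
  -- functions supported inside do not see the change.
  set a' := IccExtend hle (fun t => a t) with ha'
  set A' := IccExtend hle (fun t => A t) with hA'
  have hac : Continuous a' := (ha.mono hrU).domRestrict.Icc_extend'
  have hAc : Continuous A' := (hA.mono hrU).domRestrict.Icc_extend'
  have hae : ∀ t ∈ Icc (t₀ - r) (t₀ + r), a' t = a t := fun t ht => IccExtend_of_mem hle _ ht
  have hAe : ∀ t ∈ Icc (t₀ - r) (t₀ + r), A' t = A t := fun t ht => IccExtend_of_mem hle _ ht
  -- Subtracting a primitive of `A` leaves a function with vanishing weak derivative, hence a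
  -- constant.
  set B : ℝ → F := fun t => ∫ s in t₀..t, A' s with hB
  have hBd : ∀ t, HasDerivAt B (A' t) t := fun t =>
    (hAc.integral_hasStrictDerivAt t₀ t).hasDerivAt
  have hBc : Continuous B := continuous_iff_continuousAt.2 fun t => (hBd t).continuousAt
  obtain ⟨c₀, hc₀⟩ := eqOn_const_of_integral_deriv_smul (c := fun t => a' t - B t)
    (α := t₀ - r) (β := t₀ + r) (by linarith) (hac.sub hBc) fun θ hθ hθc hθt => by
      have hθ1 : ∀ t, HasDerivAt θ (deriv θ t) t := fun t =>
        (hθ.differentiable (by simp) t).hasDerivAt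
      have hθ'c : Continuous (deriv θ) := hθ.continuous_deriv (by simp)
      have e1 := h θ hθ hθc (hθt.trans (Ioo_subset_Icc_self.trans hrU))
      have e2 : ∀ t, deriv θ t • a t + θ t • A t = deriv θ t • a' t + θ t • A' t := by
        intro t
        by_cases ht : t ∈ Icc (t₀ - r) (t₀ + r)
        · rw [hae t ht, hAe t ht]
        · have h1 : t ∉ tsupport θ := fun hh => ht (Ioo_subset_Icc_self (hθt hh))
          have h2 : deriv θ t = 0 := by
            by_contra hne
            exact h1 (support_deriv_subset hne)
          rw [image_eq_zero_of_notMem_tsupport h1, h2]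
          simp
      simp only [e2] at e1
      have i1 : Integrable fun t => deriv θ t • a' t :=
        (hθ'c.smul hac).integrable_of_hasCompactSupport hθc.deriv.smul_right
      have i2 : Integrable fun t => θ t • A' t :=
        (hθ.continuous.smul hAc).integrable_of_hasCompactSupport hθc.smul_right
      have i3 : Integrable fun t => deriv θ t • B t :=
        (hθ'c.smul hBc).integrable_of_hasCompactSupport hθc.deriv.smul_right
      have i4 : Integrable fun t => θ t • B t :=
        (hθ.continuous.smul hBc).integrable_of_hasCompactSupport hθc.smul_right
      have e3 : ∫ t, (θ t • A' t + deriv θ t • B t) = 0 :=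
        integral_eq_zero_of_hasDerivAt_of_integrable (fun t => (hθ1 t).smul (hBd t)) (i2.add i3) i4
      rw [integral_add i1 i2] at e1
      rw [integral_add i2 i3] at e3
      simp only [smul_sub]
      rw [integral_sub i1 i3]
      rw [← e1] at e3
      have e4 := e3
      rw [add_comm] at e4
      exact sub_eq_zero.2 (add_right_cancel e4).symm
  have h1 : HasDerivAt (fun t => c₀ + B t) (A t₀) t₀ := by
    rw [← hAe t₀ ⟨by linarith, by linarith⟩]
    exact (hBd t₀).const_add c₀
  refine h1.congr_of_eventuallyEq ?_
  filter_upwards [Ioo_mem_nhds (show t₀ - r < t₀ by linarith) (show t₀ < t₀ + r by linarith)]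
    with t ht
  rw [← hc₀ t ht, hae t (Ioo_subset_Icc_self ht), sub_add_cancel]

end WeakTimeDerivative

/-! ### Partial derivatives and Laplacian of test functions -/

section TestFunctions

variable {m : ℕ} {k : Space m → ℝ}

/-- The partial derivative of a scalar function. -/
def dpart (k : Space m → ℝ) (i : Fin m) (x : Space m) : ℝ := fderiv ℝ k x (basisVec i)

lemma contDiff_dpart (hk : ContDiff ℝ ((⊤ : ℕ∞) : WithTop ℕ∞) k) (i : Fin m) :
    ContDiff ℝ ((⊤ : ℕ∞) : WithTop ℕ∞) (dpart k i) :=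
  ContDiff.clm_apply (hk.fderiv_right (m := ((⊤ : ℕ∞) : WithTop ℕ∞)) (by simp)) contDiff_const

lemma hasCompactSupport_dpart (hc : HasCompactSupport k) (i : Fin m) :
    HasCompactSupport (dpart k i) := HasCompactSupport.fderiv_apply_const hc _

lemma dpart_reflect (hk : ContDiff ℝ ((⊤ : ℕ∞) : WithTop ℕ∞) k) (x : Space m) (i : Fin m) :
    dpart (fun y => k (x - y)) i = fun y => -dpart k i (x - y) := by
  ext1 y
  exact fderiv_sub_left (hk.differentiable (by simp)) x y _

lemma dpart_neg (i : Fin m) : dpart (fun y => -k y) i = fun y => -dpart k i y := by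
  ext1 y
  unfold dpart
  rw [fderiv_fun_neg]
  rfl

/-- The Laplacian as a sum of pure second derivatives. -/
def lapl (k : Space m → ℝ) (x : Space m) : ℝ := ∑ i, dpart (dpart k i) i x

lemma laplacian_eq_lapl (hk : ContDiff ℝ ((⊤ : ℕ∞) : WithTop ℕ∞) k) (x : Space m) :
    Laplacian.laplacian k x = lapl k x := by
  rw [InnerProductSpace.laplacian_eq_iteratedFDeriv_orthonormalBasis k
    (EuclideanSpace.basisFun (Fin m) ℝ)]
  unfold lapl dpart
  refine Finset.sum_congr rfl fun i _ => ?_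
  rw [iteratedFDeriv_two_apply]
  have h1 : DifferentiableAt ℝ (fderiv ℝ k) x :=
    (hk.fderiv_right (m := ((⊤ : ℕ∞) : WithTop ℕ∞)) (by simp)).differentiable (by simp) x
  rw [fderiv_clm_apply h1 (by fun_prop)]
  simp

lemma continuous_lapl (hk : ContDiff ℝ ((⊤ : ℕ∞) : WithTop ℕ∞) k) : Continuous (lapl k) :=
  continuous_finsetSum _ fun i _ => (contDiff_dpart (contDiff_dpart hk i) i).continuous

lemma hasCompactSupport_lapl (hc : HasCompactSupport k) : HasCompactSupport (lapl k) := by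
  refine HasCompactSupport.intro hc.isCompact fun x hx => Finset.sum_eq_zero fun i _ => ?_
  have h1 : tsupport (dpart (dpart k i) i) ⊆ tsupport k :=
    (tsupport_fderiv_apply_subset ℝ _).trans (tsupport_fderiv_apply_subset ℝ _)
  exact image_eq_zero_of_notMem_tsupport fun h => hx (h1 h)

lemma lapl_reflect (hk : ContDiff ℝ ((⊤ : ℕ∞) : WithTop ℕ∞) k) (x : Space m) :
    lapl (fun y => k (x - y)) = fun y => lapl k (x - y) := by
  ext1 y
  unfold lapl
  refine Finset.sum_congr rfl fun i _ => ?_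
  rw [dpart_reflect hk, dpart_neg, dpart_reflect (contDiff_dpart hk i)]
  simp

/-- The antisymmetric flux `v_i f - f_i v`, whose divergence is the nonlinear term. -/
def fluxField (i : Fin m) (v f : Space m → Space m) : Space m → Space m :=
  tensorField i v f - tensorField i f v

end TestFunctions

/-! ### Time derivatives prescribed by the equation -/

section Rates

variable {m : ℕ} {p ν : ℝ} {f v : Space m → Space m} {Dv Df : Fin m → Space m → Space m}
  {k ψ : Space m → ℝ}

/-- The time derivative of `∫ ψ f` prescribed by the vorticity equation. -/
def testRate (ν : ℝ) (ψ : Space m → ℝ) (v f : Space m → Space m) : Space m :=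
  ν • (∫ y, lapl ψ y • f y) + ∑ i, ∫ y, dpart ψ i y • fluxField i v f y

/-- The time derivative of the mollified vorticity. -/
def mollRate (n : ℕ) (ν : ℝ) (v f : Space m → Space m) (x : Space m) : Space m :=
  ν • kconv (lapl (kernel m n)) f x - ∑ i, kconv (dpart (kernel m n) i) (fluxField i v f) x

lemma testRate_kernel (n : ℕ) (x : Space m) :
    testRate ν (fun y => kernel m n (x - y)) v f = mollRate n ν v f x := by
  unfold testRate mollRate
  rw [lapl_reflect (kernel_contDiff n), sub_eq_add_neg, ← Finset.sum_neg_distrib]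
  congr 1
  refine Finset.sum_congr rfl fun i _ => ?_
  rw [dpart_reflect (kernel_contDiff n)]
  unfold kconv
  rw [← integral_neg]
  simp

namespace Slice

lemma memLp_tensorField (hv : MemLp v (m : ℝ≥0∞) volume) (hf : MemLp f (m : ℝ≥0∞) volume)
    (i : Fin m) : MemLp (tensorField i v f) (m / 2 : ℝ≥0∞) volume :=
  ⟨aestronglyMeasurable_tensorField i hv.1 hf.1,
    (eLpNorm_tensorField_le i hv.1 hf.1).trans_lt (ENNReal.mul_lt_top hv.2 hf.2)⟩

lemma loc_fluxField (h : Slice p v f Dv Df) (i : Fin m) :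
    LocallyIntegrable (fluxField i v f) volume :=
  ((memLp_tensorField h.memLp_v h.memLp_f i).sub
    (memLp_tensorField h.memLp_f h.memLp_v i)).locallyIntegrable (one_le_half h.three_le)

/-- Both fields being divergence free, the nonlinear term is the divergence of `v_i f - f_i v`. In
this form it involves no gradient of `v` or `f`, so it is defined and continuous at every time, not
just almost every one. -/
lemma integral_smul_nonlin_eq_flux (h : Slice p v f Dv Df) (h' : Slice p f v Df Dv)
    (hψ : ContDiff ℝ ((⊤ : ℕ∞) : WithTop ℕ∞) ψ) (hc : HasCompactSupport ψ) :
    ∫ x, ψ x • nonlin v f Dv Df x = -∑ i, ∫ y, dpart ψ i y • fluxField i v f y := by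
  rw [(h.integral_smul_nonlin h' (hψ.of_le (by exact_mod_cast le_top)) hc).2.2,
    ← integral_finsetSum _ fun i _ => integrable_smul_of_compact (contDiff_dpart hψ i).continuous
      (hasCompactSupport_dpart hc i) (h.loc_fluxField i)]
  congr 2
  ext1 x
  rw [clm_eq_sum, clm_eq_sum, Finset.sum_smul, Finset.sum_smul, ← Finset.sum_sub_distrib]
  refine Finset.sum_congr rfl fun i _ => ?_
  simp only [fluxField, Pi.sub_apply, tensorField, dpart, smul_sub, smul_smul, smul_eq_mul]
  rw [mul_comm, mul_comm (f x i)]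

/-- The numbers `c` and `d` stand for `θ'(t)` and `θ(t)` in a product test function `θ(t) ψ(x)`. -/
lemma integral_eq_testRate (h : Slice p v f Dv Df) (h' : Slice p f v Df Dv)
    (hψ : ContDiff ℝ ((⊤ : ℕ∞) : WithTop ℕ∞) ψ) (hc : HasCompactSupport ψ) (c d : ℝ) :
    ∫ x, ((c * ψ x + ν * (d * lapl ψ x)) • f x - (d * ψ x) • nonlin v f Dv Df x) =
      c • (∫ x, ψ x • f x) + d • testRate ν ψ v f := by
  have i1 := integrable_smul_of_compact hψ.continuous hc h.loc_f
  have i2 := integrable_smul_of_compact (continuous_lapl hψ) (hasCompactSupport_lapl hc) h.loc_f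
  have i3 := (h.integral_smul_nonlin h' (hψ.of_le (by exact_mod_cast le_top)) hc).1
  have e : ∀ x, (c * ψ x + ν * (d * lapl ψ x)) • f x - (d * ψ x) • nonlin v f Dv Df x =
      (c • (ψ x • f x) + (d * ν) • (lapl ψ x • f x)) - d • (ψ x • nonlin v f Dv Df x) := by
    intro x
    simp only [smul_smul, add_smul]
    congr 3
    ring
  simp only [e]
  rw [integral_sub (f := fun x => c • (ψ x • f x) + (d * ν) • (lapl ψ x • f x))
    (g := fun x => d • (ψ x • nonlin v f Dv Df x)) ((i1.smul c).add (i2.smul (d * ν))) (i3.smul d),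
    integral_add (f := fun x => c • (ψ x • f x)) (g := fun x => (d * ν) • (lapl ψ x • f x))
    (i1.smul c) (i2.smul (d * ν)), integral_smul, integral_smul, integral_smul,
    h.integral_smul_nonlin_eq_flux h' hψ hc, testRate, smul_add, smul_neg, sub_neg_eq_add, mul_smul,
    add_assoc]

/-- At times where weak gradients exist, the convolution formula for the rate becomes viscosity
minus the mollified nonlinear term, the form suited to energy estimates. -/
lemma mollRate_eq (h : Slice p v f Dv Df) (h' : Slice p f v Df Dv) (n : ℕ) (x : Space m) :
    mollRate n ν v f x = ν • (∑ i, fderiv ℝ (mollGrad n Df i) x (basisVec i)) -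
      moll n (nonlin v f Dv Df) x := by
  have hk : ContDiff ℝ ((⊤ : ℕ∞) : WithTop ℕ∞) (kernel m n) := kernel_contDiff n
  have hkc : HasCompactSupport (kernel m n) := kernel_hasCompactSupport n
  have hd : ∀ i, kconv (dpart (kernel m n) i) f = mollGrad n Df i := by
    intro i
    ext1 z
    have h1 := fderiv_conv (hk.of_le (by exact_mod_cast le_top)) hkc h.loc_f z (basisVec i)
    have h2 := fderiv_moll (h.weak_f i) n z
    rw [show moll n f = fun z => ∫ y, kernel m n (z - y) • f y from
      funext fun z => moll_apply n f z, h1] at h2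
    exact h2
  unfold mollRate
  congr 1
  · congr 1
    have h1 : kconv (lapl (kernel m n)) f x = ∑ i, kconv (dpart (dpart (kernel m n) i) i) f x := by
      unfold kconv lapl
      simp only [Finset.sum_smul]
      exact integral_finsetSum _ fun i _ => integrable_smul_of_compact
        ((contDiff_dpart (contDiff_dpart hk i) i).continuous.comp (continuous_const.sub continuous_id))
        (hasCompactSupport_reflect (hasCompactSupport_dpart (hasCompactSupport_dpart hkc i) i) x)
        h.loc_f
    rw [h1]
    refine Finset.sum_congr rfl fun i _ => ?_
    rw [← hd i]
    exact (fderiv_conv ((contDiff_dpart hk i).of_le (by exact_mod_cast le_top))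
      (hasCompactSupport_dpart hkc i) h.loc_f x (basisVec i)).symm
  · rw [moll_apply, h.integral_smul_nonlin_eq_flux h' (ψ := fun y => kernel m n (x - y))
      (hk.comp (contDiff_const.sub contDiff_id)) (hasCompactSupport_reflect hkc x),
      ← Finset.sum_neg_distrib]
    refine Finset.sum_congr rfl fun i _ => ?_
    rw [dpart_reflect hk]
    unfold kconv
    rw [← integral_neg]
    simp

end Slice

end Rates

/-! ### Solutions in time and their mollifications -/

section Evolutions

variable {m : ℕ} {p ν : ℝ} {T : EReal} {u ω : ℝ → Space m → Space m}
  {Du Dω : ℝ → Fin m → Space m → Space m}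

/-- The standing hypotheses on a solution of the vorticity equation. -/
structure Evolution (p ν : ℝ) (T : EReal) (u ω : ℝ → Space m → Space m)
    (Du Dω : ℝ → Fin m → Space m → Space m) : Prop where
  two_le : 2 ≤ p
  three_le : 3 ≤ m
  visc_pos : 0 < ν
  velocity : ContinuousInLp (closedTimes T) (m : ℝ≥0∞) u
  velocity' : ContinuousInLp (closedTimes T) (ENNReal.ofReal p) u
  grad_velocity : HasGradientL1LocLp p T u Du
  vorticity : ContinuousInLp (closedTimes T) (m : ℝ≥0∞) ω
  vorticity' : ContinuousInLp (closedTimes T) (ENNReal.ofReal p) ω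
  grad_vorticity : HasGradientL1LocLp p T ω Dω
  solves : SolvesVorticityEquation ν T u ω Du Dω

lemma openTimes_subset : openTimes T ⊆ closedTimes T := fun _ ht => ⟨ht.1.le, ht.2.le⟩

lemma isOpen_openTimes : IsOpen (openTimes T) :=
  (isOpen_lt continuous_const continuous_id).inter
    (isOpen_lt continuous_coe_real_ereal continuous_const)

namespace Evolution

lemma ae_slice (h : Evolution p ν T u ω Du Dω) : ∀ᵐ t : ℝ, t ∈ openTimes T →
    Slice p (u t) (ω t) (Du t) (Dω t) ∧ Slice p (ω t) (u t) (Dω t) (Du t) := by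
  filter_upwards [h.grad_velocity.weakPartial, h.grad_velocity.memLp, h.grad_vorticity.weakPartial,
    h.grad_vorticity.memLp, h.solves.div_velocity, h.solves.div_vorticity] with t h1 h2 h3 h4 h5 h6 ht
  have hc := openTimes_subset ht
  exact ⟨⟨h.two_le, h.three_le, h.velocity.1 t hc, h.vorticity.1 t hc, h.vorticity'.1 t hc, h2 ht,
    h4 ht, h1 ht, h3 ht, h5 ht, h6 ht⟩, ⟨h.two_le, h.three_le, h.vorticity.1 t hc,
    h.velocity.1 t hc, h.velocity'.1 t hc, h4 ht, h2 ht, h3 ht, h1 ht, h6 ht, h5 ht⟩⟩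

lemma one_le_m (h : Evolution p ν T u ω Du Dω) : (1 : ℝ≥0∞) ≤ m := by
  have : 1 ≤ m := by have := h.three_le; omega
  exact_mod_cast this

lemma flux (h : Evolution p ν T u ω Du Dω) (i : Fin m) :
    ContinuousInLp (closedTimes T) (m / 2 : ℝ≥0∞) fun t => fluxField i (u t) (ω t) :=
  (h.velocity.tensorField h.three_le h.vorticity i).sub (one_le_half h.three_le)
    (h.vorticity.tensorField h.three_le h.velocity i)

lemma continuousOn_testRate (h : Evolution p ν T u ω Du Dω) {ψ : Space m → ℝ}
    (hψ : ContDiff ℝ ((⊤ : ℕ∞) : WithTop ℕ∞) ψ) (hc : HasCompactSupport ψ) :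
    ContinuousOn (fun t => testRate ν ψ (u t) (ω t)) (closedTimes T) :=
  ((h.vorticity.continuousOn_integral_smul h.one_le_m (continuous_lapl hψ)
    (hasCompactSupport_lapl hc)).const_smul ν).add (continuousOn_finsetSum _ fun i _ =>
    (h.flux i).continuousOn_integral_smul (one_le_half h.three_le) (contDiff_dpart hψ i).continuous
      (hasCompactSupport_dpart hc i))

/-- Product test functions `θ(t) ψ(x)` show that the prescribed rate is the weak derivative in time.
The rate is continuous, so the derivative is classical at every interior time. -/
lemma hasDerivAt_test (h : Evolution p ν T u ω Du Dω) {ψ : Space m → ℝ}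
    (hψ : ContDiff ℝ ((⊤ : ℕ∞) : WithTop ℕ∞) ψ) (hc : HasCompactSupport ψ) {t : ℝ}
    (ht : t ∈ openTimes T) :
    HasDerivAt (fun t => ∫ x, ψ x • ω t x) (testRate ν ψ (u t) (ω t)) t := by
  refine hasDerivAt_of_integral_deriv_smul (A := fun t => testRate ν ψ (u t) (ω t))
    isOpen_openTimes
    ((h.vorticity.continuousOn_integral_smul h.one_le_m hψ.continuous hc).mono openTimes_subset)
    ((h.continuousOn_testRate hψ hc).mono openTimes_subset) (fun θ hθ hθc hθt => ?_) ht
  have hts : tsupport (fun z : ℝ × Space m => θ z.1 * ψ z.2) ⊆ tsupport θ ×ˢ tsupport ψ := by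
    refine closure_minimal (fun z hz => ?_) ((isClosed_tsupport θ).prod (isClosed_tsupport ψ))
    exact ⟨subset_tsupport _ (left_ne_zero_of_mul hz), subset_tsupport _ (right_ne_zero_of_mul hz)⟩
  have h1 := h.solves.equation (fun z => θ z.1 * ψ z.2)
    ((hθ.comp contDiff_fst).mul (hψ.comp contDiff_snd))
    ((hθc.isCompact.prod hc.isCompact).of_isClosed_subset (isClosed_tsupport _) hts)
    (hts.trans (prod_mono hθt (subset_univ _)))
  rw [← h1]
  refine integral_congr_ae ?_
  filter_upwards [h.ae_slice] with s hs
  have hd : deriv (fun s => θ s) s = deriv θ s := rfl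
  have e1 : ∀ x, deriv (fun s => θ s * ψ x) s = deriv θ s * ψ x := fun x =>
    deriv_mul_const (hθ.differentiable (by simp) s) _
  have e2 : ∀ x, Laplacian.laplacian (fun y => θ s * ψ y) x = θ s * lapl ψ x := by
    intro x
    have := InnerProductSpace.laplacian_smul (f := ψ) (x := x) (θ s)
      (hψ.of_le (WithTop.coe_le_coe.2 le_top)).contDiffAt
    rw [laplacian_eq_lapl hψ] at this
    exact this
  simp only [e1, e2]
  by_cases hsI : s ∈ openTimes T
  · obtain ⟨s1, s2⟩ := hs hsI
    exact (s1.integral_eq_testRate s2 hψ hc (deriv θ s) (θ s)).symm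
  · have z0 : s ∉ tsupport θ := fun hh => hsI (hθt hh)
    have z1 : θ s = 0 := image_eq_zero_of_notMem_tsupport z0
    have z2 : deriv θ s = 0 := by
      by_contra hne
      exact z0 (support_deriv_subset hne)
    simp [z1, z2]

lemma hasDerivAt_moll (h : Evolution p ν T u ω Du Dω) (n : ℕ) (x : Space m) {t : ℝ}
    (ht : t ∈ openTimes T) :
    HasDerivAt (fun t => moll n (ω t) x) (mollRate n ν (u t) (ω t) x) t := by
  have h1 := h.hasDerivAt_test (ψ := fun y => kernel m n (x - y))
    ((kernel_contDiff n).comp (contDiff_const.sub contDiff_id))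
    (hasCompactSupport_reflect (kernel_hasCompactSupport n) x) ht
  rw [testRate_kernel] at h1
  simpa only [moll_apply] using h1

lemma continuousOn_mollRate (h : Evolution p ν T u ω Du Dω) (n : ℕ) :
    ContinuousOn (fun z : ℝ × Space m => mollRate n ν (u z.1) (ω z.1) z.2)
      (closedTimes T ×ˢ univ) := by
  have hk : ContDiff ℝ ((⊤ : ℕ∞) : WithTop ℕ∞) (kernel m n) := kernel_contDiff n
  have hkc : HasCompactSupport (kernel m n) := kernel_hasCompactSupport n
  exact ((h.vorticity.continuousOn_kconv h.one_le_m (continuous_lapl hk)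
    (hasCompactSupport_lapl hkc)).const_smul ν).sub (continuousOn_finsetSum _ fun i _ =>
    (h.flux i).continuousOn_kconv (one_le_half h.three_le) (contDiff_dpart hk i).continuous
      (hasCompactSupport_dpart hkc i))

lemma continuousOn_moll (h : Evolution p ν T u ω Du Dω) (n : ℕ) :
    ContinuousOn (fun z : ℝ × Space m => moll n (ω z.1) z.2) (closedTimes T ×ˢ univ) := by
  simp only [moll_apply]
  exact h.vorticity.continuousOn_kconv h.one_le_m (kernel_continuous n)
    (kernel_hasCompactSupport n)

lemma continuousOn_classGrad_moll (h : Evolution p ν T u ω Du Dω) (n : ℕ) (i : Fin m) :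
    ContinuousOn (fun z : ℝ × Space m => classGrad (moll n (ω z.1)) i z.2)
      (closedTimes T ×ˢ univ) := by
  have hk : ContDiff ℝ ((⊤ : ℕ∞) : WithTop ℕ∞) (kernel m n) := kernel_contDiff n
  refine (h.vorticity.continuousOn_kconv h.one_le_m (contDiff_dpart hk i).continuous
    (hasCompactSupport_dpart (kernel_hasCompactSupport n) i)).congr fun z hz => ?_
  have h1 := fderiv_conv (hk.of_le (by exact_mod_cast le_top)) (kernel_hasCompactSupport n)
    ((h.vorticity.1 _ hz.1).locallyIntegrable h.one_le_m) z.2 (basisVec i)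
  unfold classGrad
  rw [show moll n (ω z.1) = fun x => ∫ y, kernel m n (x - y) • ω z.1 y from
      funext fun x => moll_apply n (ω z.1) x, h1]
  rfl

end Evolution

end Evolutions

/-! ### Integrals depending on time -/

section ParametricIntegrals

variable {m : ℕ} {c : Space m → ℝ} {S : Set ℝ} {G G' : ℝ → Space m → ℝ}

lemma continuousOn_integral_mul (hc : Continuous c) (hcs : HasCompactSupport c)
    (hG : ContinuousOn (fun z : ℝ × Space m => G z.1 z.2) (S ×ˢ univ)) :
    ContinuousOn (fun t => ∫ x, c x * G t x) S := by
  refine continuousOn_integral_of_compact_support (f := fun t x => c x * G t x) (k := tsupport c)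
    hcs.isCompact ?_ fun t x _ hx => by rw [image_eq_zero_of_notMem_tsupport hx, zero_mul]
  exact ((hc.comp continuous_snd).continuousOn).mul hG

lemma continuous_slice_of_continuousOn
    (hG : ContinuousOn (fun z : ℝ × Space m => G z.1 z.2) (S ×ˢ univ)) {t : ℝ} (ht : t ∈ S) :
    Continuous (G t) := by
  have h2 : Continuous fun x : Space m => ((t, x) : ℝ × Space m) := by fun_prop
  exact hG.comp_continuous h2 fun x => ⟨ht, mem_univ _⟩

lemma hasDerivAt_integral_mul (hc : Continuous c) (hcs : HasCompactSupport c) (hS : IsOpen S)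
    (hG : ContinuousOn (fun z : ℝ × Space m => G z.1 z.2) (S ×ˢ univ))
    (hG' : ContinuousOn (fun z : ℝ × Space m => G' z.1 z.2) (S ×ˢ univ))
    (hd : ∀ t ∈ S, ∀ x, HasDerivAt (fun s => G s x) (G' t x) t) {t : ℝ} (ht : t ∈ S) :
    HasDerivAt (fun s => ∫ x, c x * G s x) (∫ x, c x * G' t x) t := by
  obtain ⟨r, hr, hrS⟩ := Metric.nhds_basis_closedBall.mem_iff.1 (hS.mem_nhds ht)
  have hK : IsCompact (Metric.closedBall t r ×ˢ tsupport c) :=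
    (isCompact_closedBall t r).prod hcs.isCompact
  obtain ⟨M, hM⟩ := hK.exists_bound_of_continuousOn (hG'.mono (prod_mono hrS (subset_univ _)))
  refine (hasDerivAt_integral_of_dominated_loc_of_deriv_le (F := fun s x => c x * G s x)
    (F' := fun s x => c x * G' s x) (bound := fun x => |c x| * M) (Metric.closedBall_mem_nhds t hr)
    ?_ ?_ ?_ ?_ ?_ ?_).2
  · filter_upwards [hS.mem_nhds ht] with s hs
    exact (hc.mul (continuous_slice_of_continuousOn hG hs)).aestronglyMeasurable
  · exact (hc.mul (continuous_slice_of_continuousOn hG ht)).integrable_of_hasCompactSupport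
      hcs.mul_right
  · exact (hc.mul (continuous_slice_of_continuousOn hG' ht)).aestronglyMeasurable
  · refine Eventually.of_forall fun x s hs => ?_
    rw [norm_mul, Real.norm_eq_abs]
    by_cases hx : x ∈ tsupport c
    · exact mul_le_mul_of_nonneg_left (hM (s, x) ⟨hs, hx⟩) (abs_nonneg _)
    · rw [image_eq_zero_of_notMem_tsupport hx]
      simp
  · exact (hc.integrable_of_hasCompactSupport hcs).abs.mul_const M
  · exact Eventually.of_forall fun x s hs => (hd s (hrS hs) x).const_mul (c x)

end ParametricIntegrals

/-! ### The localized truncated energy -/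

section Energy

variable {m : ℕ} {a δ p ν : ℝ} {f v : Space m → Space m} {Dv Df : Fin m → Space m → Space m}
  {χ : Space m → ℝ}

/-- The localized truncated energy. -/
def energy (a δ : ℝ) (χ : Space m → ℝ) (f : Space m → Space m) : ℝ :=
  ∫ x, χ x * potential a (a + 1 / 3) δ (f x)

lemma integral_inner_fderiv {g φ : Space m → Space m} (hg : ContDiff ℝ 1 g) (hφ : ContDiff ℝ 1 φ)
    (hc : HasCompactSupport φ) (w : Space m) :
    ∫ x, (inner ℝ (φ x) (fderiv ℝ g x w) : ℝ) = -∫ x, (inner ℝ (fderiv ℝ φ x w) (g x) : ℝ) := by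
  have hφ' : Continuous fun x => fderiv ℝ φ x w := ContDiff.continuous_fderiv_const hφ w
  have hg' : Continuous fun x => fderiv ℝ g x w := ContDiff.continuous_fderiv_const hg w
  have hc' : HasCompactSupport fun x => fderiv ℝ φ x w := HasCompactSupport.fderiv_apply_const hc w
  have key : ∀ {F G : Space m → Space m}, Continuous F → Continuous G → HasCompactSupport F →
      Integrable (fun x => innerSL ℝ (F x) (G x)) volume := fun hF hG hFc =>
    (hF.inner hG).integrable_of_hasCompactSupport
      (hFc.mono fun x hx h0 => hx (by simp [h0]))
  exact integral_bilinear_fderiv_right_eq_neg_left_of_integrable (B := innerSL ℝ) (f := φ) (g := g)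
    (v := w) (key hφ' hg.continuous hc') (key hφ.continuous hg' hc) (key hφ.continuous hg.continuous hc)
    (fun x _ => hφ.differentiable (by norm_num) x) (fun x _ => hg.differentiable (by norm_num) x)

/-- The viscous term is integrated by parts: the derivative falls on the radial field, giving the
dissipation, and on the weight, giving the cross term. -/
lemma Slice.transForm_mollRate (h : Slice p v f Dv Df) (h' : Slice p f v Df Dv) (ha : 0 ≤ a)
    (hδ : 0 ≤ δ) (hχ : ContDiff ℝ 1 χ) (hc : HasCompactSupport χ) (n : ℕ) :
    transForm a δ χ (moll n f) (mollRate n ν v f) =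
      -(ν * dissipForm a δ χ (moll n f) (mollGrad n Df)) -
        ν * crossForm a δ χ (moll n f) (mollGrad n Df) -
        transForm a δ χ (moll n f) (moll n (nonlin v f Dv Df)) := by
  have hf : ContDiff ℝ 1 (moll n f) := moll_contDiff n h.loc_f
  have hD : ∀ i, ContDiff ℝ 1 (mollGrad n Df i) := fun i => moll_contDiff n (h.loc_Df i)
  have hN : Continuous (moll n (nonlin v f Dv Df)) := moll_continuous n h.loc_nonlin
  have hr : Continuous fun x => radField a (a + 1 / 3) δ (moll n f x) :=
    (continuous_radField ha hδ).comp hf.continuous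
  set φ : Space m → Space m := fun x => χ x • radField a (a + 1 / 3) δ (moll n f x) with hφ
  have hφ1 : ContDiff ℝ 1 φ := hχ.smul ((contDiff_radField ha hδ).comp hf)
  have hφc : HasCompactSupport φ := hc.smul_right
  have hDc : ∀ i, Continuous fun x => fderiv ℝ (mollGrad n Df i) x (basisVec i) := fun i =>
    ContDiff.continuous_fderiv_const (hD i) _
  have e1 : ∀ x, χ x * inner ℝ (radField a (a + 1 / 3) δ (moll n f x)) (mollRate n ν v f x) =
      ν * (∑ i, inner ℝ (φ x) (fderiv ℝ (mollGrad n Df i) x (basisVec i))) -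
      χ x * inner ℝ (radField a (a + 1 / 3) δ (moll n f x)) (moll n (nonlin v f Dv Df) x) := by
    intro x
    rw [h.mollRate_eq h', inner_sub_right, inner_smul_right, inner_sum, mul_sub, ← mul_assoc,
      mul_comm (χ x), mul_assoc, Finset.mul_sum]
    congr 3
    ext i
    rw [hφ, inner_smul_left]
    simp
  have i0 : ∀ i, Integrable (fun x => (inner ℝ (φ x)
      (fderiv ℝ (mollGrad n Df i) x (basisVec i)) : ℝ)) volume := fun i =>
    integrable_inner_of_compact hφ1.continuous hφc (hDc i).locallyIntegrable
  have i1 : Integrable (fun x => ν * (∑ i, (inner ℝ (φ x)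
      (fderiv ℝ (mollGrad n Df i) x (basisVec i)) : ℝ))) volume :=
    (integrable_finsetSum _ fun i _ => i0 i).const_mul ν
  have i2 : Integrable (fun x => χ x * (inner ℝ (radField a (a + 1 / 3) δ (moll n f x))
      (moll n (nonlin v f Dv Df) x) : ℝ)) volume :=
    (hχ.continuous.mul (hr.inner hN)).integrable_of_hasCompactSupport hc.mul_right
  have i3 : ∀ i, Integrable (fun x => fderiv ℝ χ x (basisVec i) *
      (inner ℝ (radField a (a + 1 / 3) δ (moll n f x)) (mollGrad n Df i x) : ℝ)) volume := fun i =>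
    ((ContDiff.continuous_fderiv_const hχ _).mul
      (hr.inner (hD i).continuous)).integrable_of_hasCompactSupport
      (HasCompactSupport.fderiv_apply_const hc _).mul_right
  have i4 : ∀ i, Integrable (fun x => χ x * (inner ℝ (radDeriv a (a + 1 / 3) δ (moll n f x)
      (mollGrad n Df i x)) (mollGrad n Df i x) : ℝ)) volume := fun i =>
    (hχ.continuous.mul (Continuous.inner (Continuous.clm_apply ((continuous_radDeriv ha hδ).comp
      hf.continuous) (hD i).continuous) (hD i).continuous)).integrable_of_hasCompactSupport
      hc.mul_right
  have e2 : ∀ i, ∫ x, (inner ℝ (φ x) (fderiv ℝ (mollGrad n Df i) x (basisVec i)) : ℝ) =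
      -((∫ x, fderiv ℝ χ x (basisVec i) *
        (inner ℝ (radField a (a + 1 / 3) δ (moll n f x)) (mollGrad n Df i x) : ℝ)) +
      ∫ x, χ x * (inner ℝ (radDeriv a (a + 1 / 3) δ (moll n f x)
      (mollGrad n Df i x)) (mollGrad n Df i x) : ℝ)) := by
    intro i
    rw [integral_inner_fderiv (hD i) hφ1 hφc, ← integral_add (i3 i) (i4 i)]
    congr 2
    ext1 x
    rw [hφ, fderiv_weighted_radField ha hδ hχ hf, fderiv_moll (h.weak_f i), inner_add_left,
      inner_smul_left, inner_smul_left]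
    simp [mollGrad]
  unfold transForm dissipForm crossForm
  simp only [e1]
  rw [integral_sub i1 i2, integral_const_mul, integral_finsetSum _ fun i _ => i0 i,
    integral_finsetSum _ fun i _ => i3 i]
  simp only [e2, Finset.mul_sum]
  rw [integral_finsetSum _ fun i _ => i4 i, Finset.mul_sum, ← Finset.sum_neg_distrib,
    ← Finset.sum_sub_distrib]
  congr 1
  refine Finset.sum_congr rfl fun i _ => ?_
  ring

lemma tendsto_energy_moll (hp : 2 ≤ p) (ha : 0 ≤ a) (hap : 2 * a + 2 ≤ p) (hδ : 0 ≤ δ)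
    (hf : MemLp f (ENNReal.ofReal p) volume) (hχ : Continuous χ) (hc : HasCompactSupport χ) :
    Tendsto (fun n => energy a δ χ (moll n f)) atTop (𝓝 (energy a δ χ f)) := by
  have hl : LocallyIntegrable f volume := hf.locallyIntegrable (by
    rw [← ENNReal.ofReal_one]; exact ENNReal.ofReal_le_ofReal (by linarith))
  have hV := memLp_integrable_rpow hp hf
  have hpc : Continuous (potential a (a + 1 / 3) δ : Space m → ℝ) :=
    (contDiff_potential ha hδ).continuous
  refine (tendsto_integral_of_le_weight (c := χ) hχ hc (fun n => ?_) hV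
    (fun x => by positivity) (fun n x => ?_) ?_).2
  · exact (hχ.mul (hpc.comp (moll_continuous n hl))).aestronglyMeasurable
  · rw [norm_mul, Real.norm_eq_abs, Real.norm_eq_abs, abs_of_nonneg (potential_nonneg hδ _)]
    refine mul_le_mul_of_nonneg_left ?_ (abs_nonneg _)
    have h1 := potential_le (a := a) (κ := a + 1 / 3) ha (by linarith) hδ (moll n f x)
    have h2 : ‖moll n f x‖ ^ (2 * a + 2) ≤ 1 + ‖moll n f x‖ ^ p := by
      rcases le_total ‖moll n f x‖ 1 with h3 | h3
      · have := Real.rpow_le_one (norm_nonneg _) h3 (show 0 ≤ 2 * a + 2 by linarith)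
        have : 0 ≤ ‖moll n f x‖ ^ p := by positivity
        linarith
      · have := Real.rpow_le_rpow_of_exponent_le h3 hap
        linarith
    have h3 := rpow_norm_moll_le (q := p) n (by linarith) hl hV.locallyIntegrable x
    have h4 : 0 ≤ ‖f x‖ ^ p := by positivity
    linarith
  · filter_upwards [tendsto_moll_ae hl] with x hx
    exact ((hpc.tendsto _).comp hx).const_mul _

end Energy

/-! ### Energy balance for the mollified vorticity -/

namespace Evolution

variable {m : ℕ} {a δ p ν : ℝ} {T : EReal} {u ω : ℝ → Space m → Space m}
  {Du Dω : ℝ → Fin m → Space m → Space m} {χ : Space m → ℝ}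

lemma continuousOn_transForm_mollRate (h : Evolution p ν T u ω Du Dω) (ha : 0 ≤ a) (hδ : 0 ≤ δ)
    (hχ : Continuous χ) (hc : HasCompactSupport χ) (n : ℕ) :
    ContinuousOn (fun t => transForm a δ χ (moll n (ω t)) (mollRate n ν (u t) (ω t)))
      (closedTimes T) :=
  continuousOn_integral_mul (G := fun t x => inner ℝ (radField a (a + 1 / 3) δ (moll n (ω t) x))
      (mollRate n ν (u t) (ω t) x)) hχ hc
    (((continuous_radField ha hδ).comp_continuousOn (h.continuousOn_moll n)).inner
      (h.continuousOn_mollRate n))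

lemma continuousOn_dissipForm_moll (h : Evolution p ν T u ω Du Dω) (ha : 0 ≤ a) (hδ : 0 ≤ δ)
    (hχ : Continuous χ) (hc : HasCompactSupport χ) (n : ℕ) :
    ContinuousOn (fun t => dissipForm a δ χ (moll n (ω t)) (classGrad (moll n (ω t))))
      (closedTimes T) :=
  continuousOn_integral_mul (G := fun t x => ∑ i, inner ℝ (radDeriv a (a + 1 / 3) δ
      (moll n (ω t) x) (classGrad (moll n (ω t)) i x)) (classGrad (moll n (ω t)) i x)) hχ hc
    (continuousOn_finsetSum _ fun i _ => ContinuousOn.inner (ContinuousOn.clm_apply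
      ((continuous_radDeriv ha hδ).comp_continuousOn (h.continuousOn_moll n))
      (h.continuousOn_classGrad_moll n i)) (h.continuousOn_classGrad_moll n i))

lemma hasDerivAt_energy_moll (h : Evolution p ν T u ω Du Dω) (ha : 0 ≤ a) (hδ : 0 ≤ δ)
    (hχ : Continuous χ) (hc : HasCompactSupport χ) (n : ℕ) {t : ℝ} (ht : t ∈ openTimes T) :
    HasDerivAt (fun t => energy a δ χ (moll n (ω t)))
      (transForm a δ χ (moll n (ω t)) (mollRate n ν (u t) (ω t))) t := by
  have hsub : (openTimes T ×ˢ univ : Set (ℝ × Space m)) ⊆ closedTimes T ×ˢ univ :=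
    prod_mono openTimes_subset subset_rfl
  refine hasDerivAt_integral_mul (G := fun t x => potential a (a + 1 / 3) δ (moll n (ω t) x))
    (G' := fun t x => inner ℝ (radField a (a + 1 / 3) δ (moll n (ω t) x))
      (mollRate n ν (u t) (ω t) x)) hχ hc isOpen_openTimes ?_ ?_ (fun s hs x => ?_) ht
  · exact ((contDiff_potential ha hδ).continuous.comp_continuousOn (h.continuousOn_moll n)).mono hsub
  · exact (((continuous_radField ha hδ).comp_continuousOn (h.continuousOn_moll n)).inner
      (h.continuousOn_mollRate n)).mono hsub
  · have h1 := (hasFDerivAt_potential (a := a) (κ := a + 1 / 3) ha hδ (moll n (ω s) x)).comp_hasDerivAt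
      s (h.hasDerivAt_moll n x hs)
    exact h1

/-- The energy balance at the mollified level. -/
lemma energy_moll_sub (h : Evolution p ν T u ω Du Dω) (ha : 0 ≤ a) (hδ : 0 ≤ δ)
    (hχ : Continuous χ) (hc : HasCompactSupport χ) (n : ℕ) {s t : ℝ} (hst : s ≤ t)
    (hsub : Icc s t ⊆ openTimes T) :
    energy a δ χ (moll n (ω t)) - energy a δ χ (moll n (ω s)) =
      ∫ r in s..t, transForm a δ χ (moll n (ω r)) (mollRate n ν (u r) (ω r)) := by
  refine (intervalIntegral.integral_eq_sub_of_hasDerivAt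
    (f := fun r => energy a δ χ (moll n (ω r))) (fun r hr => ?_) ?_).symm
  · rw [uIcc_of_le hst] at hr
    exact h.hasDerivAt_energy_moll ha hδ hχ hc n (hsub hr)
  · refine ContinuousOn.intervalIntegrable ?_
    rw [uIcc_of_le hst]
    exact (h.continuousOn_transForm_mollRate ha hδ hχ hc n).mono (hsub.trans openTimes_subset)

end Evolution

/-! ### Fatou's lemma for real functions -/

section Fatou

variable {α : Type*} [MeasurableSpace α] {μ : Measure α}

lemma integrable_of_tendsto_of_liminf {G : ℕ → α → ℝ} {f : α → ℝ}
    (hGf : ∀ᵐ x ∂μ, Tendsto (fun n => G n x) atTop (𝓝 (f x)))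
    (hG : ∀ n, AEStronglyMeasurable (G n) μ)
    (hG' : liminf (fun n => ∫⁻ x, ‖G n x‖ₑ ∂μ) atTop ≠ ⊤) : Integrable f μ := by
  refine ⟨aestronglyMeasurable_of_tendsto_ae _ hG hGf, lt_of_le_of_lt ?_ hG'.lt_top⟩
  refine (lintegral_congr_ae ?_).trans_le (lintegral_liminf_le' fun n => (hG n).aemeasurable.enorm)
  filter_upwards [hGf] with x hx using hx.enorm.liminf_eq.symm

/-- Fatou's lemma for nonnegative integrable functions with bounded integrals. -/
lemma integrable_of_tendsto_of_integral_le {G : ℕ → α → ℝ} {f : α → ℝ} {c : ℕ → ℝ} {L : ℝ}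
    (hG : ∀ n, Integrable (G n) μ) (h0 : ∀ n, ∀ᵐ x ∂μ, 0 ≤ G n x)
    (hGf : ∀ᵐ x ∂μ, Tendsto (fun n => G n x) atTop (𝓝 (f x)))
    (hc : Tendsto c atTop (𝓝 L)) (hle : ∀ n, ∫ x, G n x ∂μ ≤ c n) :
    Integrable f μ ∧ ∫ x, f x ∂μ ≤ L := by
  have e : ∀ n, ∫⁻ x, ‖G n x‖ₑ ∂μ = ENNReal.ofReal (∫ x, G n x ∂μ) := by
    intro n
    rw [ofReal_integral_eq_lintegral_ofReal (hG n) (h0 n)]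
    refine lintegral_congr_ae ?_
    filter_upwards [h0 n] with x hx
    rw [Real.enorm_eq_ofReal hx]
  have hlim : Tendsto (fun n => ENNReal.ofReal (c n)) atTop (𝓝 (ENNReal.ofReal L)) :=
    ENNReal.tendsto_ofReal hc
  have hle' : liminf (fun n => ∫⁻ x, ‖G n x‖ₑ ∂μ) atTop ≤ ENNReal.ofReal L := by
    rw [← hlim.liminf_eq]
    refine liminf_le_liminf (Eventually.of_forall fun n => ?_)
    rw [e]
    exact ENNReal.ofReal_le_ofReal (hle n)
  have hi : Integrable f μ := integrable_of_tendsto_of_liminf hGf (fun n => (hG n).1)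
    (hle'.trans_lt ENNReal.ofReal_lt_top).ne
  refine ⟨hi, ?_⟩
  have hf0 : ∀ᵐ x ∂μ, 0 ≤ f x := by
    filter_upwards [hGf, ae_all_iff.2 h0] with x hx hx0
    exact ge_of_tendsto' hx hx0
  have h1 : ∫⁻ x, ‖f x‖ₑ ∂μ ≤ liminf (fun n => ∫⁻ x, ‖G n x‖ₑ ∂μ) atTop := by
    refine (lintegral_congr_ae ?_).trans_le (lintegral_liminf_le' fun n =>
      (hG n).1.aemeasurable.enorm)
    filter_upwards [hGf] with x hx using hx.enorm.liminf_eq.symm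
  have h2 : ENNReal.ofReal (∫ x, f x ∂μ) ≤ ENNReal.ofReal L := by
    rw [ofReal_integral_eq_lintegral_ofReal hi hf0]
    refine le_trans (le_of_eq (lintegral_congr_ae ?_)) (h1.trans hle')
    filter_upwards [hf0] with x hx
    rw [Real.enorm_eq_ofReal hx]
  have hL : 0 ≤ L := ge_of_tendsto' hc fun n =>
    (integral_nonneg_of_ae (h0 n)).trans (hle n)
  exact (ENNReal.ofReal_le_ofReal_iff hL).1 h2

end Fatou

/-! ### Norms as integrals and the integral of the majorant -/

section Norms

variable {m : ℕ} {p Λ : ℝ} {f v : Space m → Space m} {Dv Df : Fin m → Space m → Space m}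

lemma lpNorm_rpow_eq (hp : 2 ≤ p) {g : Space m → Space m}
    (hg : MemLp g (ENNReal.ofReal p) volume) :
    lpNorm g (ENNReal.ofReal p) volume ^ p = ∫ x, ‖g x‖ ^ p := by
  rw [lpNorm_eq_integral_norm_rpow_toReal (by simp; linarith) ENNReal.ofReal_ne_top hg.1,
    ENNReal.toReal_ofReal (by linarith), ← Real.rpow_mul (integral_nonneg fun x => by positivity),
    inv_mul_cancel₀ (by linarith), Real.rpow_one]

lemma lpNorm_pow_eq (hm : 3 ≤ m) {g : Space m → Space m} (hg : MemLp g (m : ℝ≥0∞) volume) :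
    lpNorm g (m : ℝ≥0∞) volume ^ m = ∫ x, ‖g x‖ ^ m := by
  have hm0 : (m : ℝ) ≠ 0 := by positivity
  rw [lpNorm_eq_integral_norm_rpow_toReal (by simp; omega) (by simp) hg.1, ← Real.rpow_natCast,
    ENNReal.toReal_natCast, ← Real.rpow_mul (integral_nonneg fun x => by positivity),
    inv_mul_cancel₀ hm0, Real.rpow_one]
  simp

/-- Division by `Λ` makes each of the `2m` gradient contributions at most one, so the integral is
controlled by norms that are continuous in time. -/
lemma Slice.integral_majorant_le (h : Slice p v f Dv Df) (hΛ : 0 < Λ)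
    (h1 : ∀ i, lpNorm (Df i) (ENNReal.ofReal p) volume ≤ Λ)
    (h2 : ∀ i, lpNorm (Dv i) (ENNReal.ofReal p) volume ≤ Λ) :
    ∫ x, majorant p Λ v f Dv Df x ≤ lpNorm v (m : ℝ≥0∞) volume ^ m +
      lpNorm f (m : ℝ≥0∞) volume ^ m + lpNorm f (ENNReal.ofReal p) volume ^ p + (m + m) := by
  have hp := h.two_le
  have key : ∀ g : Space m → Space m, MemLp g (ENNReal.ofReal p) volume →
      lpNorm g (ENNReal.ofReal p) volume ≤ Λ → ∫ x, (‖g x‖ / Λ) ^ p ≤ 1 := by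
    intro g hg hle
    have e : ∀ x, (‖g x‖ / Λ) ^ p = ‖g x‖ ^ p / Λ ^ p := fun x =>
      Real.div_rpow (norm_nonneg _) hΛ.le _
    simp only [e]
    rw [integral_div, ← lpNorm_rpow_eq hp hg, div_le_one (by positivity)]
    exact Real.rpow_le_rpow lpNorm_nonneg hle (by linarith)
  have sum_key : ∀ D : Fin m → Space m → Space m, (∀ i, MemLp (D i) (ENNReal.ofReal p) volume) →
      (∀ i, lpNorm (D i) (ENNReal.ofReal p) volume ≤ Λ) →
      ∫ x, ∑ i, (‖D i x‖ / Λ) ^ p ≤ m := by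
    intro D hD hle
    rw [integral_finsetSum _ fun i _ => h.integrable_div_rpow Λ hΛ (hD i)]
    refine (Finset.sum_le_sum fun i _ => key (D i) (hD i) (hle i)).trans (le_of_eq ?_)
    simp
  have i1 := memLp_integrable_pow h.three_le h.memLp_v
  have i2 := memLp_integrable_pow h.three_le h.memLp_f
  have i3 := memLp_integrable_rpow h.two_le h.memLp_f'
  have i4 : Integrable (fun x => ∑ i, (‖Df i x‖ / Λ) ^ p) volume :=
    integrable_finsetSum _ fun i _ => h.integrable_div_rpow Λ hΛ (h.memLp_Df i)
  have i5 : Integrable (fun x => ∑ i, (‖Dv i x‖ / Λ) ^ p) volume :=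
    integrable_finsetSum _ fun i _ => h.integrable_div_rpow Λ hΛ (h.memLp_Dv i)
  unfold majorant
  rw [integral_add (f := fun x => ‖v x‖ ^ m + ‖f x‖ ^ m + ‖f x‖ ^ p)
      (g := fun x => ∑ i, (‖Df i x‖ / Λ) ^ p + ∑ i, (‖Dv i x‖ / Λ) ^ p) ((i1.add i2).add i3)
      (i4.add i5), integral_add (f := fun x => ‖v x‖ ^ m + ‖f x‖ ^ m) (i1.add i2) i3,
    integral_add i1 i2, integral_add i4 i5, lpNorm_pow_eq h.three_le h.memLp_v,
    lpNorm_pow_eq h.three_le h.memLp_f, lpNorm_rpow_eq hp h.memLp_f']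
  have := sum_key Df h.memLp_Df h1
  have := sum_key Dv h.memLp_Dv h2
  linarith

end Norms

/-- The sum of the `Lᵖ` norms of the gradients, increased by one. -/
def gradSize {m : ℕ} (p : ℝ) (Dv Df : Fin m → Space m → Space m) : ℝ :=
  1 + (∑ i, lpNorm (Df i) (ENNReal.ofReal p) volume + ∑ i, lpNorm (Dv i) (ENNReal.ofReal p) volume)

lemma gradSize_pos {m : ℕ} (p : ℝ) (Dv Df : Fin m → Space m → Space m) : 0 < gradSize p Dv Df := by
  have h1 : ∀ D : Fin m → Space m → Space m,
      0 ≤ ∑ i, lpNorm (D i) (ENNReal.ofReal p) volume := fun D =>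
    Finset.sum_nonneg fun i _ => lpNorm_nonneg
  have := h1 Dv
  have := h1 Df
  unfold gradSize
  linarith

lemma lpNorm_le_gradSize {m : ℕ} (p : ℝ) (Dv Df : Fin m → Space m → Space m) (i : Fin m) :
    lpNorm (Df i) (ENNReal.ofReal p) volume ≤ gradSize p Dv Df ∧
    lpNorm (Dv i) (ENNReal.ofReal p) volume ≤ gradSize p Dv Df := by
  have h1 : ∀ D : Fin m → Space m → Space m,
      0 ≤ ∑ i, lpNorm (D i) (ENNReal.ofReal p) volume := fun D =>
    Finset.sum_nonneg fun i _ => lpNorm_nonneg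
  have h2 : ∀ D : Fin m → Space m → Space m, lpNorm (D i) (ENNReal.ofReal p) volume ≤
      ∑ i, lpNorm (D i) (ENNReal.ofReal p) volume := fun D =>
    Finset.single_le_sum (f := fun i => lpNorm (D i) (ENNReal.ofReal p) volume)
      (fun i _ => lpNorm_nonneg) (Finset.mem_univ i)
  have := h1 Dv
  have := h1 Df
  have := h2 Dv
  have := h2 Df
  unfold gradSize
  constructor <;> linarith

/-- The part of the energy rate not coming from the dissipation. -/
def residual {m : ℕ} (ν a δ : ℝ) (χ : Space m → ℝ) (v f : Space m → Space m)
    (Dv Df : Fin m → Space m → Space m) : ℝ :=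
  -(ν * crossForm a δ χ f Df) - transForm a δ χ f (nonlin v f Dv Df)

/-! ### The residual and its limit under the time integral -/

namespace Evolution

variable {m : ℕ} {a δ p ν : ℝ} {T : EReal} {u ω : ℝ → Space m → Space m}
  {Du Dω : ℝ → Fin m → Space m → Space m} {χ : Space m → ℝ} {s t : ℝ}

/-- The mollified residual. -/
def mollResidual (ν a δ : ℝ) (χ : Space m → ℝ) (n : ℕ) (v f : Space m → Space m) : ℝ :=
  transForm a δ χ (moll n f) (mollRate n ν v f) +
    ν * dissipForm a δ χ (moll n f) (classGrad (moll n f))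

/-- By its definition `mollResidual` uses classical gradients of mollified fields, hence is
continuous in time. This identity, valid at times with weak gradients, shows that the quadratic
gradient terms have cancelled. -/
lemma mollResidual_eq {v f : Space m → Space m} {Dv Df : Fin m → Space m → Space m}
    (h : Slice p v f Dv Df) (h' : Slice p f v Df Dv) (ha : 0 ≤ a)
    (hδ : 0 ≤ δ) (hχ : ContDiff ℝ 1 χ) (hc : HasCompactSupport χ) (n : ℕ) :
    mollResidual ν a δ χ n v f = -(ν * crossForm a δ χ (moll n f) (mollGrad n Df)) -
      transForm a δ χ (moll n f) (moll n (nonlin v f Dv Df)) := by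
  rw [mollResidual, h.transForm_mollRate h' ha hδ hχ hc, h.classGrad_moll]
  ring

lemma continuousOn_mollResidual (h : Evolution p ν T u ω Du Dω) (ha : 0 ≤ a) (hδ : 0 ≤ δ)
    (hχ : Continuous χ) (hc : HasCompactSupport χ) (n : ℕ) :
    ContinuousOn (fun r => mollResidual ν a δ χ n (u r) (ω r)) (closedTimes T) :=
  (h.continuousOn_transForm_mollRate ha hδ hχ hc n).add
    ((h.continuousOn_dissipForm_moll ha hδ hχ hc n).const_smul ν)

lemma ae_slice_Ioc (h : Evolution p ν T u ω Du Dω) (hsub : Icc s t ⊆ openTimes T) :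
    ∀ᵐ r ∂volume.restrict (Ioc s t), Slice p (u r) (ω r) (Du r) (Dω r) ∧
      Slice p (ω r) (u r) (Dω r) (Du r) ∧ r ∈ Icc s t := by
  rw [ae_restrict_iff' measurableSet_Ioc]
  filter_upwards [h.ae_slice] with r hr hmem
  have := hr (hsub (Ioc_subset_Icc_self hmem))
  exact ⟨this.1, this.2, Ioc_subset_Icc_self hmem⟩

lemma integrableOn_of_continuousOn {G : ℝ → ℝ} (hG : ContinuousOn G (closedTimes T))
    (hsub : Icc s t ⊆ openTimes T) : Integrable G (volume.restrict (Ioc s t)) :=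
  ((hG.mono (hsub.trans openTimes_subset)).integrableOn_Icc).mono_set Ioc_subset_Icc_self

lemma integrableOn_gradSize (h : Evolution p ν T u ω Du Dω) (hsub : Icc s t ⊆ openTimes T) :
    Integrable (fun r => gradSize p (Du r) (Dω r)) (volume.restrict (Ioc s t)) := by
  have key : ∀ (v : ℝ → Space m → Space m) (Dv : ℝ → Fin m → Space m → Space m),
      HasGradientL1LocLp p T v Dv → ∀ i, Integrable
        (fun r => lpNorm (Dv r i) (ENNReal.ofReal p) volume) (volume.restrict (Ioc s t)) :=
    fun v Dv hv i => ((hv.locallyIntegrable i).integrableOn_compact_subset hsub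
      isCompact_Icc).mono_set Ioc_subset_Icc_self
  exact (integrable_const 1).add ((integrable_finsetSum _ fun i _ => key ω Dω h.grad_vorticity i).add
    (integrable_finsetSum _ fun i _ => key u Du h.grad_velocity i))

lemma exists_bound_norms (h : Evolution p ν T u ω Du Dω) (hsub : Icc s t ⊆ openTimes T) :
    ∃ B : ℝ, 0 ≤ B ∧ ∀ r ∈ Icc s t, lpNorm (u r) (m : ℝ≥0∞) volume ≤ B ∧
      lpNorm (ω r) (m : ℝ≥0∞) volume ≤ B ∧ lpNorm (ω r) (ENNReal.ofReal p) volume ≤ B := by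
  have hp1 : (1 : ℝ≥0∞) ≤ ENNReal.ofReal p := by
    rw [ENNReal.one_le_ofReal]; linarith [h.two_le]
  have hs := hsub.trans openTimes_subset
  obtain ⟨B1, h1⟩ := isCompact_Icc.exists_bound_of_continuousOn
    ((h.velocity.continuousOn_lpNorm h.one_le_m).mono hs)
  obtain ⟨B2, h2⟩ := isCompact_Icc.exists_bound_of_continuousOn
    ((h.vorticity.continuousOn_lpNorm h.one_le_m).mono hs)
  obtain ⟨B3, h3⟩ := isCompact_Icc.exists_bound_of_continuousOn
    ((h.vorticity'.continuousOn_lpNorm hp1).mono hs)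
  refine ⟨max 0 (max B1 (max B2 B3)), le_max_left _ _, fun r hr => ⟨?_, ?_, ?_⟩⟩
  · exact ((le_abs_self _).trans (h1 r hr)).trans (by simp)
  · exact ((le_abs_self _).trans (h2 r hr)).trans (by simp)
  · exact ((le_abs_self _).trans (h3 r hr)).trans (by simp)

/-- Taking `Λ` to be the gradient size at time `r` makes the integral of the majorant bounded on the
interval. The bound on the forms is then a constant times `gradSize`, integrable in time although
its square need not be. -/
lemma exists_mollResidual_bound (h : Evolution p ν T u ω Du Dω) (ha : 0 ≤ a) (hδ : 0 < δ)
    (hχ : ContDiff ℝ 1 χ) (hc : HasCompactSupport χ) (hsub : Icc s t ⊆ openTimes T) :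
    ∃ g : ℝ → ℝ, Integrable g (volume.restrict (Ioc s t)) ∧
      ∀ᵐ r ∂volume.restrict (Ioc s t), ∀ n, ‖mollResidual ν a δ χ n (u r) (ω r)‖ ≤ g r := by
  obtain ⟨A, hA0, hA⟩ := Slice.exists_abs_forms_le (m := m) ha hδ hχ hc
  obtain ⟨B, hB0, hB⟩ := h.exists_bound_norms hsub
  refine ⟨fun r => (ν + 1) * (A * (1 + (B ^ m + B ^ m + B ^ p + (m + m)))) *
    gradSize p (Du r) (Dω r), (h.integrableOn_gradSize hsub).const_mul _, ?_⟩
  filter_upwards [h.ae_slice_Ioc hsub] with r ⟨h1, h2, hr⟩ n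
  have hν := h.visc_pos
  set Λ := gradSize p (Du r) (Dω r) with hΛ
  have hΛ0 : 0 < Λ := gradSize_pos _ _ _
  obtain ⟨b1, b2⟩ := hA p Λ (u r) (ω r) (Du r) (Dω r) h1 hΛ0 n
  obtain ⟨n1, n2, n3⟩ := hB r hr
  have hI : ∫ x, majorant p Λ (u r) (ω r) (Du r) (Dω r) x ≤ B ^ m + B ^ m + B ^ p + (m + m) := by
    refine (h1.integral_majorant_le hΛ0 (fun i => (lpNorm_le_gradSize _ _ _ i).1)
      (fun i => (lpNorm_le_gradSize _ _ _ i).2)).trans ?_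
    have := h.two_le
    gcongr <;> exact lpNorm_nonneg
  have hAΛ : A * Λ * (1 + ∫ x, majorant p Λ (u r) (ω r) (Du r) (Dω r) x) ≤
      A * Λ * (1 + (B ^ m + B ^ m + B ^ p + (m + m))) := by gcongr
  rw [mollResidual_eq h1 h2 ha hδ.le hχ hc, Real.norm_eq_abs]
  have b3 := abs_sub (-(ν * crossForm a δ χ (moll n (ω r)) (mollGrad n (Dω r))))
    (transForm a δ χ (moll n (ω r)) (moll n (nonlin (u r) (ω r) (Du r) (Dω r))))
  rw [abs_neg, abs_mul, abs_of_pos hν] at b3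
  have b4 := mul_le_mul_of_nonneg_left (b1.trans hAΛ) hν.le
  have b5 := b2.trans hAΛ
  linarith

lemma ae_tendsto_mollResidual (h : Evolution p ν T u ω Du Dω) (ha : 0 ≤ a) (hδ : 0 < δ)
    (hχ : ContDiff ℝ 1 χ) (hc : HasCompactSupport χ) (hsub : Icc s t ⊆ openTimes T) :
    ∀ᵐ r ∂volume.restrict (Ioc s t), Tendsto (fun n => mollResidual ν a δ χ n (u r) (ω r)) atTop
      (𝓝 (residual ν a δ χ (u r) (ω r) (Du r) (Dω r))) := by
  filter_upwards [h.ae_slice_Ioc hsub] with r ⟨h1, h2, hr⟩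
  simp only [mollResidual_eq h1 h2 ha hδ.le hχ hc]
  exact (((h1.tendsto_crossForm ha hδ hχ hc).const_mul ν).neg).sub
    (h1.tendsto_transForm ha hδ hχ.continuous hc)

lemma tendsto_integral_mollResidual (h : Evolution p ν T u ω Du Dω) (ha : 0 ≤ a) (hδ : 0 < δ)
    (hχ : ContDiff ℝ 1 χ) (hc : HasCompactSupport χ) (hsub : Icc s t ⊆ openTimes T) :
    Integrable (fun r => residual ν a δ χ (u r) (ω r) (Du r) (Dω r)) (volume.restrict (Ioc s t)) ∧
    Tendsto (fun n => ∫ r in Ioc s t, mollResidual ν a δ χ n (u r) (ω r)) atTop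
      (𝓝 (∫ r in Ioc s t, residual ν a δ χ (u r) (ω r) (Du r) (Dω r))) := by
  obtain ⟨g, hg, hbound⟩ := h.exists_mollResidual_bound ha hδ hχ hc hsub
  have hlim := h.ae_tendsto_mollResidual ha hδ hχ hc hsub
  have hm : ∀ n, AEStronglyMeasurable (fun r => mollResidual ν a δ χ n (u r) (ω r))
      (volume.restrict (Ioc s t)) := fun n => (integrableOn_of_continuousOn
    (h.continuousOn_mollResidual ha hδ.le hχ.continuous hc n) hsub).1
  refine ⟨hg.mono' (aestronglyMeasurable_of_tendsto_ae _ hm hlim) ?_,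
    tendsto_integral_of_dominated_convergence g hm hg (fun n => hbound.mono fun r hr => hr n) hlim⟩
  filter_upwards [hbound, hlim] with r hr1 hr2
  exact le_of_tendsto' hr2.norm hr1

/-- The balance is solved for the dissipation, so that it is expressed through quantities whose
limits are already known. -/
lemma integral_dissipForm_moll (h : Evolution p ν T u ω Du Dω) (ha : 0 ≤ a) (hδ : 0 ≤ δ)
    (hχ : Continuous χ) (hc : HasCompactSupport χ) (hst : s ≤ t) (hsub : Icc s t ⊆ openTimes T)
    (n : ℕ) :
    ν * ∫ r in Ioc s t, dissipForm a δ χ (moll n (ω r)) (classGrad (moll n (ω r))) =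
      (∫ r in Ioc s t, mollResidual ν a δ χ n (u r) (ω r)) -
        (energy a δ χ (moll n (ω t)) - energy a δ χ (moll n (ω s))) := by
  have i1 := integrableOn_of_continuousOn (h.continuousOn_transForm_mollRate ha hδ hχ hc n) hsub
  have i2 := integrableOn_of_continuousOn (h.continuousOn_dissipForm_moll ha hδ hχ hc n) hsub
  rw [h.energy_moll_sub ha hδ hχ hc n hst hsub, intervalIntegral.integral_of_le hst]
  unfold mollResidual
  rw [integral_add i1 (i2.const_mul ν), integral_const_mul]
  ring

lemma tendsto_energy (h : Evolution p ν T u ω Du Dω) (ha : 0 ≤ a) (hap : 2 * a + 2 ≤ p)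
    (hδ : 0 ≤ δ) (hχ : Continuous χ) (hc : HasCompactSupport χ) (ht : t ∈ openTimes T) :
    Tendsto (fun n => energy a δ χ (moll n (ω t))) atTop (𝓝 (energy a δ χ (ω t))) :=
  tendsto_energy_moll h.two_le ha hap hδ (h.vorticity'.1 t (openTimes_subset ht)) hχ hc

end Evolution

lemma dissipForm_nonneg {m : ℕ} {a δ : ℝ} (ha : 0 ≤ a) (hδ : 0 ≤ δ) (η : Space m → ℝ)
    (f : Space m → Space m) (D : Fin m → Space m → Space m) :
    0 ≤ dissipForm a δ (fun x => η x ^ 2) f D := by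
  refine integral_nonneg fun x => mul_nonneg (sq_nonneg _) (Finset.sum_nonneg fun i _ => ?_)
  refine le_trans ?_ (radDeriv_coercive ha hδ (f x) (D i x))
  have := wt_nonneg (a := a) (κ := a + 1 / 3) hδ (sq_nonneg ‖f x‖)
  positivity

lemma energy_nonneg {m : ℕ} {a δ : ℝ} (hδ : 0 ≤ δ) (η : Space m → ℝ) (f : Space m → Space m) :
    0 ≤ energy a δ (fun x => η x ^ 2) f :=
  integral_nonneg fun _ => mul_nonneg (sq_nonneg _) (potential_nonneg hδ _)

/-- A family continuous in `L^q` splits uniformly on compact time sets into a small and a bounded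
part. -/
lemma ContinuousInLp.exists_splitting {m : ℕ} {q : ℝ≥0∞} {S k : Set ℝ}
    {v : ℝ → Space m → Space m} (hv : ContinuousInLp S q v) (hq : 1 ≤ q) (hq' : q ≠ ⊤)
    (hk : IsCompact k) (hkS : k ⊆ S) {ε : ℝ} (hε : 0 < ε) :
    ∃ M : ℝ, ∀ r ∈ k, ∃ w : Space m → Space m, MemLp w q volume ∧ lpNorm w q volume ≤ ε ∧
      ∀ x, ‖v r x - w x‖ ≤ M := by
  refine hk.induction_on (p := fun k' => ∃ M : ℝ, ∀ r ∈ k', r ∈ S → ∃ w : Space m → Space m,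
    MemLp w q volume ∧ lpNorm w q volume ≤ ε ∧ ∀ x, ‖v r x - w x‖ ≤ M) ⟨0, by simp⟩
    (fun s t hst ⟨M, hM⟩ => ⟨M, fun r hr => hM r (hst hr)⟩)
    (fun s t ⟨M, hM⟩ ⟨M', hM'⟩ => ⟨max M M', fun r hr hrS => ?_⟩) (fun r hr => ?_) |>.imp
      fun M hM r hr => hM r hr (hkS hr)
  · rcases hr with hr | hr
    · obtain ⟨w, h1, h2, h3⟩ := hM r hr hrS
      exact ⟨w, h1, h2, fun x => (h3 x).trans (le_max_left _ _)⟩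
    · obtain ⟨w, h1, h2, h3⟩ := hM' r hr hrS
      exact ⟨w, h1, h2, fun x => (h3 x).trans (le_max_right _ _)⟩
  · have hrS := hkS hr
    have hε2 : ENNReal.ofReal (ε / 2) ≠ 0 := by simpa using by linarith
    -- One compactly supported continuous `g` within `ε/2` of `v r` serves all nearby times: with `w
    -- = v r' - g` the difference `v r' - w = g` is bounded. Compactness in time then needs only
    -- finitely many such `g`.
    obtain ⟨g, hgc, hg1, hg2, hg3⟩ :=
      (hv.1 r hrS).exists_hasCompactSupport_eLpNorm_sub_le hq' hε2
    obtain ⟨M, hM⟩ := hgc.exists_bound_of_continuous hg2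
    have hev : ∀ᶠ r' in 𝓝[S] r, eLpNorm (v r' - v r) q volume ≤ ENNReal.ofReal (ε / 2) :=
      ((hv.2 r hrS).eventually (gt_mem_nhds (pos_iff_ne_zero.2 hε2))).mono fun _ h => h.le
    refine ⟨{r' | r' ∈ S → eLpNorm (v r' - v r) q volume ≤ ENNReal.ofReal (ε / 2)}, ?_, M, ?_⟩
    · exact nhdsWithin_le_nhds (by rwa [eventually_nhdsWithin_iff] at hev) 
    · intro r' hr' hr'S
      refine ⟨v r' - g, (hv.1 r' hr'S).sub hg3, ?_, fun x => by simpa using hM x⟩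
      have e : v r' - g = (v r' - v r) + (v r - g) := by abel
      have m1 := ((hv.1 r' hr'S).sub (hv.1 r hrS))
      have m2 := (hv.1 r hrS).sub hg3
      have h1 : lpNorm (v r' - v r) q volume ≤ ε / 2 := by
        rw [← toReal_eLpNorm m1.1]
        exact ENNReal.toReal_le_of_le_ofReal (by linarith) (hr' hr'S)
      have h2 : lpNorm (v r - g) q volume ≤ ε / 2 := by
        rw [← toReal_eLpNorm m2.1]
        exact ENNReal.toReal_le_of_le_ofReal (by linarith) hg1
      rw [e]
      exact (lpNorm_add_le m1 hq).trans (by linarith)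

/-! ### Energy inequality and a priori bound for the dissipation -/

namespace Evolution

variable {m : ℕ} {a δ p ν : ℝ} {T : EReal} {u ω : ℝ → Space m → Space m}
  {Du Dω : ℝ → Fin m → Space m → Space m} {η : Space m → ℝ} {s t : ℝ}

lemma hasCompactSupport_sq (hc : HasCompactSupport η) : HasCompactSupport fun x => η x ^ 2 :=
  hc.comp_left (g := fun y : ℝ => y ^ 2) (by simp)

/-- The energy inequality. -/
lemma energy_inequality (h : Evolution p ν T u ω Du Dω) (ha : 0 ≤ a) (hap : 2 * a + 2 ≤ p)
    (hδ : 0 < δ) (hη : ContDiff ℝ 1 η) (hc : HasCompactSupport η) (hst : s ≤ t)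
    (hsub : Icc s t ⊆ openTimes T) :
    Integrable (fun r => dissipForm a δ (fun x => η x ^ 2) (ω r) (Dω r))
      (volume.restrict (Ioc s t)) ∧
    ν * ∫ r in Ioc s t, dissipForm a δ (fun x => η x ^ 2) (ω r) (Dω r) ≤
      (∫ r in Ioc s t, residual ν a δ (fun x => η x ^ 2) (u r) (ω r) (Du r) (Dω r)) -
      (energy a δ (fun x => η x ^ 2) (ω t) - energy a δ (fun x => η x ^ 2) (ω s)) := by
  have hν := h.visc_pos
  have hχ : ContDiff ℝ 1 fun x => η x ^ 2 := hη.pow 2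
  have hχc := hasCompactSupport_sq hc
  have hs : s ∈ openTimes T := hsub (left_mem_Icc.2 hst)
  have ht : t ∈ openTimes T := hsub (right_mem_Icc.2 hst)
  have hlim := ((h.tendsto_integral_mollResidual ha hδ hχ hχc hsub).2.sub
    ((h.tendsto_energy ha hap hδ.le hχ.continuous hχc ht).sub
      (h.tendsto_energy ha hap hδ.le hχ.continuous hχc hs))).const_mul ν⁻¹
  -- No majorant in time for the quadratic dissipation is available yet, so Fatou's lemma is used
  -- and only an inequality results.
  have key := integrable_of_tendsto_of_integral_le
    (G := fun n r => dissipForm a δ (fun x => η x ^ 2) (moll n (ω r)) (classGrad (moll n (ω r))))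
    (f := fun r => dissipForm a δ (fun x => η x ^ 2) (ω r) (Dω r))
    (μ := volume.restrict (Ioc s t))
    (fun n => integrableOn_of_continuousOn
      (h.continuousOn_dissipForm_moll ha hδ.le hχ.continuous hχc n) hsub)
    (fun n => Eventually.of_forall fun r => dissipForm_nonneg ha hδ.le _ _ _) ?_ hlim (fun n => ?_)
  · refine ⟨key.1, ?_⟩
    have := mul_le_mul_of_nonneg_left key.2 hν.le
    rwa [← mul_assoc, mul_inv_cancel₀ hν.ne', one_mul] at this
  · filter_upwards [h.ae_slice_Ioc hsub] with r ⟨h1, h2, hr⟩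
    simp only [h1.classGrad_moll]
    exact h1.tendsto_dissipForm ha hδ hχ.continuous hχc
  · rw [← h.integral_dissipForm_moll ha hδ.le hχ.continuous hχc hst hsub, ← mul_assoc,
      inv_mul_cancel₀ hν.ne', one_mul]

lemma continuousOn_wDissip_moll (h : Evolution p ν T u ω Du Dω) (ha : 0 ≤ a) (hδ : 0 ≤ δ)
    (hη : Continuous η) (hc : HasCompactSupport η) (n : ℕ) :
    ContinuousOn (fun t => wDissip a δ η (moll n (ω t)) (classGrad (moll n (ω t))))
      (closedTimes T) :=
  continuousOn_integral_mul (G := fun t x => wt a (a + 1 / 3) δ (‖moll n (ω t) x‖ ^ 2) *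
      gradSq (classGrad (moll n (ω t))) x) (hη.pow 2) (hasCompactSupport_sq hc)
    (((continuous_wt_norm_sq ha hδ).comp_continuousOn (h.continuousOn_moll n)).mul
      (continuousOn_finsetSum _ fun i _ => (h.continuousOn_classGrad_moll n i).norm.pow 2))

lemma aestronglyMeasurable_wDissip (h : Evolution p ν T u ω Du Dω) (ha : 0 ≤ a) (hδ : 0 < δ)
    (hη : Continuous η) (hc : HasCompactSupport η) (hsub : Icc s t ⊆ openTimes T) :
    AEStronglyMeasurable (fun r => wDissip a δ η (ω r) (Dω r)) (volume.restrict (Ioc s t)) := by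
  refine aestronglyMeasurable_of_tendsto_ae atTop
    (f := fun n r => wDissip a δ η (moll n (ω r)) (classGrad (moll n (ω r))))
    (fun n => (integrableOn_of_continuousOn
      (h.continuousOn_wDissip_moll ha hδ.le hη hc n) hsub).1) ?_
  filter_upwards [h.ae_slice_Ioc hsub] with r ⟨h1, h2, hr⟩
  simp only [h1.classGrad_moll]
  exact (h1.tendsto_wDissip ha hδ hη hc).2

lemma integrable_wDissip_time (h : Evolution p ν T u ω Du Dω) (ha : 0 ≤ a)
    (hap : 2 * a + 2 ≤ p) (hδ : 0 < δ) (hη : ContDiff ℝ 1 η) (hc : HasCompactSupport η)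
    (hst : s ≤ t) (hsub : Icc s t ⊆ openTimes T) :
    Integrable (fun r => wDissip a δ η (ω r) (Dω r)) (volume.restrict (Ioc s t)) := by
  refine ((h.energy_inequality ha hap hδ hη hc hst hsub).1.const_mul 3).mono'
    (h.aestronglyMeasurable_wDissip ha hδ hη.continuous hc hsub) ?_
  filter_upwards [h.ae_slice_Ioc hsub] with r ⟨h1, h2, hr⟩
  rw [Real.norm_eq_abs, abs_of_nonneg (Slice.wDissip_nonneg hδ.le)]
  linarith [(h1.dissipForm_bounds ha hδ hη.continuous hc).1]

/-- Uniform bound for the truncated dissipation. -/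
lemma exists_integral_wDissip_le (h : Evolution p ν T u ω Du Dω) (ha : 0 ≤ a)
    (hap : 2 * a + 2 ≤ p) (hst : s ≤ t) (hsub : Icc s t ⊆ openTimes T) :
    ∃ B : ℝ, 0 ≤ B ∧ ∀ (δ : ℝ) (η : Space m → ℝ) (c₁ c₂ : ℝ), 0 < δ → ContDiff ℝ 1 η →
      HasCompactSupport η → (∀ r ∈ Icc s t, wCut a δ η (ω r) ≤ c₁ ∧ wMass a δ η (ω r) ≤ c₂) →
      ∫ r in Ioc s t, wDissip a δ η (ω r) (Dω r) ≤
        6 / ν * (energy a δ (fun x => η x ^ 2) (ω s) + (t - s) * (13 * ν * c₁ + B * c₂)) := by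
  have hν := h.visc_pos
  set S := sobConst m with hS
  have hS0 : 0 ≤ S := sobConst_nonneg m
  have hg4 : 4 ≤ gradConst a := by unfold gradConst; linarith
  -- With `‖w‖_m ≤ l` this gives `(S ‖w‖_m + l) · 2 gradConst² ≤ ν/12`. The same `l` is the
  -- smallness in the splitting and the Young parameter for the bounded part.
  set l := ν / 12 / ((2 * gradConst a ^ 2) * (S + 1)) with hl
  have hl0 : 0 < l := by rw [hl]; positivity
  have hm : (m : ℝ≥0∞) ≠ ⊤ := by simp
  obtain ⟨M, hM⟩ := h.velocity.exists_splitting h.one_le_m hm isCompact_Icc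
    (hsub.trans openTimes_subset) hl0
  refine ⟨M ^ 2 / l, by positivity, fun δ η c₁ c₂ hδ hη hc hb => ?_⟩
  obtain ⟨e1, e2⟩ := h.energy_inequality ha hap hδ hη hc hst hsub
  have i1 := h.integrable_wDissip_time ha hap hδ hη hc hst hsub
  have i2 := (h.tendsto_integral_mollResidual ha hδ (hη.pow 2) (hasCompactSupport_sq hc) hsub).1
  set W := ∫ r in Ioc s t, wDissip a δ η (ω r) (Dω r) with hW
  have h1 : 1 / 3 * W ≤ ∫ r in Ioc s t, dissipForm a δ (fun x => η x ^ 2) (ω r) (Dω r) := by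
    rw [hW, ← integral_const_mul]
    refine integral_mono_ae (i1.const_mul _) e1 ?_
    filter_upwards [h.ae_slice_Ioc hsub] with r ⟨h1, h2, hr⟩
    exact (h1.dissipForm_bounds ha hδ hη.continuous hc).1
  have h2 : ∫ r in Ioc s t, residual ν a δ (fun x => η x ^ 2) (u r) (ω r) (Du r) (Dω r) ≤
      ∫ r in Ioc s t, (ν / 6 * wDissip a δ η (ω r) (Dω r) + (13 * ν * c₁ + M ^ 2 / l * c₂)) := by
    refine integral_mono_ae i2 ((i1.const_mul _).add (integrable_const _)) ?_
    filter_upwards [h.ae_slice_Ioc hsub] with r ⟨h1, h2, hr⟩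
    obtain ⟨w, w1, w2, w3⟩ := hM r hr
    obtain ⟨b1, b2⟩ := hb r hr
    -- Cross term and transport term each use `ν/12` of the dissipation, together `ν/6`. Coercivity
    -- supplies `ν/3`, so `ν/6` is left, whence the factor `6 / ν`. The cutoff errors add up to `12
    -- + 1/12 ≤ 13` times `ν c₁`.
    have k1 := h1.abs_crossForm_le ha hδ hη hc (show (0 : ℝ) < 1 / 12 by norm_num)
    have k2 := h1.abs_transForm_le ha hδ hη hc w1 w3 hl0
    have k3 : (S * lpNorm w (m : ℝ≥0∞) volume + l) * (2 * gradConst a ^ 2) ≤ ν / 12 := by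
      calc (S * lpNorm w (m : ℝ≥0∞) volume + l) * (2 * gradConst a ^ 2)
          ≤ (S * l + l) * (2 * gradConst a ^ 2) := by gcongr
        _ = ν / 12 := by rw [hl]; field_simp
    have p1 : 0 ≤ wDissip a δ η (ω r) (Dω r) := Slice.wDissip_nonneg hδ.le
    have p2 : 0 ≤ wCut a δ η (ω r) := Slice.wCut_nonneg hδ.le
    have k4 := mul_le_mul_of_nonneg_right k3 (add_nonneg p2 p1)
    have k5 := mul_le_mul_of_nonneg_left k1 hν.le
    have k6 := mul_le_mul_of_nonneg_left b2 (show 0 ≤ M ^ 2 / l by positivity)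
    have k7 := mul_le_mul_of_nonneg_left b1 hν.le
    have k8 := mul_nonneg hν.le p2
    have k9 := neg_abs_le (crossForm a δ (fun x => η x ^ 2) (ω r) (Dω r))
    have k10 := neg_abs_le (transForm a δ (fun x => η x ^ 2) (ω r)
      (nonlin (u r) (ω r) (Du r) (Dω r)))
    have k11 := mul_le_mul_of_nonneg_left k9 hν.le
    unfold residual
    simp only [one_div, inv_inv] at k5
    linarith
  rw [integral_add (i1.const_mul _) (integrable_const _), integral_const_mul, ← hW] at h2
  simp only [integral_const, measureReal_restrict_apply_univ, Real.volume_real_Ioc_of_le hst,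
    smul_eq_mul] at h2
  have h3 := mul_le_mul_of_nonneg_left h1 hν.le
  have h4 : 0 ≤ energy a δ (fun x => η x ^ 2) (ω t) := energy_nonneg hδ.le _ _
  have h5 : ν / 6 * W ≤ energy a δ (fun x => η x ^ 2) (ω s) +
      (t - s) * (13 * ν * c₁ + M ^ 2 / l * c₂) := by linarith
  calc W = 6 / ν * (ν / 6 * W) := by field_simp
    _ ≤ _ := by gcongr

end Evolution

/-! ### Weighted integrals of powers of the vorticity -/

section WeightedBounds

variable {m : ℕ} {a δ p M : ℝ} {f : Space m → Space m} {c G : Space m → ℝ}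

lemma rpow_le_one_add_rpow {r q p : ℝ} (hr : 0 ≤ r) (hq : 0 ≤ q) (hqp : q ≤ p) :
    r ^ q ≤ 1 + r ^ p := by
  have h0 : 0 ≤ r ^ p := by positivity
  rcases le_total r 1 with h | h
  · have := Real.rpow_le_one hr h hq
    linarith
  · have := Real.rpow_le_rpow_of_exponent_le h hqp
    linarith

/-- An exponent below `p` is dominated only by `1 + |f|^p`; the constant is integrable because the
weight has compact support. -/
lemma integral_weight_le (hp : 2 ≤ p) (ha : 0 ≤ a) (hap : 2 * a + 2 ≤ p)
    (hf : MemLp f (ENNReal.ofReal p) volume) (hc : Continuous c) (hcs : HasCompactSupport c)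
    (hc0 : ∀ x, 0 ≤ c x) (hcM : ∀ x, c x ≤ M) (hG0 : ∀ x, 0 ≤ G x)
    (hG : ∀ x, G x ≤ ‖f x‖ ^ (2 * a + 2)) :
    ∫ x, c x * G x ≤ (∫ x, c x) + M * lpNorm f (ENNReal.ofReal p) volume ^ p := by
  have i1 := memLp_integrable_rpow hp hf
  have i2 := hc.integrable_of_hasCompactSupport hcs (μ := volume)
  rw [lpNorm_rpow_eq hp hf, ← integral_const_mul, ← integral_add i2 (i1.const_mul M)]
  refine integral_mono_of_nonneg (Eventually.of_forall fun x => mul_nonneg (hc0 x) (hG0 x))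
    (i2.add (i1.const_mul M)) (Eventually.of_forall fun x => ?_)
  have h1 := (hG x).trans (rpow_le_one_add_rpow (norm_nonneg (f x)) (by linarith) hap)
  have h2 : 0 ≤ ‖f x‖ ^ p := by positivity
  have h3 := mul_le_mul_of_nonneg_left h1 (hc0 x)
  have h4 := mul_le_mul_of_nonneg_right (hcM x) h2
  simp only
  linarith

/-- At exponent exactly `p` the size of the support does not enter, so the bound is uniform along
expanding cutoffs. -/
lemma integral_weight_le' (hp : 2 ≤ p) (hf : MemLp f (ENNReal.ofReal p) volume)
    (hc0 : ∀ x, 0 ≤ c x) (hcM : ∀ x, c x ≤ M) (hG0 : ∀ x, 0 ≤ G x)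
    (hG : ∀ x, G x ≤ ‖f x‖ ^ p) :
    ∫ x, c x * G x ≤ M * lpNorm f (ENNReal.ofReal p) volume ^ p := by
  have i1 := memLp_integrable_rpow hp hf
  rw [lpNorm_rpow_eq hp hf, ← integral_const_mul]
  refine integral_mono_of_nonneg (Eventually.of_forall fun x => mul_nonneg (hc0 x) (hG0 x))
    (i1.const_mul M) (Eventually.of_forall fun x => ?_)
  exact mul_le_mul (hcM x) (hG x) (hG0 x) ((hc0 x).trans (hcM x))

lemma wt_mul_sq_le (ha : 0 ≤ a) (hδ : 0 ≤ δ) (w : Space m) :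
    0 ≤ wt a (a + 1 / 3) δ (‖w‖ ^ 2) * ‖w‖ ^ 2 ∧
    wt a (a + 1 / 3) δ (‖w‖ ^ 2) * ‖w‖ ^ 2 ≤ ‖w‖ ^ (2 * a + 2) := by
  have h0 := wt_nonneg (a := a) (κ := a + 1 / 3) hδ (sq_nonneg ‖w‖)
  refine ⟨by positivity, ?_⟩
  have h1 := wt_le_rpow (a := a) (κ := a + 1 / 3) (by linarith) hδ (sq_nonneg ‖w‖)
  refine (mul_le_mul_of_nonneg_right h1 (sq_nonneg _)).trans (le_of_eq ?_)
  exact rpow_sq_mul ha (norm_nonneg w)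

end WeightedBounds

/-! ### Localized bounds for mollified gradients -/

section LocalGradients

variable {m : ℕ} {a δ p : ℝ} {D : Fin m → Space m → Space m} {η ζ : Space m → ℝ}

lemma integrable_sq_gradSq (hp : 2 ≤ p) (hD : ∀ i, MemLp (D i) (ENNReal.ofReal p) volume)
    (hη : Continuous η) (hc : HasCompactSupport η) :
    Integrable (fun x => η x ^ 2 * gradSq D x) volume := by
  have hc2 : HasCompactSupport fun x => η x ^ 2 :=
    hc.comp_left (g := fun y : ℝ => y ^ 2) (by simp)
  have h1 : Integrable (fun x => ∑ i, η x ^ 2 • (1 + ‖D i x‖ ^ p)) volume :=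
    integrable_finsetSum _ fun i _ => integrable_smul_of_compact (hη.pow 2) hc2
      ((locallyIntegrable_const 1).add (memLp_integrable_rpow hp (hD i)).locallyIntegrable)
  refine h1.mono' ((hη.pow 2).aestronglyMeasurable.mul
    (Finset.aestronglyMeasurable_fun_sum _ fun i _ => (hD i).1.norm.pow 2))
    (Eventually.of_forall fun x => ?_)
  rw [Real.norm_eq_abs, abs_of_nonneg (mul_nonneg (sq_nonneg _) (gradSq_nonneg _ _)), gradSq,
    Finset.mul_sum]
  exact Finset.sum_le_sum fun i _ => mul_le_mul_of_nonneg_left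
    (sq_le_one_add_rpow (norm_nonneg _) hp) (sq_nonneg _)

lemma locallyIntegrable_gradSq (hp : 2 ≤ p) (hD : ∀ i, MemLp (D i) (ENNReal.ofReal p) volume)
    (i : Fin m) : LocallyIntegrable (fun x => ‖D i x‖ ^ (2 : ℝ)) volume := by
  refine ((locallyIntegrable_const (1 : ℝ)).add
    (memLp_integrable_rpow hp (hD i)).locallyIntegrable).mono
    ((hD i).1.norm.aemeasurable.pow_const _).aestronglyMeasurable
    (Eventually.of_forall fun x => ?_)
  have h0 : 0 ≤ ‖D i x‖ ^ p := by positivity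
  rw [Real.norm_eq_abs, abs_of_nonneg (by positivity), Real.norm_eq_abs, Pi.add_apply,
    abs_of_nonneg (by positivity), Real.rpow_two]
  exact sq_le_one_add_rpow (norm_nonneg _) hp

/-- Localized Jensen inequality for mollified gradients. -/
lemma sq_mul_gradSq_moll_le (hp : 2 ≤ p) (hD : ∀ i, MemLp (D i) (ENNReal.ofReal p) volume) {M : ℝ}
    (hM : ∀ x, η x ^ 2 ≤ M) (hζ : ∀ x, η x ≠ 0 → ∀ y, ‖x - y‖ < 1 → ζ y = 1) (n : ℕ) (x : Space m) :
    η x ^ 2 * gradSq (mollGrad n D) x ≤ M * moll n (fun y => ζ y ^ 2 * gradSq D y) x := by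
  have h0 : 0 ≤ moll n (fun y => ζ y ^ 2 * gradSq D y) x :=
    moll_nonneg n (fun y => mul_nonneg (sq_nonneg _) (gradSq_nonneg _ _)) x
  by_cases hx : η x = 0
  · rw [hx]
    have : 0 ≤ M := (sq_nonneg (η x)).trans (hM x)
    simp
    positivity
  -- The kernel lives in the unit ball, on which `ζ = 1`, so inserting the cutoff changes nothing at
  -- `x`.
  · have e : moll n (fun y => ζ y ^ 2 * gradSq D y) x = moll n (gradSq D) x :=
      moll_congr_ball n fun y hy => by rw [hζ x hx y hy]; simp
    have h1 : gradSq (mollGrad n D) x ≤ moll n (gradSq D) x := by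
      have e2 : gradSq D = fun y => ∑ i, ‖D i y‖ ^ (2 : ℝ) := by
        ext1 y; simp [gradSq]
      rw [e2, moll_sum n _ fun i _ => locallyIntegrable_gradSq hp hD i]
      refine Finset.sum_le_sum fun i _ => ?_
      have := rpow_norm_moll_le (q := 2) n (by norm_num) (memLp_locallyIntegrable_rpow hp (hD i))
        (locallyIntegrable_gradSq hp hD i) x
      rwa [Real.rpow_two] at this
    rw [e] at h0 ⊢
    exact (mul_le_mul_of_nonneg_left h1 (sq_nonneg _)).trans (mul_le_mul_of_nonneg_right (hM x) h0)

/-- The bound is uniform in `n` and involves only the local square of the true gradient. Once that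
is integrable in time, it is the majorant missing from the energy inequality. -/
lemma dissipForm_moll_le {f : Space m → Space m} (ha : 0 ≤ a) (hδ : 0 < δ) (hp : 2 ≤ p)
    (hD : ∀ i, MemLp (D i) (ENNReal.ofReal p) volume) {M : ℝ}
    (hM : ∀ x, η x ^ 2 ≤ M) (hζc : Continuous ζ) (hζs : HasCompactSupport ζ)
    (hζ : ∀ x, η x ≠ 0 → ∀ y, ‖x - y‖ < 1 → ζ y = 1) (n : ℕ) :
    dissipForm a δ (fun x => η x ^ 2) f (mollGrad n D) ≤
      (1 + 2 * (a + (a + 1 / 3))) * δ ^ (-a) * M * ∫ x, ζ x ^ 2 * gradSq D x := by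
  have hi := integrable_sq_gradSq hp hD hζc hζs
  rw [← integral_moll n hi, ← integral_const_mul]
  refine integral_mono_of_nonneg (Eventually.of_forall fun x => mul_nonneg (sq_nonneg _)
    (Finset.sum_nonneg fun i _ => ?_)) ((integrable_moll n hi).const_mul _)
    (Eventually.of_forall fun x => ?_)
  · refine le_trans ?_ (radDeriv_coercive ha hδ.le (f x) (mollGrad n D i x))
    have := wt_nonneg (a := a) (κ := a + 1 / 3) hδ.le (sq_nonneg ‖f x‖)
    positivity
  · have h1 : ∑ i, inner ℝ (radDeriv a (a + 1 / 3) δ (f x) (mollGrad n D i x)) (mollGrad n D i x) ≤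
        (1 + 2 * (a + (a + 1 / 3))) * δ ^ (-a) * gradSq (mollGrad n D) x := by
      unfold gradSq
      rw [Finset.mul_sum]
      refine Finset.sum_le_sum fun i _ => (real_inner_le_norm _ _).trans ?_
      have k1 := norm_radDeriv_apply_le (a := a) (κ := a + 1 / 3) ha (by linarith) hδ.le (f x)
        (mollGrad n D i x)
      have k2 := wt_le_const (κ := a + 1 / 3) ha (by linarith) hδ (sq_nonneg ‖f x‖)
      calc _ ≤ (1 + 2 * (a + (a + 1 / 3))) * wt a (a + 1 / 3) δ (‖f x‖ ^ 2) *
            ‖mollGrad n D i x‖ * ‖mollGrad n D i x‖ := by gcongr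
        _ ≤ (1 + 2 * (a + (a + 1 / 3))) * δ ^ (-a) *
            ‖mollGrad n D i x‖ * ‖mollGrad n D i x‖ := by gcongr
        _ = _ := by ring
    have h2 := sq_mul_gradSq_moll_le hp hD hM hζ n x
    have hC : 0 ≤ (1 + 2 * (a + (a + 1 / 3))) * δ ^ (-a) := by positivity
    have h3 := mul_le_mul_of_nonneg_left h1 (sq_nonneg (η x))
    have h4 := mul_le_mul_of_nonneg_left h2 hC
    simp only
    linarith

lemma exists_cutoff_one_on_thickening (hc : HasCompactSupport η) :
    ∃ ζ : Space m → ℝ, ContDiff ℝ 1 ζ ∧ HasCompactSupport ζ ∧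
      ∀ x, η x ≠ 0 → ∀ y, ‖x - y‖ < 1 → ζ y = 1 := by
  obtain ⟨R, hR⟩ := hc.isCompact.isBounded.subset_closedBall (0 : Space m)
  let b : ContDiffBump (0 : Space m) :=
    ⟨max R 0 + 1, max R 0 + 2, by positivity, by linarith⟩
  refine ⟨b, b.contDiff, b.hasCompactSupport, fun x hx y hxy => b.one_of_mem_closedBall ?_⟩
  have h1 : ‖x‖ ≤ R := by simpa using hR (subset_tsupport _ hx)
  have h2 : ‖y‖ ≤ ‖x‖ + ‖x - y‖ := by
    rw [norm_sub_rev]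
    simpa using norm_add_le x (y - x)
  rw [mem_closedBall_zero_iff]
  change ‖y‖ ≤ max R 0 + 1
  linarith [le_max_left R 0]

end LocalGradients

/-! ### Local square integrability of the gradient and the energy identity -/

namespace Evolution

variable {m : ℕ} {a δ p ν : ℝ} {T : EReal} {u ω : ℝ → Space m → Space m}
  {Du Dω : ℝ → Fin m → Space m → Space m} {η : Space m → ℝ} {s t : ℝ}

/-- The gradient is locally square integrable in space-time. -/
lemma integrable_local_gradSq (h : Evolution p ν T u ω Du Dω) (hη : ContDiff ℝ 1 η)
    (hc : HasCompactSupport η) (hst : s ≤ t) (hsub : Icc s t ⊆ openTimes T) :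
    Integrable (fun r => ∫ x, η x ^ 2 * gradSq (Dω r) x) (volume.restrict (Ioc s t)) := by
  have hp := h.two_le
  -- The case `a = 0`: the weight is `(1 + δ q)^(-1/3)`, which tends to `1` as `δ → 0`, and the
  -- energy is quadratic, so `p ≥ 2` suffices.
  have hap : 2 * (0 : ℝ) + 2 ≤ p := by linarith
  have hν := h.visc_pos
  obtain ⟨B, hB0, hB⟩ := h.exists_integral_wDissip_le le_rfl hap hst hsub
  obtain ⟨N, hN0, hN⟩ := h.exists_bound_norms hsub
  have hc2 := hasCompactSupport_sq hc
  have hη2 : Continuous fun x => η x ^ 2 := hη.continuous.pow 2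
  obtain ⟨M₁, hM₁⟩ := (hasCompactSupport_cutGradSq hc).exists_bound_of_continuous
    (continuous_cutGradSq hη)
  obtain ⟨M₂, hM₂⟩ := hc2.exists_bound_of_continuous hη2
  have hM1 : ∀ x, cutGradSq η x ≤ M₁ := fun x => (le_abs_self _).trans (hM₁ x)
  have hM2 : ∀ x, η x ^ 2 ≤ M₂ := fun x => (le_abs_self _).trans (hM₂ x)
  have hM10 : 0 ≤ M₁ := (norm_nonneg _).trans (hM₁ 0)
  have hM20 : 0 ≤ M₂ := (norm_nonneg _).trans (hM₂ 0)
  have hNp : ∀ r ∈ Icc s t, lpNorm (ω r) (ENNReal.ofReal p) volume ^ p ≤ N ^ p := fun r hr =>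
    Real.rpow_le_rpow lpNorm_nonneg (hN r hr).2.2 (by linarith)
  have hmem : ∀ r ∈ Icc s t, MemLp (ω r) (ENNReal.ofReal p) volume := fun r hr =>
    h.vorticity'.1 r (openTimes_subset (hsub hr))
  set c₁ := (∫ x, cutGradSq η x) + M₁ * N ^ p with hc₁
  set c₂ := (∫ x, η x ^ 2) + M₂ * N ^ p with hc₂
  have hδ : ∀ k : ℕ, (0 : ℝ) < 1 / ((k : ℝ) + 1) := fun k => by positivity
  have hbound : ∀ k : ℕ, ∫ r in Ioc s t, wDissip 0 (1 / ((k : ℝ) + 1)) η (ω r) (Dω r) ≤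
      6 / ν * (c₂ + (t - s) * (13 * ν * c₁ + B * c₂)) := by
    intro k
    refine (hB (1 / ((k : ℝ) + 1)) η c₁ c₂ (hδ k) hη hc fun r hr => ⟨?_, ?_⟩).trans ?_
    · refine (integral_weight_le (a := 0) hp le_rfl hap (hmem r hr) (continuous_cutGradSq hη)
        (hasCompactSupport_cutGradSq hc) (cutGradSq_nonneg η) hM1
        (fun x => (wt_mul_sq_le le_rfl (hδ k).le _).1)
        (fun x => (wt_mul_sq_le le_rfl (hδ k).le _).2)).trans ?_
      have := mul_le_mul_of_nonneg_left (hNp r hr) hM10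
      linarith
    · refine (integral_weight_le (a := 0) hp le_rfl hap (hmem r hr) hη2 hc2
        (fun x => sq_nonneg _) hM2
        (fun x => (wt_mul_sq_le le_rfl (hδ k).le _).1)
        (fun x => (wt_mul_sq_le le_rfl (hδ k).le _).2)).trans ?_
      have := mul_le_mul_of_nonneg_left (hNp r hr) hM20
      linarith
    · have hsm := left_mem_Icc.2 hst
      have : energy 0 (1 / ((k : ℝ) + 1)) (fun x => η x ^ 2) (ω s) ≤ c₂ := by
        refine (integral_weight_le (a := 0) hp le_rfl hap (hmem s hsm) hη2 hc2
          (fun x => sq_nonneg _) hM2 (fun x => potential_nonneg (hδ k).le _)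
          (fun x => potential_le le_rfl (by norm_num) (hδ k).le _)).trans ?_
        have := mul_le_mul_of_nonneg_left (hNp s hsm) hM20
        linarith
      gcongr
  refine (integrable_of_tendsto_of_integral_le
    (fun k : ℕ => h.integrable_wDissip_time le_rfl hap (hδ k) hη hc hst hsub)
    (fun k => Eventually.of_forall fun r => Slice.wDissip_nonneg (hδ k).le) ?_ tendsto_const_nhds
    hbound).1
  filter_upwards [h.ae_slice_Ioc hsub] with r ⟨h1, h2, hr⟩
  refine tendsto_integral_of_dominated_convergence (fun x => η x ^ 2 * gradSq (Dω r) x)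
    (fun k => (h1.tendsto_wDissip le_rfl (hδ k) hη.continuous hc).1.1)
    (integrable_sq_gradSq hp h1.memLp_Df hη.continuous hc) (fun k => Eventually.of_forall fun x => ?_)
    (Eventually.of_forall fun x => ?_)
  · have k0 := wt_nonneg (a := 0) (κ := 0 + 1 / 3) (hδ k).le (sq_nonneg ‖ω r x‖)
    have k1 := wt_le_rpow (a := 0) (κ := 0 + 1 / 3) (by norm_num) (hδ k).le (sq_nonneg ‖ω r x‖)
    have k2 := gradSq_nonneg (Dω r) x
    rw [Real.rpow_zero] at k1
    rw [Real.norm_eq_abs, abs_of_nonneg (by positivity)]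
    refine mul_le_mul_of_nonneg_left ?_ (sq_nonneg _)
    exact mul_le_of_le_one_left k2 k1
  · have := tendsto_wt_one_div (a := 0) (κ := 0 + 1 / 3) (‖ω r x‖ ^ 2)
    rw [Real.rpow_zero] at this
    simpa using (this.mul_const (gradSq (Dω r) x)).const_mul (η x ^ 2)

/-- The energy balance. -/
lemma energy_identity (h : Evolution p ν T u ω Du Dω) (ha : 0 ≤ a) (hap : 2 * a + 2 ≤ p)
    (hδ : 0 < δ) (hη : ContDiff ℝ 1 η) (hc : HasCompactSupport η) (hst : s ≤ t)
    (hsub : Icc s t ⊆ openTimes T) :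
    energy a δ (fun x => η x ^ 2) (ω t) - energy a δ (fun x => η x ^ 2) (ω s) =
      (∫ r in Ioc s t, residual ν a δ (fun x => η x ^ 2) (u r) (ω r) (Du r) (Dω r)) -
      ν * ∫ r in Ioc s t, dissipForm a δ (fun x => η x ^ 2) (ω r) (Dω r) := by
  have hχ : ContDiff ℝ 1 fun x => η x ^ 2 := hη.pow 2
  have hχc := hasCompactSupport_sq hc
  have hs : s ∈ openTimes T := hsub (left_mem_Icc.2 hst)
  have ht : t ∈ openTimes T := hsub (right_mem_Icc.2 hst)
  have hlim := (h.tendsto_integral_mollResidual ha hδ hχ hχc hsub).2.sub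
    ((h.tendsto_energy ha hap hδ.le hχ.continuous hχc ht).sub
      (h.tendsto_energy ha hap hδ.le hχ.continuous hχc hs))
  obtain ⟨ζ, hζ1, hζc, hζ⟩ := exists_cutoff_one_on_thickening hc
  obtain ⟨M, hM⟩ := hχc.exists_bound_of_continuous hχ.continuous
  have hM' : ∀ x, η x ^ 2 ≤ M := fun x => (le_abs_self _).trans (hM x)
  -- Local square integrability of the gradient in space-time now provides a majorant, so the
  -- dissipation converges and equality holds.
  have hlim2 : Tendsto (fun n => ∫ r in Ioc s t, dissipForm a δ (fun x => η x ^ 2) (moll n (ω r))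
      (classGrad (moll n (ω r)))) atTop
      (𝓝 (∫ r in Ioc s t, dissipForm a δ (fun x => η x ^ 2) (ω r) (Dω r))) := by
    refine tendsto_integral_of_dominated_convergence
      (fun r => (1 + 2 * (a + (a + 1 / 3))) * δ ^ (-a) * M * ∫ x, ζ x ^ 2 * gradSq (Dω r) x)
      (fun n => (integrableOn_of_continuousOn
        (h.continuousOn_dissipForm_moll ha hδ.le hχ.continuous hχc n) hsub).1)
      ((h.integrable_local_gradSq hζ1 hζc hst hsub).const_mul _) (fun n => ?_) ?_
    · filter_upwards [h.ae_slice_Ioc hsub] with r ⟨h1, h2, hr⟩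
      rw [Real.norm_eq_abs, abs_of_nonneg (dissipForm_nonneg ha hδ.le _ _ _), h1.classGrad_moll]
      exact dissipForm_moll_le ha hδ h.two_le h1.memLp_Df hM' hζ1.continuous hζc hζ n
    · filter_upwards [h.ae_slice_Ioc hsub] with r ⟨h1, h2, hr⟩
      simp only [h1.classGrad_moll]
      exact h1.tendsto_dissipForm ha hδ hχ.continuous hχc
  have h3 := hlim2.const_mul ν
  simp only [h.integral_dissipForm_moll ha hδ.le hχ.continuous hχc hst hsub] at h3
  have h4 := tendsto_nhds_unique h3 hlim
  linarith

end Evolution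

/-! ### Expanding cutoffs -/

section Cutoffs

/-- Cutoff functions exhausting the space with vanishing gradients. -/
lemma exists_cutoffs (m : ℕ) : ∃ (η : ℕ → Space m → ℝ) (C : ℝ), 0 ≤ C ∧
    (∀ k, ContDiff ℝ 1 (η k)) ∧ (∀ k, HasCompactSupport (η k)) ∧ (∀ k x, η k x ^ 2 ≤ 1) ∧
    (∀ k x, cutGradSq (η k) x ≤ C * (1 / ((k : ℝ) + 1)) ^ 2) ∧
    ∀ x, Tendsto (fun k => η k x) atTop (𝓝 1) := by
  let b : ContDiffBump (0 : Space m) := ⟨1, 2, by norm_num, by norm_num⟩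
  have hb : ContDiff ℝ 1 b := b.contDiff
  obtain ⟨C, hC⟩ := (hasCompactSupport_cutGradSq b.hasCompactSupport).exists_bound_of_continuous
    (continuous_cutGradSq hb)
  have hε : ∀ k : ℕ, (0 : ℝ) < 1 / ((k : ℝ) + 1) := fun k => by positivity
  refine ⟨fun k x => b ((1 / ((k : ℝ) + 1)) • x), C, (norm_nonneg _).trans (hC 0), fun k => ?_,
    fun k => ?_, fun k x => ?_, fun k x => ?_, fun x => ?_⟩
  · exact hb.comp (contDiff_const_smul _)
  · exact b.hasCompactSupport.comp_smul (hε k).ne'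
  · have h1 : 0 ≤ b ((1 / ((k : ℝ) + 1)) • x) := b.nonneg
    have h2 : b ((1 / ((k : ℝ) + 1)) • x) ≤ 1 := b.le_one
    exact pow_le_one₀ h1 h2
  · have e : ∀ w, fderiv ℝ (fun x => b ((1 / ((k : ℝ) + 1)) • x)) x w =
        (1 / ((k : ℝ) + 1)) * fderiv ℝ b ((1 / ((k : ℝ) + 1)) • x) w := by
      intro w
      have h1 := (hb.differentiable (by norm_num) ((1 / ((k : ℝ) + 1)) • x)).hasFDerivAt.comp x
        ((hasFDerivAt_id x).const_smul (1 / ((k : ℝ) + 1)))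
      have h2 := congrArg (fun A : Space m →L[ℝ] ℝ => A w) h1.fderiv
      refine Eq.trans h2 ?_
      simp
    have h3 := (le_abs_self _).trans (hC ((1 / ((k : ℝ) + 1)) • x))
    unfold cutGradSq at h3 ⊢
    simp only [e, mul_pow]
    rw [← Finset.mul_sum, mul_comm]
    exact mul_le_mul_of_nonneg_right h3 (sq_nonneg _)
  · have h1 : Tendsto (fun k : ℕ => (1 / ((k : ℝ) + 1)) • x) atTop (𝓝 0) := by
      simpa using (tendsto_one_div_add_atTop_nhds_zero_nat (𝕜 := ℝ)).smul_const x
    have h2 := (hb.continuous.tendsto 0).comp h1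
    have h3 : b (0 : Space m) = 1 :=
      b.one_of_mem_closedBall (Metric.mem_closedBall_self (by norm_num))
    rw [h3] at h2
    exact h2

end Cutoffs

/-! ### Finiteness and integrability of the full dissipation -/

namespace Evolution

variable {m : ℕ} {p ν : ℝ} {T : EReal} {u ω : ℝ → Space m → Space m}
  {Du Dω : ℝ → Fin m → Space m → Space m} {s t : ℝ}

/-- The truncated dissipations are bounded uniformly in the cutoff. -/
lemma exists_integral_wDissip_cutoff_le (h : Evolution p ν T u ω Du Dω) {η : ℕ → Space m → ℝ} {C : ℝ}
    (hC : 0 ≤ C) (hη : ∀ k, ContDiff ℝ 1 (η k)) (hc : ∀ k, HasCompactSupport (η k))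
    (h1 : ∀ k x, η k x ^ 2 ≤ 1) (h2 : ∀ k x, cutGradSq (η k) x ≤ C * (1 / ((k : ℝ) + 1)) ^ 2)
    (hst : s ≤ t) (hsub : Icc s t ⊆ openTimes T) :
    ∃ L : ℝ, ∀ k : ℕ,
      ∫ r in Ioc s t, wDissip ((p - 2) / 2) (1 / ((k : ℝ) + 1)) (η k) (ω r) (Dω r) ≤ L := by
  have hp := h.two_le
  have ha : 0 ≤ (p - 2) / 2 := by linarith
  have hap : 2 * ((p - 2) / 2) + 2 = p := by ring
  have hν := h.visc_pos
  obtain ⟨B, hB0, hB⟩ := h.exists_integral_wDissip_le ha hap.le hst hsub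
  obtain ⟨N, hN0, hN⟩ := h.exists_bound_norms hsub
  have hNp : ∀ r ∈ Icc s t, lpNorm (ω r) (ENNReal.ofReal p) volume ^ p ≤ N ^ p := fun r hr =>
    Real.rpow_le_rpow lpNorm_nonneg (hN r hr).2.2 (by linarith)
  have hmem : ∀ r ∈ Icc s t, MemLp (ω r) (ENNReal.ofReal p) volume := fun r hr =>
    h.vorticity'.1 r (openTimes_subset (hsub hr))
  have hδ : ∀ k : ℕ, (0 : ℝ) < 1 / ((k : ℝ) + 1) := fun k => by positivity
  have hδ1 : ∀ k : ℕ, 1 / ((k : ℝ) + 1) ≤ 1 := fun k => by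
    rw [div_le_one (by positivity)]; linarith [(Nat.cast_nonneg k : (0 : ℝ) ≤ k)]
  refine ⟨6 / ν * (N ^ p + (t - s) * (13 * ν * (C * N ^ p) + B * N ^ p)), fun k => ?_⟩
  have hwt : ∀ r x, 0 ≤ wt ((p - 2) / 2) ((p - 2) / 2 + 1 / 3) (1 / ((k : ℝ) + 1)) (‖ω r x‖ ^ 2) *
      ‖ω r x‖ ^ 2 ∧ wt ((p - 2) / 2) ((p - 2) / 2 + 1 / 3) (1 / ((k : ℝ) + 1)) (‖ω r x‖ ^ 2) *
      ‖ω r x‖ ^ 2 ≤ ‖ω r x‖ ^ p := fun r x => by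
    have := wt_mul_sq_le (m := m) ha (hδ k).le (ω r x)
    rwa [hap] at this
  have hcut : ∀ x, cutGradSq (η k) x ≤ C := fun x => (h2 k x).trans
    (mul_le_of_le_one_right hC (pow_le_one₀ (hδ k).le (hδ1 k)))
  refine (hB (1 / ((k : ℝ) + 1)) (η k) (C * N ^ p) (N ^ p) (hδ k) (hη k) (hc k)
    fun r hr => ⟨?_, ?_⟩).trans ?_
  · exact (integral_weight_le' hp (hmem r hr) (cutGradSq_nonneg (η k)) hcut
      (fun x => (hwt r x).1) (fun x => (hwt r x).2)).trans
      (mul_le_mul_of_nonneg_left (hNp r hr) hC)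
  · refine (integral_weight_le' hp (hmem r hr) (fun x => sq_nonneg (η k x)) (h1 k)
      (fun x => (hwt r x).1) (fun x => (hwt r x).2)).trans ?_
    rw [one_mul]
    exact hNp r hr
  · have hsm := left_mem_Icc.2 hst
    have : energy ((p - 2) / 2) (1 / ((k : ℝ) + 1)) (fun x => η k x ^ 2) (ω s) ≤ N ^ p := by
      refine (integral_weight_le' hp (hmem s hsm) (fun x => sq_nonneg (η k x)) (h1 k)
        (fun x => potential_nonneg (hδ k).le _) (fun x => ?_)).trans ?_
      · have := potential_le (κ := (p - 2) / 2 + 1 / 3) ha (by linarith) (hδ k).le (ω s x)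
        rwa [hap] at this
      · rw [one_mul]
        exact hNp s hsm
    gcongr

lemma truncated_density_le (hp : 2 ≤ p) {δ : ℝ} (hδ : 0 < δ) {η : Space m → ℝ}
    (h1 : ∀ x, η x ^ 2 ≤ 1) (f : Space m → Space m) (D : Fin m → Space m → Space m) (x : Space m) :
    0 ≤ η x ^ 2 * (wt ((p - 2) / 2) ((p - 2) / 2 + 1 / 3) δ (‖f x‖ ^ 2) * gradSq D x) ∧
    η x ^ 2 * (wt ((p - 2) / 2) ((p - 2) / 2 + 1 / 3) δ (‖f x‖ ^ 2) * gradSq D x) ≤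
      dissipationDensity p f D x := by
  have k0 := wt_nonneg (a := (p - 2) / 2) (κ := (p - 2) / 2 + 1 / 3) hδ.le (sq_nonneg ‖f x‖)
  have k1 := wt_le_rpow (a := (p - 2) / 2) (κ := (p - 2) / 2 + 1 / 3) (by linarith) hδ.le
    (sq_nonneg ‖f x‖)
  have k2 := gradSq_nonneg D x
  rw [sq_rpow_eq _ (norm_nonneg _), show 2 * ((p - 2) / 2) = p - 2 by ring] at k1
  refine ⟨by positivity, (mul_le_of_le_one_left (by positivity) (h1 x)).trans ?_⟩
  exact mul_le_mul_of_nonneg_right k1 k2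

/-- The dissipation is locally integrable in time, and is the limit of its truncations. -/
lemma integrable_Q (h : Evolution p ν T u ω Du Dω) {η : ℕ → Space m → ℝ} {C : ℝ}
    (hC : 0 ≤ C) (hη : ∀ k, ContDiff ℝ 1 (η k)) (hc : ∀ k, HasCompactSupport (η k))
    (h1 : ∀ k x, η k x ^ 2 ≤ 1) (h2 : ∀ k x, cutGradSq (η k) x ≤ C * (1 / ((k : ℝ) + 1)) ^ 2)
    (h3 : ∀ x, Tendsto (fun k => η k x) atTop (𝓝 1))
    (hst : s ≤ t) (hsub : Icc s t ⊆ openTimes T) :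
    (∀ᵐ r ∂volume.restrict (Ioc s t), Integrable (dissipationDensity p (ω r) (Dω r)) volume ∧
      Tendsto (fun k : ℕ => wDissip ((p - 2) / 2) (1 / ((k : ℝ) + 1)) (η k) (ω r) (Dω r)) atTop
        (𝓝 (Q p (ω r) (Dω r))) ∧
      ∀ k : ℕ, wDissip ((p - 2) / 2) (1 / ((k : ℝ) + 1)) (η k) (ω r) (Dω r) ≤ Q p (ω r) (Dω r)) ∧
    Integrable (fun r => Q p (ω r) (Dω r)) (volume.restrict (Ioc s t)) := by
  have hp := h.two_le
  have ha : 0 ≤ (p - 2) / 2 := by linarith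
  have hap : 2 * ((p - 2) / 2) + 2 = p := by ring
  have hδ : ∀ k : ℕ, (0 : ℝ) < 1 / ((k : ℝ) + 1) := fun k => by positivity
  obtain ⟨L, hL⟩ := h.exists_integral_wDissip_cutoff_le hC hη hc h1 h2 hst hsub
  set G : ℕ → ℝ → ℝ := fun k r =>
    wDissip ((p - 2) / 2) (1 / ((k : ℝ) + 1)) (η k) (ω r) (Dω r) with hG
  have hGi : ∀ k, Integrable (G k) (volume.restrict (Ioc s t)) := fun k =>
    h.integrable_wDissip_time ha hap.le (hδ k) (hη k) (hc k) hst hsub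
  have hG0 : ∀ k r, 0 ≤ G k r := fun k r => Slice.wDissip_nonneg (hδ k).le
  -- Fatou in time: bounded time integrals force a finite lower limit at almost every time. At such
  -- a time Fatou in space gives integrability of the untruncated density.
  have hfin : ∀ᵐ r ∂volume.restrict (Ioc s t), liminf (fun k => ‖G k r‖ₑ) atTop < ⊤ := by
    have hme : ∀ k, AEMeasurable (fun r => ‖G k r‖ₑ) (volume.restrict (Ioc s t)) :=
      fun k => (hGi k).1.aemeasurable.enorm
    refine ae_lt_top' ⟨_, Measurable.liminf fun k => (hme k).measurable_mk, ?_⟩ ?_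
    · filter_upwards [ae_all_iff.2 fun k => (hme k).ae_eq_mk] with r hr
      simp only [hr]
    refine ((lintegral_liminf_le' fun k => (hGi k).1.aemeasurable.enorm).trans_lt ?_).ne
    refine lt_of_le_of_lt (b := ENNReal.ofReal L) ?_ ENNReal.ofReal_lt_top
    refine liminf_le_of_le (by isBoundedDefault) fun b hb => ?_
    obtain ⟨k, hk⟩ := hb.exists
    refine hk.trans ?_
    have e : ∫⁻ r in Ioc s t, ‖G k r‖ₑ = ENNReal.ofReal (∫ r in Ioc s t, G k r) := by
      rw [ofReal_integral_eq_lintegral_ofReal (hGi k) (Eventually.of_forall (hG0 k))]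
      exact lintegral_congr fun r => Real.enorm_eq_ofReal (hG0 k r)
    rw [e]
    exact ENNReal.ofReal_le_ofReal (hL k)
  have main : ∀ᵐ r ∂volume.restrict (Ioc s t),
      Integrable (dissipationDensity p (ω r) (Dω r)) volume ∧
      Tendsto (fun k => G k r) atTop (𝓝 (Q p (ω r) (Dω r))) ∧ ∀ k, G k r ≤ Q p (ω r) (Dω r) := by
    filter_upwards [h.ae_slice_Ioc hsub, hfin] with r ⟨s1, s2, hr⟩ hrfin
    set g : ℕ → Space m → ℝ := fun k x => η k x ^ 2 *
      (wt ((p - 2) / 2) ((p - 2) / 2 + 1 / 3) (1 / ((k : ℝ) + 1)) (‖ω r x‖ ^ 2) *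
        gradSq (Dω r) x) with hg
    have hgi : ∀ k, Integrable (g k) volume := fun k =>
      (s1.tendsto_wDissip ha (hδ k) (hη k).continuous (hc k)).1
    have hgb : ∀ k x, 0 ≤ g k x ∧ g k x ≤ dissipationDensity p (ω r) (Dω r) x := fun k x =>
      truncated_density_le hp (hδ k) (h1 k) _ _ x
    have hglim : ∀ x, Tendsto (fun k => g k x) atTop (𝓝 (dissipationDensity p (ω r) (Dω r) x)) := by
      intro x
      have t1 := tendsto_wt_one_div (a := (p - 2) / 2) (κ := (p - 2) / 2 + 1 / 3) (‖ω r x‖ ^ 2)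
      have t2 := ((h3 x).pow 2).mul (t1.mul_const (gradSq (Dω r) x))
      rw [one_pow, one_mul, sq_rpow_eq _ (norm_nonneg _),
        show 2 * ((p - 2) / 2) = p - 2 by ring] at t2
      exact t2
    have hgG : ∀ k, ∫⁻ x, ‖g k x‖ₑ = ‖G k r‖ₑ := by
      intro k
      rw [Real.enorm_eq_ofReal (hG0 k r)]
      change _ = ENNReal.ofReal (∫ x, g k x)
      rw [ofReal_integral_eq_lintegral_ofReal (hgi k) (Eventually.of_forall fun x => (hgb k x).1)]
      exact lintegral_congr fun x => Real.enorm_eq_ofReal (hgb k x).1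
    have hint : Integrable (dissipationDensity p (ω r) (Dω r)) volume := by
      refine integrable_of_tendsto_of_liminf (Eventually.of_forall hglim) (fun k => (hgi k).1) ?_
      simp only [hgG]
      exact hrfin.ne
    refine ⟨hint, ?_, fun k => integral_mono (hgi k) hint fun x => (hgb k x).2⟩
    refine tendsto_integral_of_dominated_convergence _ (fun k => (hgi k).1) hint
      (fun k => Eventually.of_forall fun x => ?_) (Eventually.of_forall hglim)
    rw [Real.norm_eq_abs, abs_of_nonneg (hgb k x).1]
    exact (hgb k x).2
  refine ⟨main, (integrable_of_tendsto_of_integral_le hGi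
    (fun k => Eventually.of_forall (hG0 k)) ?_ tendsto_const_nhds hL).1⟩
  exact main.mono fun r hr => hr.2.1

lemma tendsto_energy_cutoff (hp : 2 ≤ p) {f : Space m → Space m}
    (hf : MemLp f (ENNReal.ofReal p) volume) {η : ℕ → Space m → ℝ}
    (hη : ∀ k, ContDiff ℝ 1 (η k)) (h1 : ∀ k x, η k x ^ 2 ≤ 1)
    (h3 : ∀ x, Tendsto (fun k => η k x) atTop (𝓝 1)) :
    Tendsto (fun k : ℕ => energy ((p - 2) / 2) (1 / ((k : ℝ) + 1)) (fun x => η k x ^ 2) f) atTop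
      (𝓝 (lpNorm f (ENNReal.ofReal p) volume ^ p / p)) := by
  have ha : 0 ≤ (p - 2) / 2 := by linarith
  have hap : 2 * ((p - 2) / 2) + 2 = p := by ring
  have hδ : ∀ k : ℕ, (0 : ℝ) < 1 / ((k : ℝ) + 1) := fun k => by positivity
  have hi := memLp_integrable_rpow hp hf
  rw [lpNorm_rpow_eq hp hf, ← integral_div]
  refine tendsto_integral_of_dominated_convergence (fun x => ‖f x‖ ^ p) (fun k => ?_) hi
    (fun k => Eventually.of_forall fun x => ?_) (Eventually.of_forall fun x => ?_)
  · exact ((hη k).continuous.pow 2).aestronglyMeasurable.mul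
      ((contDiff_potential ha (hδ k).le).continuous.comp_aestronglyMeasurable hf.1)
  · have k0 := potential_nonneg (a := (p - 2) / 2) (κ := (p - 2) / 2 + 1 / 3) (hδ k).le (f x)
    have k1 := potential_le (κ := (p - 2) / 2 + 1 / 3) ha (by linarith) (hδ k).le (f x)
    rw [hap] at k1
    rw [Real.norm_eq_abs, abs_of_nonneg (by positivity)]
    exact (mul_le_of_le_one_left k0 (h1 k x)).trans k1
  · have t1 := ((h3 x).pow 2).mul (tendsto_potential (κ := (p - 2) / 2 + 1 / 3) ha
      (by linarith) (f x))
    rw [one_pow, one_mul, hap] at t1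
    exact t1

end Evolution

/-! ### The residual in terms of the full dissipation -/

namespace Slice

variable {m : ℕ} {a ε p ν N C B : ℝ} {v f : Space m → Space m} {Dv Df : Fin m → Space m → Space m}
  {η : Space m → ℝ}

/-- The residual is controlled by the velocity times the dissipation, up to a cutoff error. -/
lemma abs_residual_le (h : Slice p v f Dv Df) (hν : 0 ≤ ν) (hap : 2 * a + 2 = p) (ha : 0 ≤ a)
    (hε : 0 < ε) (hε1 : ε ≤ 1) (hη : ContDiff ℝ 1 η) (hc : HasCompactSupport η) (hC : 0 ≤ C)
    (hcut : ∀ x, cutGradSq η x ≤ C * ε ^ 2) (hQ : wDissip a ε η f Df ≤ Q p f Df)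
    (hN : lpNorm f (ENNReal.ofReal p) volume ^ p ≤ N) (hB : lpNorm v (m : ℝ≥0∞) volume ≤ B) :
    |residual ν a ε (fun x => η x ^ 2) v f Dv Df| ≤
      2 * gradConst a ^ 2 * sobConst m * (lpNorm v (m : ℝ≥0∞) volume * Q p f Df) +
      ε * ((ν + 2 * gradConst a ^ 2) * Q p f Df +
        (ν + 2 * gradConst a ^ 2 * (sobConst m * B + 1)) * (C * N)) := by
  -- No splitting is wanted here: the whole velocity is taken as `v₁`, the remainder is zero, and
  -- `l` equals the truncation parameter `ε`, so its contribution vanishes in the limit.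
  have b1 := h.abs_transForm_le ha hε hη hc h.memLp_v (M := 0) (by simp) hε
  have b2 := h.abs_crossForm_le ha hε hη hc hε
  have b3 : wCut a ε η f ≤ C * ε ^ 2 * N := by
    refine (integral_weight_le' h.two_le h.memLp_f' (cutGradSq_nonneg η) hcut
      (fun x => (wt_mul_sq_le ha hε.le (f x)).1)
      (fun x => (wt_mul_sq_le ha hε.le (f x)).2.trans (by rw [hap]))).trans ?_
    exact mul_le_mul_of_nonneg_left hN (by positivity)
  have b4 : 0 ≤ wCut a ε η f := wCut_nonneg hε.le
  have b5 : 0 ≤ wDissip a ε η f Df := wDissip_nonneg hε.le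
  have hS := sobConst_nonneg m
  have hl : 0 ≤ lpNorm v (m : ℝ≥0∞) volume := lpNorm_nonneg
  have hN0 : 0 ≤ N := le_trans (Real.rpow_nonneg lpNorm_nonneg _) hN
  have hg : 0 ≤ 2 * gradConst a ^ 2 := by positivity
  generalize lpNorm v (m : ℝ≥0∞) volume = L at *
  generalize 2 * gradConst a ^ 2 = g at *
  generalize sobConst m = S at *
  generalize wCut a ε η f = W at *
  generalize wDissip a ε η f Df = D at *
  generalize Q p f Df = R at *
  have hCN : 0 ≤ C * N := mul_nonneg hC hN0
  -- The squared cutoff gradient is of order `ε²` whereas completing the square costs `1 / ε`; the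
  -- product still tends to zero.
  have e1 : 1 / ε * W ≤ ε * (C * N) := by
    calc 1 / ε * W ≤ 1 / ε * (C * ε ^ 2 * N) := by gcongr
      _ = ε * (C * N) := by field_simp
  have e2 : W ≤ ε * (C * N) := by
    refine b3.trans ?_
    have : ε ^ 2 ≤ ε := by nlinarith
    calc C * ε ^ 2 * N = ε ^ 2 * (C * N) := by ring
      _ ≤ ε * (C * N) := by gcongr
  have e3 : ν * |crossForm a ε (fun x => η x ^ 2) f Df| ≤ ν * (ε * R + ε * (C * N)) :=
    mul_le_mul_of_nonneg_left (b2.trans (add_le_add (by gcongr) e1)) hν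
  have e4 : (S * L + ε) * (g * (W + D)) ≤ (S * L + ε) * (g * (ε * (C * N) + R)) := by gcongr
  have e5 : (S * L + ε) * (g * (ε * (C * N))) ≤ (S * B + 1) * (g * (ε * (C * N))) := by gcongr
  have e6 : |residual ν a ε (fun x => η x ^ 2) v f Dv Df| ≤
      ν * |crossForm a ε (fun x => η x ^ 2) f Df| +
        |transForm a ε (fun x => η x ^ 2) f (nonlin v f Dv Df)| := by
    unfold residual
    refine (abs_sub _ _).trans ?_
    rw [abs_neg, abs_mul, abs_of_nonneg hν]
  simp only [ne_eq, OfNat.ofNat_ne_zero, not_false_eq_true, zero_pow, zero_div, zero_mul,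
    add_zero] at b1
  nlinarith

end Slice

/-! ### Two-sided bounds for the increments of the norm -/

namespace Evolution

variable {m : ℕ} {p ν : ℝ} {T : EReal} {u ω : ℝ → Space m → Space m}
  {Du Dω : ℝ → Fin m → Space m → Space m} {s t : ℝ}

lemma integrable_dissipation (h : Evolution p ν T u ω Du Dω) (hst : s ≤ t)
    (hsub : Icc s t ⊆ openTimes T) :
    (∀ᵐ r ∂volume.restrict (Ioc s t), Integrable (dissipationDensity p (ω r) (Dω r)) volume) ∧
    Integrable (fun r => Q p (ω r) (Dω r)) (volume.restrict (Ioc s t)) ∧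
    Integrable (fun r => lpNorm (u r) (m : ℝ≥0∞) volume * Q p (ω r) (Dω r))
      (volume.restrict (Ioc s t)) := by
  obtain ⟨η, C, hC, hη, hc, h1, h2, h3⟩ := exists_cutoffs m
  have hQ := h.integrable_Q hC hη hc h1 h2 h3 hst hsub
  obtain ⟨B, hB0, hB⟩ := h.exists_bound_norms hsub
  refine ⟨hQ.1.mono fun r hr => hr.1, hQ.2, hQ.2.bdd_mul (c := B)
    (integrableOn_of_continuousOn (h.velocity.continuousOn_lpNorm h.one_le_m) hsub).1 ?_⟩
  rw [ae_restrict_iff' measurableSet_Ioc]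
  refine Eventually.of_forall fun r hr => ?_
  rw [Real.norm_eq_abs, abs_of_nonneg lpNorm_nonneg]
  exact (hB r (Ioc_subset_Icc_self hr)).1

/-- The two-sided integrated energy estimate. -/
lemma energy_estimate (h : Evolution p ν T u ω Du Dω) (hst : s ≤ t)
    (hsub : Icc s t ⊆ openTimes T) :
    (lpNorm (ω t) (ENNReal.ofReal p) volume ^ p / p -
        lpNorm (ω s) (ENNReal.ofReal p) volume ^ p / p ≤
      2 * gradConst ((p - 2) / 2) ^ 2 * sobConst m *
        (∫ r in Ioc s t, lpNorm (u r) (m : ℝ≥0∞) volume * Q p (ω r) (Dω r)) -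
      ν * (1 / 3 * ∫ r in Ioc s t, Q p (ω r) (Dω r))) ∧
    (-(2 * gradConst ((p - 2) / 2) ^ 2 * sobConst m *
        (∫ r in Ioc s t, lpNorm (u r) (m : ℝ≥0∞) volume * Q p (ω r) (Dω r))) -
      ν * ((1 + 2 * ((p - 2) / 2 + ((p - 2) / 2 + 1 / 3))) * ∫ r in Ioc s t, Q p (ω r) (Dω r)) ≤
      lpNorm (ω t) (ENNReal.ofReal p) volume ^ p / p -
        lpNorm (ω s) (ENNReal.ofReal p) volume ^ p / p) := by
  have hp := h.two_le
  have hν := h.visc_pos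
  obtain ⟨η, C, hC, hη, hc, h1, h2, h3⟩ := exists_cutoffs m
  have hQ := h.integrable_Q hC hη hc h1 h2 h3 hst hsub
  obtain ⟨_, hQi, hLQ⟩ := h.integrable_dissipation hst hsub
  obtain ⟨B, hB0, hB⟩ := h.exists_bound_norms hsub
  have ha : 0 ≤ (p - 2) / 2 := by linarith
  have hap : 2 * ((p - 2) / 2) + 2 = p := by ring
  generalize (p - 2) / 2 = a at *
  set ε : ℕ → ℝ := fun k => 1 / ((k : ℝ) + 1) with hε
  have hε0 : ∀ k, 0 < ε k := fun k => by simp only [hε]; positivity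
  have hε1 : ∀ k, ε k ≤ 1 := fun k => by
    simp only [hε]
    rw [div_le_one (by positivity)]; linarith [(Nat.cast_nonneg k : (0 : ℝ) ≤ k)]
  have hεlim : Tendsto ε atTop (𝓝 0) := tendsto_one_div_add_atTop_nhds_zero_nat (𝕜 := ℝ)
  set g := 2 * gradConst a ^ 2 with hg
  set I : ℕ → ℝ := fun k =>
    ∫ r in Ioc s t, residual ν a (ε k) (fun x => η k x ^ 2) (u r) (ω r) (Du r) (Dω r) with hI
  set W : ℕ → ℝ := fun k => ∫ r in Ioc s t, wDissip a (ε k) (η k) (ω r) (Dω r) with hW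
  set X := ∫ r in Ioc s t, lpNorm (u r) (m : ℝ≥0∞) volume * Q p (ω r) (Dω r) with hX
  set Z : ℝ → ℝ := fun r => (ν + g) * Q p (ω r) (Dω r) +
    (ν + g * (sobConst m * B + 1)) * (C * B ^ p) with hZ
  have hZi : Integrable Z (volume.restrict (Ioc s t)) :=
    (hQi.const_mul _).add (integrable_const _)
  -- Everything except the term `‖u‖_m Q_p` carries a factor `ε k`. Since the absolute value is
  -- controlled, the same estimate serves for the upper and the lower bound.
  have hIle : ∀ k, |I k| ≤ g * sobConst m * X + ε k * ∫ r in Ioc s t, Z r := by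
    intro k
    rw [hX, ← integral_const_mul, ← integral_const_mul,
      ← integral_add (hLQ.const_mul _) (hZi.const_mul _), ← Real.norm_eq_abs]
    refine norm_integral_le_of_norm_le ((hLQ.const_mul _).add (hZi.const_mul _)) ?_
    filter_upwards [h.ae_slice_Ioc hsub, hQ.1] with r ⟨s1, s2, hr⟩ hr2
    exact s1.abs_residual_le hν.le hap ha (hε0 k) (hε1 k) (hη k) (hc k) hC (h2 k) (hr2.2.2 k)
      (Real.rpow_le_rpow lpNorm_nonneg (hB r hr).2.2 (by linarith)) (hB r hr).1
  have hWi : ∀ k, Integrable (fun r => wDissip a (ε k) (η k) (ω r) (Dω r))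
      (volume.restrict (Ioc s t)) := fun k =>
    h.integrable_wDissip_time ha hap.le (hε0 k) (hη k) (hc k) hst hsub
  have hWlim : Tendsto W atTop (𝓝 (∫ r in Ioc s t, Q p (ω r) (Dω r))) := by
    refine tendsto_integral_of_dominated_convergence _ (fun k => (hWi k).1) hQi (fun k => ?_)
      (hQ.1.mono fun r hr => hr.2.1)
    filter_upwards [hQ.1] with r hr
    rw [Real.norm_eq_abs, abs_of_nonneg (Slice.wDissip_nonneg (hε0 k).le)]
    exact hr.2.2 k
  have hD : ∀ k, 1 / 3 * W k ≤ ∫ r in Ioc s t, dissipForm a (ε k) (fun x => η k x ^ 2) (ω r) (Dω r) ∧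
      ∫ r in Ioc s t, dissipForm a (ε k) (fun x => η k x ^ 2) (ω r) (Dω r) ≤
        (1 + 2 * (a + (a + 1 / 3))) * W k := by
    intro k
    have hDi := (h.energy_inequality ha hap.le (hε0 k) (hη k) (hc k) hst hsub).1
    simp only [hW]
    rw [← integral_const_mul, ← integral_const_mul]
    constructor
    · refine integral_mono_ae ((hWi k).const_mul _) hDi ?_
      filter_upwards [h.ae_slice_Ioc hsub] with r hr
      exact (hr.1.dissipForm_bounds ha (hε0 k) (hη k).continuous (hc k)).1
    · refine integral_mono_ae hDi ((hWi k).const_mul _) ?_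
      filter_upwards [h.ae_slice_Ioc hsub] with r hr
      exact (hr.1.dissipForm_bounds ha (hε0 k) (hη k).continuous (hc k)).2
  have hE : ∀ r ∈ Icc s t, Tendsto (fun k => energy a (ε k) (fun x => η k x ^ 2) (ω r)) atTop
      (𝓝 (lpNorm (ω r) (ENNReal.ofReal p) volume ^ p / p)) := by
    intro r hr
    have := tendsto_energy_cutoff hp (h.vorticity'.1 r (openTimes_subset (hsub hr))) hη h1 h3
    rwa [show (p - 2) / 2 = a by linarith] at this
  have hdiff := (hE t (right_mem_Icc.2 hst)).sub (hE s (left_mem_Icc.2 hst))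
  have hid := fun k => h.energy_identity ha hap.le (hε0 k) (hη k) (hc k) hst hsub
  have herr : Tendsto (fun k => g * sobConst m * X + ε k * ∫ r in Ioc s t, Z r) atTop
      (𝓝 (g * sobConst m * X)) := by
    simpa using (hεlim.mul_const (∫ r in Ioc s t, Z r)).const_add (g * sobConst m * X)
  constructor
  · refine le_of_tendsto_of_tendsto' hdiff (herr.sub ((hWlim.const_mul (1 / 3)).const_mul ν))
      fun k => ?_
    rw [hid k]
    exact sub_le_sub ((le_abs_self _).trans (hIle k)) (mul_le_mul_of_nonneg_left (hD k).1 hν.le)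
  · refine le_of_tendsto_of_tendsto' (herr.neg.sub ((hWlim.const_mul _).const_mul ν)) hdiff
      fun k => ?_
    rw [hid k]
    exact sub_le_sub ((neg_le_neg (hIle k)).trans (neg_abs_le _))
      (mul_le_mul_of_nonneg_left (hD k).2 hν.le)

end Evolution

/-! ### Functions with integrably bounded increments -/

section RealAnalysis

variable {N k l : ℝ → ℝ} {a b : ℝ}

/-- A function with increments between the integrals of two integrable functions is absolutely
continuous. -/
lemma absolutelyContinuousOnInterval_of_increments (hab : a ≤ b)
    (hk : IntegrableOn k (Ioc a b)) (hl : IntegrableOn l (Ioc a b))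
    (hkN : ∀ s t, a ≤ s → s ≤ t → t ≤ b → N t - N s ≤ ∫ r in Ioc s t, k r)
    (hlN : ∀ s t, a ≤ s → s ≤ t → t ≤ b → ∫ r in Ioc s t, l r ≤ N t - N s) :
    AbsolutelyContinuousOnInterval N a b := by
  have hg : IntegrableOn (fun r => |k r| + |l r|) (Ioc a b) := hk.abs.add hl.abs
  have hg' : IntervalIntegrable (fun r => |k r| + |l r|) volume a b :=
    (intervalIntegrable_iff_integrableOn_Ioc_of_le hab).2 hg
  -- The increments of `N` are dominated by those of `G`, a primitive of an integrable function, and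
  -- absolute continuity is inherited.
  set G : ℝ → ℝ := fun x => ∫ r in a..x, (|k r| + |l r|) with hG
  have key : ∀ s t, a ≤ s → s ≤ t → t ≤ b → dist (N s) (N t) ≤ dist (G s) (G t) := by
    intro s t h1 h2 h3
    have hsub : Ioc s t ⊆ Ioc a b := Ioc_subset_Ioc h1 h3
    have e : G t - G s = ∫ r in Ioc s t, (|k r| + |l r|) := by
      rw [← intervalIntegral.integral_of_le h2]
      exact intervalIntegral.integral_interval_sub_left
        (hg'.mono_set (by rw [uIcc_of_le hab, uIcc_of_le (h1.trans h2)]; exact Icc_subset_Icc_right h3))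
        (hg'.mono_set (by rw [uIcc_of_le hab, uIcc_of_le h1]; exact Icc_subset_Icc_right (h2.trans h3)))
    have hgs := hg.mono_set hsub
    have b1 : ∫ r in Ioc s t, k r ≤ ∫ r in Ioc s t, (|k r| + |l r|) :=
      integral_mono (hk.mono_set hsub) hgs fun r => by
        have := le_abs_self (k r); have := abs_nonneg (l r); simp only; linarith
    have b2 : -∫ r in Ioc s t, (|k r| + |l r|) ≤ ∫ r in Ioc s t, l r := by
      rw [← integral_neg]
      exact integral_mono hgs.neg (hl.mono_set hsub) fun r => by
        have := neg_abs_le (l r); have := abs_nonneg (k r); simp only; linarith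
    rw [dist_comm, dist_comm (G s), Real.dist_eq, Real.dist_eq, e]
    refine le_trans ?_ (le_abs_self _)
    exact abs_le.2 ⟨b2.trans (hlN s t h1 h2 h3), (hkN s t h1 h2 h3).trans b1⟩
  have hAC := hg'.absolutelyContinuousOnInterval_intervalIntegral (left_mem_uIcc (a := a) (b := b))
  rw [absolutelyContinuousOnInterval_iff] at hAC ⊢
  intro ε hε
  obtain ⟨δ, hδ, H⟩ := hAC ε hε
  refine ⟨δ, hδ, fun E hE hlen => lt_of_le_of_lt (Finset.sum_le_sum fun i hi => ?_) (H E hE hlen)⟩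
  obtain ⟨m1, m2⟩ := hE.1 i hi
  rw [uIcc_of_le hab] at m1 m2
  rcases le_total (E.2 i).1 (E.2 i).2 with h | h
  · exact key _ _ m1.1 h m2.2
  · rw [dist_comm, dist_comm (∫ r in a..(E.2 i).1, _)]
    exact key _ _ m2.1 h m1.2

/-- The derivative of an absolutely continuous function is at most the integrand bounding its
increments. -/
lemma ae_deriv_le_of_increments (hab : a ≤ b) (hAC : AbsolutelyContinuousOnInterval N a b)
    (hk : IntegrableOn k (Ioc a b))
    (hkN : ∀ s t, a ≤ s → s ≤ t → t ≤ b → N t - N s ≤ ∫ r in Ioc s t, k r) :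
    ∀ᵐ t, t ∈ Ioo a b → DifferentiableAt ℝ N t ∧ deriv N t ≤ k t := by
  have hk' : IntervalIntegrable k volume a b :=
    (intervalIntegrable_iff_integrableOn_Ioc_of_le hab).2 hk
  filter_upwards [hAC.ae_differentiableAt, hk'.ae_hasDerivAt_integral] with t h1 h2 ht
  rw [uIcc_of_le hab] at h1 h2
  have hd := h1 (Ioo_subset_Icc_self ht)
  have hi := h2 (Ioo_subset_Icc_self ht) a (left_mem_Icc.2 hab)
  refine ⟨hd, ?_⟩
  -- The primitive of `k` minus `N` is nondecreasing, so its derivative is nonnegative wherever `N`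
  -- is differentiable and the Lebesgue differentiation theorem holds for `k`.
  have hmono : MonotoneOn (fun x => (∫ r in a..x, k r) - N x) (Icc a b) := by
    intro x hx y hy hxy
    have e : (∫ r in a..y, k r) - (∫ r in a..x, k r) = ∫ r in Ioc x y, k r := by
      rw [← intervalIntegral.integral_of_le hxy]
      exact intervalIntegral.integral_interval_sub_left
        (hk'.mono_set (by rw [uIcc_of_le hab, uIcc_of_le hy.1]; exact Icc_subset_Icc_right hy.2))
        (hk'.mono_set (by rw [uIcc_of_le hab, uIcc_of_le hx.1]; exact Icc_subset_Icc_right hx.2))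
    have := hkN x y hx.1 hxy hy.2
    simp only
    linarith
  have h3 := hmono.derivWithin_nonneg (x := t)
  rw [derivWithin_of_mem_nhds (Icc_mem_nhds ht.1 ht.2), (hi.fun_sub hd.hasDerivAt).deriv] at h3
  linarith

end RealAnalysis

/-! ### Exhausting the open time interval -/

section Times

variable {T : EReal}

lemma Icc_subset_openTimes {s t : ℝ} (hs : s ∈ openTimes T) (ht : t ∈ openTimes T) :
    Icc s t ⊆ openTimes T := fun _ hr =>
  ⟨hs.1.trans_le hr.1, lt_of_le_of_lt (EReal.coe_le_coe_iff.2 hr.2) ht.2⟩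

lemma exists_Icc_subset_openTimes {r : ℝ} (hr : r ∈ openTimes T) :
    ∃ s t : ℚ, (s : ℝ) < r ∧ r < t ∧ Icc (s : ℝ) t ⊆ openTimes T := by
  obtain ⟨ε, hε, h⟩ := Metric.isOpen_iff.1 (isOpen_openTimes (T := T)) r hr
  obtain ⟨s, hs1, hs2⟩ := exists_rat_btwn (show r - ε < r by linarith)
  obtain ⟨t, ht1, ht2⟩ := exists_rat_btwn (show r < r + ε by linarith)
  refine ⟨s, t, hs2, ht1, fun x hx => h ?_⟩
  rw [Metric.mem_ball, Real.dist_eq, abs_lt]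
  constructor <;> linarith [hx.1, hx.2]

/-- A property holds almost everywhere in `(0, T)` if it does in every compact subinterval. -/
lemma ae_openTimes {P : ℝ → Prop}
    (h : ∀ s t : ℝ, s ≤ t → Icc s t ⊆ openTimes T → ∀ᵐ r, r ∈ Ioo s t → P r) :
    ∀ᵐ r, r ∈ openTimes T → P r := by
  -- Rational endpoints make the union of exceptional null sets countable.
  have h' : ∀ s t : ℚ, ∀ᵐ r : ℝ, Icc (s : ℝ) t ⊆ openTimes T → r ∈ Ioo (s : ℝ) t → P r := by
    intro s t
    by_cases hsub : (s : ℝ) ≤ t ∧ Icc (s : ℝ) t ⊆ openTimes T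
    · filter_upwards [h s t hsub.1 hsub.2] with r hr _ using hr
    · refine Eventually.of_forall fun r h1 h2 => absurd ⟨h2.1.le.trans h2.2.le, h1⟩ hsub
  filter_upwards [ae_all_iff.2 fun s => ae_all_iff.2 (h' s)] with r hr hmem
  obtain ⟨s, t, h1, h2, h3⟩ := exists_Icc_subset_openTimes hmem
  exact hr s t h3 ⟨h1, h2⟩

end Times

/-- A continuous function on a compact interval that is antitone in the interior does not
increase between the endpoints. -/
lemma le_of_antitone_interior {N : ℝ → ℝ} {s t : ℝ} (hst : s < t) (hN : ContinuousOn N (Icc s t))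
    (h : ∀ x y, s < x → x ≤ y → y < t → N y ≤ N x) : N t ≤ N s := by
  obtain ⟨c, hc1, hc2⟩ := exists_between hst
  have h1 : Tendsto N (𝓝[>] s) (𝓝 (N s)) :=
    ((hN s (left_mem_Icc.2 hst.le)).mono_left
      (nhdsWithin_le_iff.2 (Icc_mem_nhdsGT hst)))
  have h2 : Tendsto N (𝓝[<] t) (𝓝 (N t)) :=
    ((hN t (right_mem_Icc.2 hst.le)).mono_left
      (nhdsWithin_le_iff.2 (Icc_mem_nhdsLT hst)))
  have h3 : N c ≤ N s := by
    refine ge_of_tendsto h1 ?_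
    filter_upwards [Ioo_mem_nhdsGT hc1] with x hx
    exact h x c hx.1 hx.2.le hc2
  have h4 : N t ≤ N c := by
    refine le_of_tendsto h2 ?_
    filter_upwards [Ioo_mem_nhdsLT hc2] with x hx
    exact h c x hc1 hx.1.le hx.2
  exact h4.trans h3

lemma Q_nonneg {m : ℕ} (p : ℝ) (f : Space m → Space m) (D : Fin m → Space m → Space m) :
    0 ≤ Q p f D :=
  integral_nonneg fun _ => mul_nonneg (Real.rpow_nonneg (norm_nonneg _) _)
    (Finset.sum_nonneg fun _ _ => sq_nonneg _)

/-! ### Rates of change, absolute continuity and monotonicity -/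

namespace Evolution

variable {m : ℕ} {p ν : ℝ} {T : EReal} {u ω : ℝ → Space m → Space m}
  {Du Dω : ℝ → Fin m → Space m → Space m} {s t : ℝ}

/-- The constant comparing stretching with dissipation. -/
def stretchConst (m : ℕ) (p : ℝ) : ℝ := 2 * gradConst ((p - 2) / 2) ^ 2 * sobConst m

lemma stretchConst_nonneg (m : ℕ) (p : ℝ) : 0 ≤ stretchConst m p :=
  mul_nonneg (by positivity) (sobConst_nonneg m)

/-- The upper rate of change of `‖ω‖_p^p`. -/
def upperRate (p ν : ℝ) (u ω : ℝ → Space m → Space m) (Dω : ℝ → Fin m → Space m → Space m)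
    (r : ℝ) : ℝ :=
  -(p / 3) * (ν - (3 * stretchConst m p + 1) * lpNorm (u r) (m : ℝ≥0∞) volume) * Q p (ω r) (Dω r)

/-- The lower rate of change of `‖ω‖_p^p`. -/
def lowerRate (p ν : ℝ) (u ω : ℝ → Space m → Space m) (Dω : ℝ → Fin m → Space m → Space m)
    (r : ℝ) : ℝ :=
  -(p * stretchConst m p) * (lpNorm (u r) (m : ℝ≥0∞) volume * Q p (ω r) (Dω r)) +
    -(p * (ν * (1 + 2 * ((p - 2) / 2 + ((p - 2) / 2 + 1 / 3))))) * Q p (ω r) (Dω r)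

lemma upperRate_eq (r : ℝ) : upperRate p ν u ω Dω r =
    p / 3 * (3 * stretchConst m p + 1) * (lpNorm (u r) (m : ℝ≥0∞) volume * Q p (ω r) (Dω r)) +
      -(p / 3 * ν) * Q p (ω r) (Dω r) := by
  unfold upperRate
  ring

lemma integrable_upperRate (h : Evolution p ν T u ω Du Dω) (hst : s ≤ t)
    (hsub : Icc s t ⊆ openTimes T) : IntegrableOn (upperRate p ν u ω Dω) (Ioc s t) := by
  obtain ⟨_, h1, h2⟩ := h.integrable_dissipation hst hsub
  rw [funext (upperRate_eq (p := p) (ν := ν) (u := u) (ω := ω) (Dω := Dω))]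
  exact (h2.const_mul _).add (h1.const_mul _)

lemma integrable_lowerRate (h : Evolution p ν T u ω Du Dω) (hst : s ≤ t)
    (hsub : Icc s t ⊆ openTimes T) : IntegrableOn (lowerRate p ν u ω Dω) (Ioc s t) := by
  obtain ⟨_, h1, h2⟩ := h.integrable_dissipation hst hsub
  exact (h2.const_mul _).add (h1.const_mul _)

/-- The energy estimate is multiplied by `p`. The additional `1` next to `3 * stretchConst m p` only
enlarges the right-hand side, since `‖u‖_m Q_p ≥ 0`. -/
lemma sub_le_integral_upperRate (h : Evolution p ν T u ω Du Dω) (hst : s ≤ t)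
    (hsub : Icc s t ⊆ openTimes T) :
    lpNorm (ω t) (ENNReal.ofReal p) volume ^ p - lpNorm (ω s) (ENNReal.ofReal p) volume ^ p ≤
      ∫ r in Ioc s t, upperRate p ν u ω Dω r := by
  have hp := h.two_le
  obtain ⟨_, h1, h2⟩ := h.integrable_dissipation hst hsub
  have h3 := (h.energy_estimate hst hsub).1
  have h4 : 0 ≤ ∫ r in Ioc s t, lpNorm (u r) (m : ℝ≥0∞) volume * Q p (ω r) (Dω r) :=
    integral_nonneg fun r => mul_nonneg lpNorm_nonneg (Q_nonneg _ _ _)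
  rw [← sub_div, div_le_iff₀ (by linarith)] at h3
  refine h3.trans ?_
  rw [funext (upperRate_eq (p := p) (ν := ν) (u := u) (ω := ω) (Dω := Dω)),
    integral_add (h2.const_mul _) (h1.const_mul _), integral_const_mul, integral_const_mul]
  have h5 := mul_nonneg (show 0 ≤ p / 3 by linarith) h4
  unfold stretchConst
  nlinarith

/-- This one-sided bound serves absolute continuity alone: an upper bound on increments would not
exclude downward jumps or singular decrease. -/
lemma integral_lowerRate_le_sub (h : Evolution p ν T u ω Du Dω) (hst : s ≤ t)
    (hsub : Icc s t ⊆ openTimes T) :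
    ∫ r in Ioc s t, lowerRate p ν u ω Dω r ≤
    lpNorm (ω t) (ENNReal.ofReal p) volume ^ p - lpNorm (ω s) (ENNReal.ofReal p) volume ^ p := by
  have hp := h.two_le
  obtain ⟨_, h1, h2⟩ := h.integrable_dissipation hst hsub
  have h3 := (h.energy_estimate hst hsub).2
  rw [← sub_div, le_div_iff₀ (by linarith)] at h3
  refine le_trans (le_of_eq ?_) h3
  unfold lowerRate stretchConst
  rw [integral_add (h2.const_mul _) (h1.const_mul _), integral_const_mul, integral_const_mul]
  ring

lemma absolutelyContinuous_lpNorm (h : Evolution p ν T u ω Du Dω) (hst : s ≤ t)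
    (hsub : Icc s t ⊆ openTimes T) : AbsolutelyContinuousOnInterval
      (fun r => lpNorm (ω r) (ENNReal.ofReal p) volume ^ p) s t :=
  absolutelyContinuousOnInterval_of_increments hst (h.integrable_upperRate hst hsub)
    (h.integrable_lowerRate hst hsub)
    (fun _ _ h1 h2 h3 => h.sub_le_integral_upperRate h2 ((Icc_subset_Icc h1 h3).trans hsub))
    (fun _ _ h1 h2 h3 => h.integral_lowerRate_le_sub h2 ((Icc_subset_Icc h1 h3).trans hsub))

lemma locallyIntegrableOn_Q (h : Evolution p ν T u ω Du Dω) :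
    LocallyIntegrableOn (fun t => Q p (ω t) (Dω t)) (openTimes T) volume := by
  intro r hr
  obtain ⟨s, t, h1, h2, h3⟩ := exists_Icc_subset_openTimes hr
  exact ⟨Ioc s t, mem_nhdsWithin_of_mem_nhds (Ioc_mem_nhds h1 h2),
    (h.integrable_dissipation (h1.le.trans h2.le) h3).2.1⟩

/-- The equation gives information only on the open time interval, while `J` may contain the times
`0` and `T`. Monotonicity is proved between interior points and carried to the endpoints by
continuity of the norm. -/
lemma antitoneOn_lpNorm (h : Evolution p ν T u ω Du Dω) {J : Set ℝ} (hJT : J ⊆ closedTimes T)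
    (hJ : J.OrdConnected)
    (hu : ∀ t ∈ J, (3 * stretchConst m p + 1) * lpNorm (u t) (m : ℝ≥0∞) volume ≤ ν) :
    AntitoneOn (fun t => lpNorm (ω t) (ENNReal.ofReal p) volume) J := by
  intro s hs t ht hst
  have hp := h.two_le
  have hp1 : (1 : ℝ≥0∞) ≤ ENNReal.ofReal p := by
    rw [ENNReal.one_le_ofReal]; linarith
  rcases hst.eq_or_lt with rfl | hst
  · exact le_rfl
  have hsub : Icc s t ⊆ J := hJ.out hs ht
  refine le_of_antitone_interior (N := fun t => lpNorm (ω t) (ENNReal.ofReal p) volume) hst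
    ((h.vorticity'.continuousOn_lpNorm hp1).mono (hsub.trans hJT)) fun x y hx hxy hy => ?_
  have hopen : Icc x y ⊆ openTimes T := fun r hr =>
    ⟨(hJT hs).1.trans_lt (hx.trans_le hr.1),
      (EReal.coe_lt_coe_iff.2 (hr.2.trans_lt hy)).trans_le (hJT ht).2⟩
  have h1 : ∫ r in Ioc x y, upperRate p ν u ω Dω r ≤ 0 := by
    refine setIntegral_nonpos measurableSet_Ioc fun r hr => ?_
    have h2 := hu r (hsub ⟨hx.le.trans hr.1.le, hr.2.trans hy.le⟩)
    have h3 := Q_nonneg p (ω r) (Dω r)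
    have h4 := mul_nonneg (mul_nonneg (show 0 ≤ p / 3 by linarith) (sub_nonneg.2 h2)) h3
    unfold upperRate
    linarith
  have h5 := h.sub_le_integral_upperRate hxy hopen
  exact (Real.rpow_le_rpow_iff lpNorm_nonneg lpNorm_nonneg (by linarith)).1
    (show lpNorm (ω y) (ENNReal.ofReal p) volume ^ p ≤ lpNorm (ω x) (ENNReal.ofReal p) volume ^ p by
      linarith)

end Evolution

end

end Vorticity

theorem theorem4p1 (m : ℕ) (hm : 3 ≤ m) (p : ℝ) (hp : 2 ≤ p) :
    ∃ C : ℝ, 0 < C ∧ ∃ K : ℝ, 0 < K ∧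
      ∀ (ν : ℝ) (T : EReal) (u ω : ℝ → Vorticity.Space m → Vorticity.Space m)
        (Du Dω : ℝ → Fin m → Vorticity.Space m → Vorticity.Space m),
        0 < ν → 0 < T →
        Vorticity.ContinuousInLp (Vorticity.closedTimes T) (m : ℝ≥0∞) u →
        Vorticity.ContinuousInLp (Vorticity.closedTimes T) (ENNReal.ofReal p) u →
        Vorticity.HasGradientL1LocLp p T u Du →
        Vorticity.ContinuousInLp (Vorticity.closedTimes T) (m : ℝ≥0∞) ω →
        Vorticity.ContinuousInLp (Vorticity.closedTimes T) (ENNReal.ofReal p) ω →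
        Vorticity.HasGradientL1LocLp p T ω Dω →
        Vorticity.SolvesVorticityEquation ν T u ω Du Dω →
        -- `‖ω(t)‖_p^p` is locally absolutely continuous and `Q_p(ω(t))` locally integrable
        (∀ a ∈ Vorticity.openTimes T, ∀ b ∈ Vorticity.openTimes T,
          AbsolutelyContinuousOnInterval
            (fun t => lpNorm (ω t) (ENNReal.ofReal p) volume ^ p) a b) ∧
        (∀ᵐ t : ℝ, t ∈ Vorticity.openTimes T →
          Integrable (Vorticity.dissipationDensity p (ω t) (Dω t)) volume) ∧
        LocallyIntegrableOn (fun t => Vorticity.Q p (ω t) (Dω t)) (Vorticity.openTimes T) volume ∧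
        -- the differential inequality
        (∀ᵐ t : ℝ, t ∈ Vorticity.openTimes T →
          DifferentiableAt ℝ (fun s => lpNorm (ω s) (ENNReal.ofReal p) volume ^ p) t ∧
          deriv (fun s => lpNorm (ω s) (ENNReal.ofReal p) volume ^ p) t ≤
            -C * (ν - K * lpNorm (u t) (m : ℝ≥0∞) volume) * Vorticity.Q p (ω t) (Dω t)) ∧
        -- the Lyapunov property on every time interval on which `‖u(t)‖_m` is small
        (∀ J : Set ℝ, J ⊆ Vorticity.closedTimes T → J.OrdConnected →
          (∀ t ∈ J, K * lpNorm (u t) (m : ℝ≥0∞) volume ≤ ν) →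
          AntitoneOn (fun t => lpNorm (ω t) (ENNReal.ofReal p) volume) J) := by
  -- The `3` in both constants comes from the coercivity constant `1/3`, and `p` from the energy
  -- `‖ω‖_p^p / p`. Adding `1` makes `K` positive without knowing that the Sobolev constant is; both
  -- constants depend on `m` and `p` only.
  refine ⟨p / 3, by positivity, 3 * Vorticity.Evolution.stretchConst m p + 1, by
    have := Vorticity.Evolution.stretchConst_nonneg m p
    positivity, ?_⟩
  intro ν T u ω Du Dω hν hT hu hu' hDu hω hω' hDω hsol
  have h : Vorticity.Evolution p ν T u ω Du Dω := ⟨hp, hm, hν, hu, hu', hDu, hω, hω', hDω, hsol⟩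
  refine ⟨fun a ha b hb => ?_, Vorticity.ae_openTimes fun s t hst hsub => ?_,
    h.locallyIntegrableOn_Q, Vorticity.ae_openTimes fun s t hst hsub => ?_,
    fun J hJT hJ hJu => h.antitoneOn_lpNorm hJT hJ hJu⟩
  · rcases le_total a b with hab | hab
    · exact h.absolutelyContinuous_lpNorm hab (Vorticity.Icc_subset_openTimes ha hb)
    · exact (h.absolutelyContinuous_lpNorm hab (Vorticity.Icc_subset_openTimes hb ha)).symm
  · have h1 := (h.integrable_dissipation hst hsub).1
    rw [ae_restrict_iff' measurableSet_Ioc] at h1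
    filter_upwards [h1] with r hr hmem using hr (Ioo_subset_Ioc_self hmem)
  · exact Vorticity.ae_deriv_le_of_increments hst (h.absolutelyContinuous_lpNorm hst hsub)
      (h.integrable_upperRate hst hsub) fun _ _ h1 h2 h3 =>
        h.sub_le_integral_upperRate h2 ((Icc_subset_Icc h1 h3).trans hsub)
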